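/- **Setting.** For each $n\ge 1$ let $X=(X_1,\dots,X_n)\sim N(\theta,I_n)$ under $P_\theta$, with $\theta=\theta^{(n)}\in\mathbb R^n$ unknown. Write $\Phi$ for the standard normal distribution function, $s_\lambda(x)=\mathrm{sgn}(x)(|x|-\lambda)_+$ and $h_\lambda(x)=x\,I\{|x|>\lambda\}$ for the soft and hard threshold rules, and let univariate functions act on vectors coordinatewise. *Threshold level.* Fix $0<\alpha_2\le\alpha_1<1$ and put $\xi_{j,k}=-\Phi^{-1}\big(\alpha_j k/(2n)\big)$, $j=1,2$, $N(s)=\#\{i\le n: |X_i|\ge s\}$, $$\hat\xi_1=\min\{\xi_{1,k}: 1\le k\le n,\ N(\xi_{1,k})\ge k\},\qquad \hat\xi_2=\max\{\xi_{2,k}: 1\le k\le n,\ N(\xi_{2,k+1})<k+1\},$$ with $\hat\xi_1=\xi_{1,1}$ (the largest candidate level) when no $k$ satisfies $N(\xi_{1,k})\ge k$. Let $\hat\lambda$ be a (random) threshold level with $$\sqrt{1+\delta_{1,n}}\,\hat\xi_1\le\hat\lambda\le\sqrt{1+\delta_{2,n}}\,\hat\xi_2 ,\qquad 0\le\delta_{1,n}\le\delta_{2,n}\to0,$$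 where $\delta_{1,n},\delta_{2,n}$ are deterministic. *Threshold rules.* Let $t_\lambda(x)$, $\lambda\ge0$, $x\in\mathbb R$, satisfy, for some constants $\kappa_0\in[1,2)$ and $\kappa_1<\infty$: $s_\lambda(x)\le t_\lambda(x)\le h_\lambda(x)$ for $x\ge0$ and $h_\lambda(x)\le t_\lambda(x)\le s_\lambda(x)$ for $x<0$; $0\le t_\lambda(y)-t_\lambda(x)\le\kappa_0(y-x)$ for $x<y$; and $|t_\lambda(x)-t_{\lambda'}(x)|\le\kappa_1|\lambda-\lambda'|$. **Theorem.** Let $L_{0,n}=(\log n)^{-3/2}\big(\delta_{1,n}(\log n)^{3/2}+(\log\log n)\sqrt{\log n}\big)^{1+\delta_{1,n}}$ and suppose that, as $n\to\infty$, $$\frac{L_{0,n}}{n^{\delta_{1,n}}}\ \ll\ \inf_{\lambda\ge0}E_\theta\|s_\lambda(X)-\theta\|^2\ \ll\ n ,$$ where $a_n\ll b_n$ means $a_n=o(b_n)$. Then the risk $E_\theta\|t_{\hat\lambda}(X)-\theta\|^2$ is finite for every $n$ and $$\limsup_{n\to\infty}\frac{E_\theta\|t_{\hat\lambda}(X)-\theta\|^2}{\inf_{\lambda\ge0}E_\theta\|s_\lambda(X)-\theta\|^2}\le1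 .$$ -/

import Mathlib

open MeasureTheory ProbabilityTheory Filter Asymptotics
open scoped Topology

noncomputable section

namespace FDRThreshold

/-- The law of `X ~ N(θ, I_n)`: independent coordinates `X_i ~ N(θ_i, 1)`. -/
def gaussianVec {n : ℕ} (θ : Fin n → ℝ) : Measure (Fin n → ℝ) :=
  Measure.pi fun i => gaussianReal (θ i) 1

/-- Standard normal distribution function `Φ`. -/
def stdNormalCDF (x : ℝ) : ℝ := cdf (gaussianReal 0 1) x

/-- Standard normal quantile function `Φ⁻¹` (used at levels in `(0, 1)` only). -/
def stdNormalQuantile (p : ℝ) : ℝ := sInf {x : ℝ | p ≤ stdNormalCDF x}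

/-- Soft threshold rule `s_l(x) = sgn(x) (|x| - l)₊`. -/
def softThreshold (l x : ℝ) : ℝ := Real.sign x * max (|x| - l) 0

open Classical in
/-- Hard threshold rule `h_l(x) = x I{|x| > l}`. -/
def hardThreshold (l x : ℝ) : ℝ := if l < |x| then x else 0

/-- A family `t l x` of smooth threshold rules, indexed by the threshold level `l ≥ 0`:
between the soft and the hard rules, nondecreasing and `κ₀`-Lipschitz in `x`, `κ₁`-Lipschitz in
the level. -/
structure IsSmoothThreshold (κ₀ κ₁ : ℝ) (t : ℝ → ℝ → ℝ) : Prop where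
  between_nonneg : ∀ l x, 0 ≤ l → 0 ≤ x →
    softThreshold l x ≤ t l x ∧ t l x ≤ hardThreshold l x
  between_neg : ∀ l x, 0 ≤ l → x < 0 →
    hardThreshold l x ≤ t l x ∧ t l x ≤ softThreshold l x
  lipschitz_obs : ∀ l x y, 0 ≤ l → x < y →
    0 ≤ t l y - t l x ∧ t l y - t l x ≤ κ₀ * (y - x)
  lipschitz_level : ∀ l l' x, 0 ≤ l → 0 ≤ l' →
    |t l x - t l' x| ≤ κ₁ * |l - l'|

/-- Candidate threshold levels `ξ_k = -Φ⁻¹(α k / (2 n))`. -/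
def xi (α : ℝ) (n k : ℕ) : ℝ := -stdNormalQuantile (α * k / (2 * n))

open Classical in
/-- `N(s)`: the number of observations with `|x_i| ≥ s`. -/
def exceedCount {n : ℕ} (x : Fin n → ℝ) (s : ℝ) : ℕ :=
  (Finset.univ.filter fun i => s ≤ |x i|).card

open Classical in
/-- `min {ξ_k : 1 ≤ k ≤ n, N(ξ_k) ≥ k}` (Benjamini–Hochberg, step-up). As `ξ_1` is the largest
candidate, including it changes nothing unless no `k` qualifies (no rejection), in which case
the level is `ξ_1`. -/
def xiHatUp {n : ℕ} (α : ℝ) (x : Fin n → ℝ) : ℝ :=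
  (insert (xi α n 1)
    (((Finset.Icc 1 n).filter fun k => k ≤ exceedCount x (xi α n k)).image (xi α n))).min'
    (Finset.insert_nonempty _ _)

open Classical in
/-- `max {ξ_k : 1 ≤ k ≤ n, N(ξ_{k+1}) < k + 1}` (step-down). As `N ≤ n`, the index `k = n` always
qualifies when `n ≥ 1`, so including `ξ_n` changes nothing. -/
def xiHatDown {n : ℕ} (α : ℝ) (x : Fin n → ℝ) : ℝ :=
  (insert (xi α n n)
    (((Finset.Icc 1 n).filter fun k => exceedCount x (xi α n (k + 1)) < k + 1).image
      (xi α n))).max'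
    (Finset.insert_nonempty _ _)

/-- Squared error `‖v - θ‖² = ∑ i, (v_i - θ_i)²`. -/
def sqError {n : ℕ} (v θ : Fin n → ℝ) : ℝ := ∑ i, (v i - θ i) ^ 2

/-- Risk `E_θ ‖s_l(X) - θ‖²` of the soft threshold estimator at the fixed level `l`. -/
def softRisk {n : ℕ} (θ : Fin n → ℝ) (l : ℝ) : ℝ :=
  ∫ x, sqError (fun i => softThreshold l (x i)) θ ∂(gaussianVec θ)

/-- Optimal nonadaptive soft threshold risk `inf_{l ≥ 0} E_θ ‖s_l(X) - θ‖²`. -/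
def optSoftRisk {n : ℕ} (θ : Fin n → ℝ) : ℝ := ⨅ l : Set.Ici (0 : ℝ), softRisk θ l

/-- `L_{0,n} = (log n)^{-3/2} (δ (log n)^{3/2} + (log log n) (log n)^{1/2})^{1+δ}`. -/
def L0 (δ : ℝ) (n : ℕ) : ℝ :=
  Real.log n ^ (-(3 / 2) : ℝ) *
    (δ * Real.log n ^ (3 / 2 : ℝ) + Real.log (Real.log n) * √(Real.log n)) ^ (1 + δ)

end FDRThreshold

end

/-! Write ρ for the optimal soft risk, N(s) for the number of exceedances of s, M(s) for its mean,
and D = δ₁ log n + log log n.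

Replacing the random level. A rule between soft and hard with slope at most 2 obeys, for all l ≤ v ≤
u, a pathwise bound: its loss at v is at most the soft loss at u plus an excess depending only on l,
on the noise and on |θ_i| (`IsSmoothThreshold.sq_sub_le`). So only deterministic brackets of the
random level matter, at the price of summing over the candidates where step-up or step-down may stop
unexpectedly. The indicator of such an event is at most exp(σ(N(s) - k)) with σ of suitable sign. By
independence, tilting a sum of coordinate losses this way costs only e^{|σ|} beyond the usual
Chernoff factor (`integral_mul_exp_card_le`). `integral_loss_le` collects the result.

Lower bracket. Take k₀ of order ρ + D. Since ρ ≪ n, near-optimal levels are high, so ∑ min(θ_i², 1)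
= O(ρ). Hence M(ξ_{1,k}) ≤ βk with β < 1 for every k > k₀, and stopping beyond k₀ contributes
O(e^{-ck₀}), which is O(e^{-2D}) (`exists_sum_totalExcess_le`). The excess at √(1+δ₁) ξ_{1,k₀} is a
small multiple of ρ plus a pure noise term. If ρ dominates D, the noise is O(k₀/ξ²) with k₀ = O(ρ).
Otherwise it is O(L₀/n^δ₁) (`excessMoment_le_L0`). The lower bound on ρ is used for this noise and
for e^{-2D}.

Upper bracket. Let H(z) be the sum of the symmetrised likelihood ratios exp(-b²/2) cosh(bz), b =
min(|θ_i|, z). Choose z in [ξ_{1,k₀}, ξ_{2,1}] with H(z) = An, or z = ξ_{2,1} if H stays below An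
there. Above z, H times the null tail bounds M from below and grows fast enough that M far exceeds
k, so step-down rarely stops there (`sum_softRisk_mul_exp_le`). Conversely H(z) ≤ An limits the
signals large enough to be hurt by z: compared with a much lower level l, their total risk is
negligible against the null risk at l. So √(1+δ₂) z is nearly optimal
(`softRisk_le_of_likelihoodSum_le`). -/

noncomputable section

namespace FDRThreshold

/-! ### The standard normal law -/

/-- The standard normal law. -/
abbrev stdGauss : Measure ℝ := gaussianReal 0 1

lemma integral_gaussianReal_shift (θ : ℝ) (f : ℝ → ℝ) :
    ∫ x, f x ∂(gaussianReal θ 1) = ∫ z, f (z + θ) ∂stdGauss := by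
  have h : (gaussianReal 0 1).map (fun x => x + θ) = gaussianReal θ 1 := by
    rw [gaussianReal_map_add_const, zero_add]
  rw [← h]
  exact (MeasurableEquiv.addRight θ).measurableEmbedding.integral_map f

lemma integral_stdGauss_neg (f : ℝ → ℝ) : ∫ z, f (-z) ∂stdGauss = ∫ z, f z ∂stdGauss := by
  have h : (gaussianReal 0 1).map (fun x => -x) = gaussianReal 0 1 := by
    rw [gaussianReal_map_neg, neg_zero]
  conv_rhs => rw [stdGauss, ← h]
  exact ((MeasurableEquiv.neg ℝ).measurableEmbedding.integral_map f).symm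

lemma integrable_comp_neg {f : ℝ → ℝ} (hf : Integrable f stdGauss) :
    Integrable (fun z => f (-z)) stdGauss := by
  have h : (gaussianReal 0 1).map (fun x => -x) = gaussianReal 0 1 := by
    rw [gaussianReal_map_neg, neg_zero]
  have h2 : Integrable f ((gaussianReal 0 1).map (fun x => -x)) := by rw [h]; exact hf
  exact (MeasurableEquiv.neg ℝ).measurableEmbedding.integrable_map_iff.1 h2

lemma integrable_shift_iff (θ : ℝ) (f : ℝ → ℝ) :
    Integrable f (gaussianReal θ 1) ↔ Integrable (fun z => f (z + θ)) stdGauss := by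
  have h : (gaussianReal 0 1).map (fun x => x + θ) = gaussianReal θ 1 := by
    rw [gaussianReal_map_add_const, zero_add]
  rw [← h]
  exact (MeasurableEquiv.addRight θ).measurableEmbedding.integrable_map_iff

/-- Several comparisons below fail at a single noise value but hold for the pair z, -z; this reduces
them to pointwise inequalities. -/
lemma integral_stdGauss_symm {f : ℝ → ℝ} (hf : Integrable f stdGauss) :
    ∫ z, f z ∂stdGauss = (1 / 2) * ∫ z, (f z + f (-z)) ∂stdGauss := by
  rw [integral_add hf (integrable_comp_neg hf), integral_stdGauss_neg]
  ring

lemma integrable_sq_stdGauss : Integrable (fun z : ℝ => z ^ 2) stdGauss :=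
  (memLp_id_gaussianReal (μ := 0) (v := 1) 2).integrable_sq

lemma integral_sq_stdGauss : ∫ z, z ^ 2 ∂stdGauss = 1 := by
  have h := variance_id_gaussianReal (μ := 0) (v := 1)
  rw [variance_eq_integral (by fun_prop)] at h
  simpa [integral_id_gaussianReal] using h

lemma integrable_of_le_sq {f : ℝ → ℝ} (hf : Measurable f) (a b : ℝ)
    (h : ∀ z, |f z| ≤ a + b * z ^ 2) : Integrable f stdGauss := by
  refine Integrable.mono' (g := fun z => a + b * z ^ 2)
    ((integrable_const a).add (integrable_sq_stdGauss.const_mul b)) hf.aestronglyMeasurable ?_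
  exact Eventually.of_forall h

lemma integral_stdGauss_eq (f : ℝ → ℝ) :
    ∫ z, f z ∂stdGauss = ∫ x, gaussianPDFReal 0 1 x * f x := by
  rw [stdGauss, integral_gaussianReal_eq_integral_smul one_ne_zero]
  rfl

/-- Change of location as an exponential tilt. -/
lemma integral_shift_eq_tilt (b : ℝ) (f : ℝ → ℝ) :
    ∫ z, f (z + b) ∂stdGauss = ∫ x, Real.exp (b * x - b ^ 2 / 2) * f x ∂stdGauss := by
  rw [← integral_gaussianReal_shift, integral_gaussianReal_eq_integral_smul one_ne_zero,
    integral_stdGauss_eq]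
  refine integral_congr_ae (Eventually.of_forall fun x => ?_)
  simp only [gaussianPDFReal, smul_eq_mul, NNReal.coe_one]
  have h : Real.exp (-(x - b) ^ 2 / (2 * 1)) =
      Real.exp (-(x - 0) ^ 2 / (2 * 1)) * Real.exp (b * x - b ^ 2 / 2) := by
    rw [← Real.exp_add]
    congr 1
    ring
  rw [h]
  ring

lemma integrable_exp_mul_stdGauss (t : ℝ) : Integrable (fun z => Real.exp (t * z)) stdGauss :=
  integrable_exp_mul_gaussianReal t

lemma integral_exp_mul_stdGauss (t : ℝ) :
    ∫ z, Real.exp (t * z) ∂stdGauss = Real.exp (t ^ 2 / 2) := by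
  have h := congrFun (mgf_id_gaussianReal (μ := 0) (v := 1)) t
  simpa [mgf] using h

lemma pdf_eq (x : ℝ) : gaussianPDFReal 0 1 x = (√(2 * Real.pi))⁻¹ * Real.exp (-(x ^ 2 / 2)) := by
  simp only [gaussianPDFReal, NNReal.coe_one]
  congr 2
  · ring_nf
  · ring

lemma pdf_le (x : ℝ) : gaussianPDFReal 0 1 x ≤ (1 / 2) * Real.exp (-(x ^ 2 / 2)) := by
  rw [pdf_eq]
  gcongr
  rw [inv_le_comm₀ (by positivity) (by norm_num)]
  apply Real.le_sqrt_of_sq_le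
  have := Real.pi_gt_three
  norm_num; linarith

lemma le_pdf (x : ℝ) : (1 / 3) * Real.exp (-(x ^ 2 / 2)) ≤ gaussianPDFReal 0 1 x := by
  rw [pdf_eq]
  gcongr
  rw [le_inv_comm₀ (by norm_num) (by positivity)]
  apply Real.sqrt_le_iff.2
  have := Real.pi_lt_four
  constructor <;> norm_num; linarith

/-! ### Tails and truncated moments -/

/-- Two-sided normal tail `P(|Z| ≥ l)`. -/
def gaussTail (l : ℝ) : ℝ := stdGauss.real {z | l ≤ |z|}

/-- Probability that an `N(a, 1)` observation exceeds `l` in absolute value. -/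
def exceedProb (l a : ℝ) : ℝ := stdGauss.real {z | l ≤ |z + a|}

/-- Second moment of the excess, `E (|Z| - l)₊²`. -/
def excessMoment (l : ℝ) : ℝ := ∫ z, (max (|z| - l) 0) ^ 2 ∂stdGauss

lemma measurableSet_abs_ge (l a : ℝ) : MeasurableSet {z : ℝ | l ≤ |z + a|} :=
  measurableSet_le measurable_const (by fun_prop)

lemma exceedProb_eq_integral (l a : ℝ) :
    exceedProb l a = ∫ z, ({z : ℝ | l ≤ |z + a|}.indicator 1) z ∂stdGauss := by
  rw [integral_indicator_one (measurableSet_abs_ge l a)]; rfl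

lemma exceedProb_zero (l : ℝ) : exceedProb l 0 = gaussTail l := by
  simp [exceedProb, gaussTail]

lemma gaussTail_eq_integral (l : ℝ) :
    gaussTail l = ∫ z, ({z : ℝ | l ≤ |z|}.indicator 1) z ∂stdGauss := by
  rw [← exceedProb_zero, exceedProb_eq_integral]; simp

lemma exceedProb_nonneg (l a : ℝ) : 0 ≤ exceedProb l a := measureReal_nonneg

lemma gaussTail_nonneg (l : ℝ) : 0 ≤ gaussTail l := measureReal_nonneg

lemma exceedProb_le_one (l a : ℝ) : exceedProb l a ≤ 1 := measureReal_le_one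

lemma exceedProb_antitone (a : ℝ) : Antitone fun l => exceedProb l a := by
  intro l l' h
  exact measureReal_mono fun z (hz : l' ≤ |z + a|) => h.trans hz

lemma gaussTail_antitone : Antitone gaussTail := by
  intro l l' h
  simpa [exceedProb_zero] using exceedProb_antitone 0 h

lemma integrable_indicator_ge (l a : ℝ) :
    Integrable ({z : ℝ | l ≤ |z + a|}.indicator (1 : ℝ → ℝ)) stdGauss :=
  (integrable_const (1 : ℝ)).indicator (measurableSet_abs_ge l a)

lemma exceedProb_neg (l a : ℝ) : exceedProb l (-a) = exceedProb l a := by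
  rw [exceedProb_eq_integral, exceedProb_eq_integral, ← integral_stdGauss_neg]
  refine integral_congr_ae (Eventually.of_forall fun z => ?_)
  have : |-z + -a| = |z + a| := by rw [← abs_neg]; congr 1; ring
  simp only [Set.indicator, Set.mem_ofPred_eq, this, Pi.one_apply]

lemma exceedProb_abs (l a : ℝ) : exceedProb l |a| = exceedProb l a := by
  rcases abs_choice a with h | h <;> rw [h]
  exact exceedProb_neg l a

lemma gaussTail_le_exp {l : ℝ} (hl : 0 ≤ l) : gaussTail l ≤ 2 * Real.exp (-(l ^ 2 / 2)) := by
  -- Chernoff majorant of the indicator of |z| ≥ l with the optimal tilt l.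
  have hi : Integrable (fun z => Real.exp (-l ^ 2) * (Real.exp (l * z) + Real.exp (-l * z)))
      stdGauss :=
    ((integrable_exp_mul_stdGauss l).add (integrable_exp_mul_stdGauss (-l))).const_mul _
  rw [gaussTail_eq_integral]
  calc _ ≤ ∫ z, Real.exp (-l ^ 2) * (Real.exp (l * z) + Real.exp (-l * z)) ∂stdGauss := by
        refine integral_mono ?_ hi fun z => ?_
        · simpa using integrable_indicator_ge l 0
        · by_cases h : l ≤ |z|
          · rw [Set.indicator_of_mem (by exact h)]
            rw [mul_add, ← Real.exp_add, ← Real.exp_add]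
            simp only [Pi.one_apply]
            rcases abs_cases z with ⟨hz, _⟩ | ⟨hz, _⟩
            · have : 1 ≤ Real.exp (-l ^ 2 + l * z) := Real.one_le_exp (by nlinarith)
              have := Real.exp_pos (-l ^ 2 + -l * z)
              linarith
            · have : 1 ≤ Real.exp (-l ^ 2 + -l * z) := Real.one_le_exp (by nlinarith)
              have := Real.exp_pos (-l ^ 2 + l * z)
              linarith
          · rw [Set.indicator_of_notMem (by exact h)]
            positivity
    _ = _ := by
        rw [integral_const_mul, integral_add (integrable_exp_mul_stdGauss l)
          (integrable_exp_mul_stdGauss (-l)), integral_exp_mul_stdGauss,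
          integral_exp_mul_stdGauss, neg_sq, ← two_mul, mul_left_comm, ← Real.exp_add]
        ring_nf

/-! ### The distribution function -/

lemma continuous_pdf : Continuous (gaussianPDFReal 0 1) := by
  rw [gaussianPDFReal_def]; fun_prop

lemma stdNormalCDF_eq_measureReal (x : ℝ) : stdNormalCDF x = stdGauss.real (Set.Iic x) :=
  cdf_eq_real _ _

lemma stdGauss_real_eq_integral {s : Set ℝ} (hs : MeasurableSet s) :
    stdGauss.real s = ∫ x in s, gaussianPDFReal 0 1 x := by
  rw [← integral_indicator_one hs, integral_stdGauss_eq, ← integral_indicator hs]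
  refine integral_congr_ae (Eventually.of_forall fun x => ?_)
  by_cases hx : x ∈ s <;> simp [hx]

lemma stdNormalCDF_sub (a b : ℝ) :
    stdNormalCDF b - stdNormalCDF a = ∫ x in a..b, gaussianPDFReal 0 1 x := by
  rw [stdNormalCDF_eq_measureReal, stdNormalCDF_eq_measureReal,
    stdGauss_real_eq_integral measurableSet_Iic, stdGauss_real_eq_integral measurableSet_Iic]
  exact intervalIntegral.integral_Iic_sub_Iic (integrable_gaussianPDFReal 0 1).integrableOn
    (integrable_gaussianPDFReal 0 1).integrableOn

lemma hasDerivAt_stdNormalCDF (x : ℝ) :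
    HasDerivAt stdNormalCDF (gaussianPDFReal 0 1 x) x := by
  have h : stdNormalCDF = fun y => stdNormalCDF 0 + ∫ t in (0 : ℝ)..y, gaussianPDFReal 0 1 t := by
    funext y; rw [← stdNormalCDF_sub]; ring
  rw [h]
  exact ((continuous_pdf.integral_hasStrictDerivAt 0 x).hasDerivAt).const_add _

lemma continuous_stdNormalCDF : Continuous stdNormalCDF :=
  continuous_iff_continuousAt.2 fun x => (hasDerivAt_stdNormalCDF x).continuousAt

lemma stdNormalCDF_neg (x : ℝ) : stdNormalCDF (-x) = 1 - stdNormalCDF x := by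
  have h : stdGauss.real (Set.Iic (-x)) = stdGauss.real (Set.Ici x) := by
    rw [← integral_indicator_one measurableSet_Iic, ← integral_indicator_one measurableSet_Ici,
      ← integral_stdGauss_neg]
    refine integral_congr_ae (Eventually.of_forall fun z => ?_)
    simp [Set.indicator]
  rw [stdNormalCDF_eq_measureReal, stdNormalCDF_eq_measureReal, h, ← Set.compl_Iio,
    probReal_compl_eq_one_sub measurableSet_Iio]
  have : NullSingletonClass stdGauss := nullSingletonClass_gaussianReal one_ne_zero
  rw [measureReal_congr (Iio_ae_eq_Iic (μ := stdGauss))]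

lemma exceedProb_eq_cdf {l : ℝ} (hl : 0 ≤ l) (a : ℝ) :
    exceedProb l a = 1 - (stdNormalCDF (l - a) - stdNormalCDF (-l - a)) := by
  have h1 : {z : ℝ | l ≤ |z + a|} = (Set.Ioo (-l - a) (l - a))ᶜ := by
    ext z
    simp only [Set.mem_ofPred_eq, Set.mem_compl_iff, Set.mem_Ioo, ← not_lt, abs_lt]
    constructor
    · rintro h ⟨h1, h2⟩; exact h ⟨by linarith, by linarith⟩
    · rintro h ⟨h1, h2⟩; exact h ⟨by linarith, by linarith⟩
  rw [exceedProb, h1, probReal_compl_eq_one_sub measurableSet_Ioo, stdNormalCDF_sub,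
    stdGauss_real_eq_integral measurableSet_Ioo,
    intervalIntegral.integral_of_le (by linarith), integral_Ioc_eq_integral_Ioo]

lemma hasDerivAt_exceedProb {l : ℝ} (hl : 0 ≤ l) (a : ℝ) :
    HasDerivAt (exceedProb l) (gaussianPDFReal 0 1 (l - a) - gaussianPDFReal 0 1 (l + a)) a := by
  have h : exceedProb l = fun a => 1 - (stdNormalCDF (l - a) - stdNormalCDF (-l - a)) := by
    funext a; exact exceedProb_eq_cdf hl a
  rw [h]
  have h1 : HasDerivAt (fun a => stdNormalCDF (l - a)) (gaussianPDFReal 0 1 (l - a) * (-1)) a :=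
    (hasDerivAt_stdNormalCDF (l - a)).comp a ((hasDerivAt_id a).const_sub l)
  have h2 : HasDerivAt (fun a => stdNormalCDF (-l - a)) (gaussianPDFReal 0 1 (-l - a) * (-1)) a :=
    (hasDerivAt_stdNormalCDF (-l - a)).comp a ((hasDerivAt_id a).const_sub (-l))
  have h3 := (h1.sub h2).const_sub 1
  refine h3.congr_deriv ?_
  have : gaussianPDFReal 0 1 (-l - a) = gaussianPDFReal 0 1 (l + a) := by
    rw [pdf_eq, pdf_eq]; congr 3; ring
  rw [this]; ring

lemma pdf_lipschitz (x y : ℝ) : |gaussianPDFReal 0 1 x - gaussianPDFReal 0 1 y| ≤ |x - y| := by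
  have hd : ∀ x, HasDerivAt (gaussianPDFReal 0 1) (-x * gaussianPDFReal 0 1 x) x := by
    intro x
    have h : gaussianPDFReal 0 1 = fun x => (√(2 * Real.pi))⁻¹ * Real.exp (-(x ^ 2 / 2)) := by
      funext x; exact pdf_eq x
    rw [h]
    have h1 : HasDerivAt (fun x : ℝ => -(x ^ 2 / 2)) (-x) x := by
      refine (((hasDerivAt_pow 2 x).div_const 2).neg).congr_deriv ?_
      norm_num
    refine (h1.exp.const_mul (√(2 * Real.pi))⁻¹).congr_deriv ?_
    ring
  have hb : ∀ x, ‖-x * gaussianPDFReal 0 1 x‖ ≤ 1 := by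
    intro x
    rw [Real.norm_eq_abs, abs_mul, abs_neg, abs_of_nonneg (gaussianPDFReal_nonneg 0 1 x)]
    have h1 := pdf_le x
    have h2 : 1 + x ^ 2 / 2 ≤ Real.exp (x ^ 2 / 2) := by
      have := Real.add_one_le_exp (x ^ 2 / 2); linarith
    have h3 : |x| * Real.exp (-(x ^ 2 / 2)) ≤ 1 := by
      rw [Real.exp_neg, ← div_eq_mul_inv, div_le_one (Real.exp_pos _)]
      nlinarith [sq_abs x, sq_nonneg (|x| - 1)]
    have h4 := mul_le_mul_of_nonneg_left h1 (abs_nonneg x)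
    linarith
  have := Convex.norm_image_sub_le_of_norm_hasDerivWithin_le (s := Set.univ) (C := 1)
    (fun x _ => (hd x).hasDerivWithinAt) (fun x _ => hb x) convex_univ (Set.mem_univ y)
    (Set.mem_univ x)
  simpa using this

lemma exceedProb_monotoneOn {l : ℝ} (hl : 0 ≤ l) : MonotoneOn (exceedProb l) (Set.Ici 0) := by
  refine monotoneOn_of_deriv_nonneg (convex_Ici 0)
    (fun x _ => (hasDerivAt_exceedProb hl x).continuousAt.continuousWithinAt)
    (fun x _ => (hasDerivAt_exceedProb hl x).differentiableAt.differentiableWithinAt) ?_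
  intro a ha
  rw [interior_Ici, Set.mem_Ioi] at ha
  rw [(hasDerivAt_exceedProb hl a).deriv, sub_nonneg, pdf_eq, pdf_eq]
  gcongr (√(2 * Real.pi))⁻¹ * Real.exp (-(?_ / 2))
  nlinarith [mul_nonneg hl ha.le]

/-- The derivative in a is φ(l - a) - φ(l + a), at most 2a because φ is 1-Lipschitz. By symmetry
small means enter only at second order, which lets the count be controlled by ∑ min(θ_i², 1). -/
lemma exceedProb_le_gaussTail_add_sq {l a : ℝ} (hl : 0 ≤ l) (ha : 0 ≤ a) :
    exceedProb l a ≤ gaussTail l + a ^ 2 := by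
  have hd : ∀ x, HasDerivAt (fun a => a ^ 2 - exceedProb l a)
      (2 * x - (gaussianPDFReal 0 1 (l - x) - gaussianPDFReal 0 1 (l + x))) x := by
    intro x
    refine ((hasDerivAt_pow 2 x).sub (hasDerivAt_exceedProb hl x)).congr_deriv ?_
    norm_num
  have hm : MonotoneOn (fun a => a ^ 2 - exceedProb l a) (Set.Ici 0) := by
    refine monotoneOn_of_deriv_nonneg (convex_Ici 0)
      (fun x _ => (hd x).continuousAt.continuousWithinAt)
      (fun x _ => (hd x).differentiableAt.differentiableWithinAt) ?_
    intro x hx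
    rw [interior_Ici, Set.mem_Ioi] at hx
    rw [(hd x).deriv]
    have h1 := (abs_le.1 (pdf_lipschitz (l - x) (l + x))).2
    have h2 : |l - x - (l + x)| = 2 * x := by
      rw [show l - x - (l + x) = -(2 * x) by ring, abs_neg, abs_of_pos (by linarith)]
    linarith
  have := hm (Set.mem_Ici.2 le_rfl) (Set.mem_Ici.2 ha) ha
  simp only [exceedProb_zero] at this
  linarith

lemma exceedProb_le_gaussTail_add_min {l a : ℝ} (hl : 0 ≤ l) (ha : 0 ≤ a) :
    exceedProb l a ≤ gaussTail l + min (a ^ 2) 1 := by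
  rcases le_total (a ^ 2) 1 with h | h
  · rw [min_eq_left h]; exact exceedProb_le_gaussTail_add_sq hl ha
  · rw [min_eq_right h]
    linarith [exceedProb_le_one l a, gaussTail_nonneg l]

/-- Exceedances of a shifted observation dominate a cosh multiple of the null tail. -/
lemma cosh_mul_gaussTail_le {l a b : ℝ} (hl : 0 ≤ l) (hb : 0 ≤ b) (hba : b ≤ a) :
    Real.exp (-(b ^ 2 / 2)) * Real.cosh (b * l) * gaussTail l ≤ exceedProb l a := by
  refine le_trans ?_ (exceedProb_monotoneOn hl (Set.mem_Ici.2 hb) (Set.mem_Ici.2 (hb.trans hba)) hba)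
  have hms : MeasurableSet {z : ℝ | l ≤ |z|} := measurableSet_le measurable_const (by fun_prop)
  set s : Set ℝ := {z : ℝ | l ≤ |z|} with hs
  have hI : ∀ t : ℝ, Integrable (fun x => Real.exp (t * x - t ^ 2 / 2) * s.indicator 1 x)
      stdGauss := by
    intro t
    have := ((integrable_exp_mul_stdGauss t).mul_const (Real.exp (-(t ^ 2 / 2)))).indicator hms
    refine this.congr (Eventually.of_forall fun x => ?_)
    by_cases hx : x ∈ s
    · simp only [hx, Set.indicator_of_mem, Pi.one_apply, mul_one]
      rw [← Real.exp_add]; ring_nf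
    · simp [hx]
  -- After the tilt by exp(bx - b²/2), symmetrising replaces exp(bx) by cosh(bx), which on |x| ≥ l
  -- is at least cosh(bl).
  have h1 : exceedProb l b = ∫ x, Real.exp (b * x - b ^ 2 / 2) * s.indicator 1 x ∂stdGauss := by
    rw [exceedProb_eq_integral, ← integral_shift_eq_tilt]
    rfl
  have hQ : gaussTail l = ∫ x, s.indicator 1 x ∂stdGauss := gaussTail_eq_integral l
  rw [h1, integral_stdGauss_symm (hI b), hQ, ← integral_const_mul,
    ← integral_const_mul]
  refine integral_mono ?_ ?_ fun x => ?_
  · have := (integrable_indicator_ge l 0).const_mul (Real.exp (-(b ^ 2 / 2)) * Real.cosh (b * l))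
    simpa using this
  · exact ((hI b).add (integrable_comp_neg (hI b))).const_mul _
  · have hneg : s.indicator (1 : ℝ → ℝ) (-x) = s.indicator 1 x := by
      simp [hs, Set.indicator]
    simp only [hneg]
    by_cases hx : x ∈ s
    · simp only [hx, Set.indicator_of_mem, Pi.one_apply, mul_one]
      have hc : Real.cosh (b * l) ≤ Real.cosh (b * x) := by
        rw [Real.cosh_le_cosh, abs_of_nonneg (mul_nonneg hb hl), abs_mul, abs_of_nonneg hb]
        exact mul_le_mul_of_nonneg_left hx hb
      calc Real.exp (-(b ^ 2 / 2)) * Real.cosh (b * l)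
          ≤ Real.exp (-(b ^ 2 / 2)) * Real.cosh (b * x) := by gcongr
        _ = _ := by
          rw [Real.cosh_eq, sub_eq_add_neg, sub_eq_add_neg, Real.exp_add, Real.exp_add]
          ring_nf
    · simp [hx]

/-! ### Mills ratio type bounds -/

/-- On [l, l + h] the density is at least its value at the right end. -/
lemma le_gaussTail {l h : ℝ} (hl : 0 ≤ l) (hh : 0 ≤ h) :
    h / 3 * Real.exp (-((l + h) ^ 2 / 2)) ≤ gaussTail l := by
  have h1 : stdGauss.real (Set.Icc l (l + h)) ≤ gaussTail l :=
    measureReal_mono fun z hz => hz.1.trans (le_abs_self z)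
  refine le_trans ?_ h1
  rw [stdGauss_real_eq_integral measurableSet_Icc]
  have h2 : ∫ x in Set.Icc l (l + h), (1 / 3 * Real.exp (-((l + h) ^ 2 / 2)) : ℝ)
      ≤ ∫ x in Set.Icc l (l + h), gaussianPDFReal 0 1 x := by
    refine setIntegral_mono_on (integrableOn_const (by simp)) (integrable_gaussianPDFReal 0 1).integrableOn
      measurableSet_Icc fun x hx => ?_
    refine le_trans ?_ (le_pdf x)
    gcongr
    · linarith [hx.1]
    · exact hx.2
  refine le_trans (le_of_eq ?_) h2
  simp [hh]
  ring

/-- The choice h = 1/l in `le_gaussTail` raises the exponent only by 1 + 1/(2l²), bounded since l ≥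
c. -/
lemma exp_le_mul_gaussTail {c l : ℝ} (hc : 0 < c) (hl : c ≤ l) :
    Real.exp (-(l ^ 2 / 2)) ≤ 3 * Real.exp (1 + 1 / (2 * c ^ 2)) * l * gaussTail l := by
  have hl0 : 0 < l := hc.trans_le hl
  have h := le_gaussTail hl0.le (h := 1 / l) (by positivity)
  have h1 : Real.exp (-(l ^ 2 / 2)) ≤
      Real.exp (1 + 1 / (2 * c ^ 2)) * Real.exp (-((l + 1 / l) ^ 2 / 2)) := by
    rw [← Real.exp_add]
    apply Real.exp_le_exp.2
    have : (l + 1 / l) ^ 2 = l ^ 2 + 2 + 1 / l ^ 2 := by field_simp; ring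
    rw [this]
    have : 1 / l ^ 2 ≤ 1 / c ^ 2 := by gcongr
    have h3 : 1 / (2 * c ^ 2) = (1 / c ^ 2) / 2 := by field_simp
    rw [h3]
    linarith
  calc _ ≤ _ := h1
    _ = Real.exp (1 + 1 / (2 * c ^ 2)) * (3 * l * ((1 / l) / 3
        * Real.exp (-((l + 1 / l) ^ 2 / 2)))) := by field_simp
    _ ≤ Real.exp (1 + 1 / (2 * c ^ 2)) * (3 * l * gaussTail l) := by gcongr
    _ = _ := by ring

lemma integrable_excess (l : ℝ) :
    Integrable (fun z : ℝ => (max (|z| - l) 0) ^ 2) stdGauss := by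
  refine integrable_of_le_sq (by fun_prop) (2 * l ^ 2) 2 fun z => ?_
  rw [abs_of_nonneg (sq_nonneg _)]
  rcases max_cases (|z| - l) 0 with ⟨h, _⟩ | ⟨h, _⟩ <;> rw [h]
  · nlinarith [sq_abs z, sq_nonneg (|z| + l)]
  · nlinarith [sq_nonneg z, sq_nonneg l]

lemma excessMoment_nonneg (l : ℝ) : 0 ≤ excessMoment l :=
  integral_nonneg fun z => by positivity

lemma excessMoment_antitone : Antitone excessMoment := by
  intro l l' h
  refine integral_mono (integrable_excess l') (integrable_excess l) fun z => ?_
  dsimp only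
  gcongr

lemma gaussTail_le_excessMoment (l : ℝ) : gaussTail (l + 1) ≤ excessMoment l := by
  rw [gaussTail_eq_integral]
  refine integral_mono ?_ (integrable_excess l) fun z => ?_
  · simpa using integrable_indicator_ge (l + 1) 0
  · by_cases h : l + 1 ≤ |z|
    · rw [Set.indicator_of_mem (by exact h), Pi.one_apply]
      have : 1 ≤ max (|z| - l) 0 := le_max_of_le_left (by linarith)
      nlinarith
    · rw [Set.indicator_of_notMem (by exact h)]; positivity

/-- Substituting z = l + u, the density is at most a constant times exp(-l²/2) exp(-lu), and u²
exp(-lu) integrates to 2/l³. Against the tail this gains a factor l², the source of the power -3/2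
of log n in `L0`. -/
lemma excessMoment_le {l : ℝ} (hl : 0 < l) :
    excessMoment l ≤ 2 * Real.exp (-(l ^ 2 / 2)) / l ^ 3 := by
  have hi : Integrable (fun z : ℝ => (max (z - l) 0) ^ 2) stdGauss := by
    refine integrable_of_le_sq (by fun_prop) (2 * l ^ 2) 2 fun z => ?_
    rw [abs_of_nonneg (sq_nonneg _)]
    rcases max_cases (z - l) 0 with ⟨h, _⟩ | ⟨h, _⟩ <;> rw [h]
    · nlinarith [sq_nonneg (z + l)]
    · nlinarith [sq_nonneg z, sq_nonneg l]
  have h1 : excessMoment l = 2 * ∫ z, (max (z - l) 0) ^ 2 ∂stdGauss := by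
    rw [integral_stdGauss_symm hi, ← mul_assoc]
    norm_num
    refine integral_congr_ae (Eventually.of_forall fun z => ?_)
    simp only
    rcases abs_cases z with ⟨h, _⟩ | ⟨h, _⟩ <;> rw [h]
    · rw [max_eq_right (show -z - l ≤ 0 by linarith)]; ring
    · rw [max_eq_right (show z - l ≤ 0 by linarith)]; ring
  have h2 : ∫ z, (max (z - l) 0) ^ 2 ∂stdGauss
      = ∫ u, gaussianPDFReal 0 1 (u + l) * (max u 0) ^ 2 := by
    rw [integral_stdGauss_eq, ← integral_add_right_eq_self _ l]
    simp
  have h3 : IntegrableOn (fun u : ℝ => u ^ (3 - 1 : ℝ) * Real.exp (-(l * u))) (Set.Ioi 0) := by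
    -- A non-integrable function would have integral 0 by convention, contradicting the positive
    -- Gamma value.
    by_contra hcon
    have h4 := Real.integral_rpow_mul_exp_neg_mul_Ioi (a := 3) (by norm_num) hl
    rw [integral_undef hcon] at h4
    have : 0 < (1 / l) ^ (3 : ℝ) * Real.Gamma 3 :=
      mul_pos (Real.rpow_pos_of_pos (by positivity) _) (Real.Gamma_pos_of_pos (by norm_num))
    linarith
  have h5 : ∫ u, gaussianPDFReal 0 1 (u + l) * (max u 0) ^ 2
      ≤ ∫ u, (Set.Ioi (0 : ℝ)).indicator (fun u => 1 / 2 * Real.exp (-(l ^ 2 / 2)) *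
        (u ^ (3 - 1 : ℝ) * Real.exp (-(l * u)))) u := by
    refine integral_mono_of_nonneg (Eventually.of_forall fun u => ?_)
      ((integrable_indicator_iff measurableSet_Ioi).2 (h3.const_mul _))
      (Eventually.of_forall fun u => ?_)
    · exact mul_nonneg (gaussianPDFReal_nonneg _ _ _) (by positivity)
    · dsimp only
      rcases le_or_gt u 0 with hu | hu
      · simp [hu]
      · rw [Set.indicator_of_mem (by exact hu), max_eq_left hu.le]
        have : u ^ (3 - 1 : ℝ) = u ^ 2 := by norm_num
        rw [this]
        have h6 := pdf_le (u + l)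
        have h7 : Real.exp (-((u + l) ^ 2 / 2)) ≤
            Real.exp (-(l ^ 2 / 2)) * Real.exp (-(l * u)) := by
          rw [← Real.exp_add]
          apply Real.exp_le_exp.2
          nlinarith [sq_nonneg u]
        calc _ ≤ (1 / 2 * (Real.exp (-(l ^ 2 / 2)) * Real.exp (-(l * u)))) * u ^ 2 := by
              gcongr; linarith
          _ = _ := by ring
  rw [integral_indicator measurableSet_Ioi, integral_const_mul,
    Real.integral_rpow_mul_exp_neg_mul_Ioi (by norm_num) hl] at h5
  have h8 : Real.Gamma 3 = 2 := by
    have h := Real.Gamma_nat_eq_factorial 2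
    rw [show ((2 : ℕ) : ℝ) + 1 = 3 by norm_num] at h
    rw [h]; norm_num
  have h9 : (1 / l) ^ (3 : ℝ) = 1 / l ^ 3 := by
    rw [show (3 : ℝ) = ((3 : ℕ) : ℝ) by norm_num, Real.rpow_natCast]; ring
  rw [h8, h9] at h5
  rw [h1, h2]
  calc _ ≤ 2 * (1 / 2 * Real.exp (-(l ^ 2 / 2)) * (1 / l ^ 3 * 2)) := by gcongr
    _ = _ := by ring

/-- For thresholds bounded away from zero the excess moment is `O(tail / l²)`. -/
lemma excessMoment_le_gaussTail {c l : ℝ} (hc : 0 < c) (hl : c ≤ l) :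
    excessMoment l ≤ 6 * Real.exp (1 + 1 / (2 * c ^ 2)) * gaussTail l / l ^ 2 := by
  have hl0 : 0 < l := hc.trans_le hl
  have h1 := excessMoment_le hl0
  have h2 := exp_le_mul_gaussTail hc hl
  calc _ ≤ _ := h1
    _ ≤ 2 * (3 * Real.exp (1 + 1 / (2 * c ^ 2)) * l * gaussTail l) / l ^ 3 := by gcongr
    _ = _ := by field_simp; ring

/-! ### Candidate levels -/

/-- The infimum is attained because the superlevel set is closed; left of it the distribution
function is below p, and continuity gives the other inequality. -/
lemma stdNormalCDF_quantile {p : ℝ} (h0 : 0 < p) (h1 : p < 1) :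
    stdNormalCDF (stdNormalQuantile p) = p := by
  set S := {x : ℝ | p ≤ stdNormalCDF x} with hS
  have hne : S.Nonempty := by
    have := (tendsto_cdf_atTop (gaussianReal 0 1)).eventually (lt_mem_nhds h1)
    obtain ⟨x, hx⟩ := this.exists
    exact ⟨x, le_of_lt hx⟩
  have hbd : BddBelow S := by
    have := (tendsto_cdf_atBot (gaussianReal 0 1)).eventually (gt_mem_nhds h0)
    obtain ⟨x, hx⟩ := this.exists
    refine ⟨x, fun y (hy : p ≤ stdNormalCDF y) => ?_⟩
    by_contra hlt
    have := monotone_cdf (gaussianReal 0 1) (not_le.1 hlt).le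
    have : stdNormalCDF y ≤ stdNormalCDF x := this
    have hx' : stdNormalCDF x < p := hx
    linarith
  have hcl : IsClosed S := isClosed_le continuous_const continuous_stdNormalCDF
  have hmem : sInf S ∈ S := hcl.csInf_mem hne hbd
  refine le_antisymm ?_ hmem
  refine le_of_tendsto (f := stdNormalCDF) (x := 𝓝[<] (sInf S))
    (continuous_stdNormalCDF.continuousAt.tendsto.mono_left
      (nhdsWithin_le_nhds (s := Set.Iio (sInf S)))) ?_
  filter_upwards [self_mem_nhdsWithin] with x hx
  by_contra hlt
  exact absurd (csInf_le hbd (show x ∈ S from (not_le.1 hlt).le)) (not_le.2 hx)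

lemma stdNormalCDF_zero : stdNormalCDF 0 = 1 / 2 := by
  have := stdNormalCDF_neg 0
  rw [neg_zero] at this
  linarith

lemma stdNormalCDF_mono : Monotone stdNormalCDF := monotone_cdf _

lemma xi_pos {α : ℝ} {n k : ℕ} (h0 : 0 < α * k / (2 * n)) (h1 : α * k / (2 * n) < 1 / 2) :
    0 < xi α n k := by
  rw [xi, neg_pos]
  by_contra hlt
  have := stdNormalCDF_mono (not_lt.1 hlt)
  rw [stdNormalCDF_quantile h0 (by linarith), stdNormalCDF_zero] at this
  linarith

/-- The 2 in the nominal level pays for the two tails: n null observations exceed the k-th level αk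
times on average. As α < 1, a fixed fraction of k is left over for signals. -/
lemma gaussTail_xi {α : ℝ} {n k : ℕ} (h0 : 0 < α * k / (2 * n)) (h1 : α * k / (2 * n) < 1 / 2) :
    gaussTail (xi α n k) = α * k / n := by
  have h := stdNormalCDF_quantile h0 (by linarith)
  rw [← exceedProb_zero, exceedProb_eq_cdf (xi_pos h0 h1).le, sub_zero, sub_zero]
  have h2 : stdNormalCDF (-xi α n k) = α * k / (2 * n) := by rw [xi, neg_neg, h]
  have h3 := stdNormalCDF_neg (xi α n k)
  have h4 : α * k / (2 * n) = (α * k / n) / 2 := by rw [mul_comm (2 : ℝ), div_mul_eq_div_div]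
  linarith

lemma gaussTail_lt_imp {l l' : ℝ} (h : gaussTail l < gaussTail l') : l' < l := by
  by_contra hcon
  exact absurd (gaussTail_antitone (not_lt.1 hcon)) (not_le.2 h)

lemma gaussTail_pos (l : ℝ) : 0 < gaussTail l := by
  refine lt_of_lt_of_le ?_ (gaussTail_antitone (le_max_left l 0))
  refine lt_of_lt_of_le ?_ (le_gaussTail (le_max_right l 0) (h := 1) zero_le_one)
  positivity

/-! ### The soft threshold rule -/

lemma softThreshold_eq {l : ℝ} (hl : 0 ≤ l) (x : ℝ) :
    softThreshold l x = max (x - l) 0 - max (-x - l) 0 := by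
  rw [softThreshold]
  rcases lt_trichotomy x 0 with h | h | h
  · rw [Real.sign_of_neg h, abs_of_neg h, max_eq_right (show x - l ≤ 0 by linarith)]; ring
  · subst h; simp
  · rw [Real.sign_of_pos h, abs_of_pos h, max_eq_right (show -x - l ≤ 0 by linarith)]; ring

lemma softThreshold_neg {l : ℝ} (hl : 0 ≤ l) (x : ℝ) :
    softThreshold l (-x) = -softThreshold l x := by
  rw [softThreshold_eq hl, softThreshold_eq hl, neg_neg]; ring

lemma continuous_softThreshold {l : ℝ} (hl : 0 ≤ l) : Continuous (softThreshold l) := by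
  rw [show softThreshold l = fun x => max (x - l) 0 - max (-x - l) 0 from
    funext (softThreshold_eq hl)]
  fun_prop

lemma softThreshold_of_abs_le {l x : ℝ} (h : |x| ≤ l) : softThreshold l x = 0 := by
  rw [softThreshold, max_eq_right (by linarith), mul_zero]

lemma abs_softThreshold_sub_le {l : ℝ} (hl : 0 ≤ l) (x : ℝ) : |softThreshold l x - x| ≤ l := by
  rw [softThreshold_eq hl, abs_le]
  rcases max_cases (x - l) 0 with ⟨h, _⟩ | ⟨h, _⟩ <;>
    rcases max_cases (-x - l) 0 with ⟨h', _⟩ | ⟨h', _⟩ <;> rw [h, h'] <;>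
    constructor <;> linarith

lemma abs_softThreshold_sub_softThreshold_le {l u : ℝ} (hl : 0 ≤ l) (hu : l ≤ u) (x : ℝ) :
    |softThreshold u x - softThreshold l x| ≤ u - l := by
  rw [softThreshold_eq hl, softThreshold_eq (hl.trans hu), abs_le]
  rcases max_cases (x - l) 0 with ⟨h, _⟩ | ⟨h, _⟩ <;>
    rcases max_cases (-x - l) 0 with ⟨h', _⟩ | ⟨h', _⟩ <;>
    rcases max_cases (x - u) 0 with ⟨h2, _⟩ | ⟨h2, _⟩ <;>
    rcases max_cases (-x - u) 0 with ⟨h2', _⟩ | ⟨h2', _⟩ <;> rw [h, h', h2, h2'] <;>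
    constructor <;> linarith

/-- The soft threshold rule shrinks more at the larger level. -/
lemma sq_softThreshold_le {l u : ℝ} (hl : 0 ≤ l) (hu : l ≤ u) (x : ℝ) :
    softThreshold u x ^ 2 ≤ softThreshold l x ^ 2 := by
  rw [softThreshold_eq hl, softThreshold_eq (hl.trans hu)]
  rcases max_cases (x - l) 0 with ⟨h, _⟩ | ⟨h, _⟩ <;>
    rcases max_cases (-x - l) 0 with ⟨h1, _⟩ | ⟨h1, _⟩ <;>
    rcases max_cases (x - u) 0 with ⟨h2, _⟩ | ⟨h2, _⟩ <;>
    rcases max_cases (-x - u) 0 with ⟨h3, _⟩ | ⟨h3, _⟩ <;> rw [h, h1, h2, h3] <;> nlinarith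
  
/-- The difference of the two rules is piecewise linear with slope 1 for l < |x| < u and slope 0
elsewhere. -/
lemma softThreshold_diff_lipschitz {l u x y : ℝ} (hl : 0 ≤ l) (hu : l ≤ u) (hxy : x ≤ y) :
    (softThreshold l y - softThreshold u y) - (softThreshold l x - softThreshold u x) ≤ y - x := by
  have key : ∀ v w : ℝ, v ≤ w → (max (w - l) 0 - max (w - u) 0) - (max (v - l) 0 - max (v - u) 0)
      ≤ max w 0 - max v 0 := by
    intro v w hvw
    rcases max_cases (w - l) 0 with ⟨h1, _⟩ | ⟨h1, _⟩ <;>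
    rcases max_cases (w - u) 0 with ⟨h2, _⟩ | ⟨h2, _⟩ <;>
    rcases max_cases (v - l) 0 with ⟨h3, _⟩ | ⟨h3, _⟩ <;>
    rcases max_cases (v - u) 0 with ⟨h4, _⟩ | ⟨h4, _⟩ <;>
    rcases max_cases w 0 with ⟨h5, _⟩ | ⟨h5, _⟩ <;>
    rcases max_cases v 0 with ⟨h6, _⟩ | ⟨h6, _⟩ <;> rw [h1, h2, h3, h4, h5, h6] <;> linarith
  have h1 := key x y hxy
  have h2 := key (-y) (-x) (by linarith)
  have h3 : max y 0 - max (-y) 0 = y := by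
    rcases max_cases y 0 with ⟨h, _⟩ | ⟨h, _⟩ <;>
    rcases max_cases (-y) 0 with ⟨h', _⟩ | ⟨h', _⟩ <;> rw [h, h'] <;> linarith
  have h4 : max x 0 - max (-x) 0 = x := by
    rcases max_cases x 0 with ⟨h, _⟩ | ⟨h, _⟩ <;>
    rcases max_cases (-x) 0 with ⟨h', _⟩ | ⟨h', _⟩ <;> rw [h, h'] <;> linarith
  simp only [softThreshold_eq hl, softThreshold_eq (hl.trans hu)]
  linarith

/-- Risk of the soft threshold rule at level `l` for a single `N(a, 1)` observation. -/
def thresholdRisk (l a : ℝ) : ℝ := ∫ z, (softThreshold l (z + a) - a) ^ 2 ∂stdGauss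

lemma sq_softThreshold_sub_le {l : ℝ} (hl : 0 ≤ l) (z a : ℝ) :
    (softThreshold l (z + a) - a) ^ 2 ≤ 2 * l ^ 2 + 2 * z ^ 2 := by
  have h := abs_le.1 (abs_softThreshold_sub_le hl (z + a))
  set s := softThreshold l (z + a)
  have h1 : (s - (z + a)) ^ 2 ≤ l ^ 2 := sq_le_sq' (by linarith [h.1]) h.2
  nlinarith [sq_nonneg ((s - (z + a)) - z)]

lemma integrable_sq_softThreshold {l : ℝ} (hl : 0 ≤ l) (a : ℝ) :
    Integrable (fun z => (softThreshold l (z + a) - a) ^ 2) stdGauss := by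
  have hc := continuous_softThreshold hl
  refine integrable_of_le_sq (by fun_prop) (2 * l ^ 2) 2 fun z => ?_
  rw [abs_of_nonneg (sq_nonneg _)]
  exact sq_softThreshold_sub_le hl z a

lemma thresholdRisk_nonneg (l a : ℝ) : 0 ≤ thresholdRisk l a :=
  integral_nonneg fun _ => sq_nonneg _

lemma thresholdRisk_neg {l : ℝ} (hl : 0 ≤ l) (a : ℝ) :
    thresholdRisk l (-a) = thresholdRisk l a := by
  rw [thresholdRisk, thresholdRisk, ← integral_stdGauss_neg]
  refine integral_congr_ae (Eventually.of_forall fun z => ?_)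
  simp only
  rw [← neg_add, softThreshold_neg hl]
  ring

lemma thresholdRisk_abs {l : ℝ} (hl : 0 ≤ l) (a : ℝ) :
    thresholdRisk l |a| = thresholdRisk l a := by
  rcases abs_choice a with h | h <;> rw [h]
  exact thresholdRisk_neg hl a

lemma thresholdRisk_symm {l : ℝ} (hl : 0 ≤ l) (a : ℝ) :
    thresholdRisk l a = 1 / 2 * ∫ z, ((softThreshold l (z + a) - a) ^ 2
      + (softThreshold l (-z + a) - a) ^ 2) ∂stdGauss :=
  integral_stdGauss_symm (integrable_sq_softThreshold hl a)

lemma integrable_symm_sq_softThreshold {l : ℝ} (hl : 0 ≤ l) (a : ℝ) :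
    Integrable (fun z => (softThreshold l (z + a) - a) ^ 2
      + (softThreshold l (-z + a) - a) ^ 2) stdGauss :=
  (integrable_sq_softThreshold hl a).add (integrable_comp_neg (integrable_sq_softThreshold hl a))

/-- With probability 1/2 the noise is nonpositive, and then the estimate misses a by at least min(a,
l). -/
lemma min_sq_le_thresholdRisk {l a : ℝ} (hl : 0 ≤ l) (ha : 0 ≤ a) :
    min (a ^ 2) (l ^ 2) ≤ 2 * thresholdRisk l a := by
  have key : ∀ z, z ≤ 0 → min (a ^ 2) (l ^ 2) ≤ (softThreshold l (z + a) - a) ^ 2 := by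
    intro z hz
    rw [softThreshold_eq hl]
    rcases max_cases (z + a - l) 0 with ⟨h, h'⟩ | ⟨h, h'⟩ <;>
      rcases max_cases (-(z + a) - l) 0 with ⟨h1, h1'⟩ | ⟨h1, h1'⟩ <;> rw [h, h1]
    · exact (min_le_right _ _).trans (by nlinarith)
    · exact (min_le_right _ _).trans (by nlinarith)
    · exact (min_le_left _ _).trans (by nlinarith)
    · exact (min_le_left _ _).trans (by nlinarith)
  rw [thresholdRisk_symm hl]
  have : ∫ _, min (a ^ 2) (l ^ 2) ∂stdGauss ≤ ∫ z, ((softThreshold l (z + a) - a) ^ 2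
      + (softThreshold l (-z + a) - a) ^ 2) ∂stdGauss := by
    refine integral_mono (integrable_const _) (integrable_symm_sq_softThreshold hl a) fun z => ?_
    dsimp only
    rcases le_total z 0 with hz | hz
    · linarith [key z hz, sq_nonneg (softThreshold l (-z + a) - a)]
    · linarith [key (-z) (by linarith), sq_nonneg (softThreshold l (z + a) - a)]
  rw [integral_const, probReal_univ, one_smul] at this
  linarith

/-- Noise z ≥ l on the side of the mean gives the error z - l whatever a ≥ 0 is, so even a nonzero
mean pays half of the null risk. -/
lemma excessMoment_le_thresholdRisk {l a : ℝ} (hl : 0 ≤ l) (ha : 0 ≤ a) :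
    excessMoment l ≤ 2 * thresholdRisk l a := by
  have key : ∀ z, 0 ≤ z → (max (z - l) 0) ^ 2 ≤ (softThreshold l (z + a) - a) ^ 2 := by
    intro z hz
    rw [softThreshold_eq hl]
    rcases max_cases (z - l) 0 with ⟨h, h'⟩ | ⟨h, h'⟩ <;> rw [h]
    · rw [max_eq_left (by linarith), max_eq_right (by linarith)]
      apply le_of_eq; ring
    · rw [zero_pow two_ne_zero]; exact sq_nonneg _
  rw [thresholdRisk_symm hl]
  have : excessMoment l ≤ ∫ z, ((softThreshold l (z + a) - a) ^ 2
      + (softThreshold l (-z + a) - a) ^ 2) ∂stdGauss := by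
    refine integral_mono (integrable_excess l) (integrable_symm_sq_softThreshold hl a) fun z => ?_
    dsimp only
    rcases le_total z 0 with hz | hz
    · rw [abs_of_nonpos hz]
      linarith [key (-z) (by linarith), sq_nonneg (softThreshold l (z + a) - a)]
    · rw [abs_of_nonneg hz]
      linarith [key z hz, sq_nonneg (softThreshold l (-z + a) - a)]
  linarith

/-- Raising the level costs little extra bias at means well below the level. -/
lemma thresholdRisk_le_add {l u a : ℝ} (hl : 0 ≤ l) (hu : l ≤ u) (ha : 0 ≤ a) :
    thresholdRisk u a ≤ thresholdRisk l a + 2 * a ^ 2 * gaussTail (l - a) := by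
  have hu0 := hl.trans hu
  rw [thresholdRisk_symm hl, thresholdRisk_symm hu0, gaussTail_eq_integral, ← integral_const_mul]
  set s : Set ℝ := {z | l - a ≤ |z|} with hs
  have hsi : Integrable (fun z => 4 * a ^ 2 * s.indicator 1 z) stdGauss := by
    have := (integrable_indicator_ge (l - a) 0).const_mul (4 * a ^ 2)
    simpa only [add_zero] using this
  have key : ∫ z, ((softThreshold u (z + a) - a) ^ 2 + (softThreshold u (-z + a) - a) ^ 2) ∂stdGauss
      ≤ ∫ z, (((softThreshold l (z + a) - a) ^ 2 + (softThreshold l (-z + a) - a) ^ 2)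
        + 4 * a ^ 2 * s.indicator 1 z) ∂stdGauss := by
    refine integral_mono (integrable_symm_sq_softThreshold hu0 a)
      ((integrable_symm_sq_softThreshold hl a).add hsi) fun z => ?_
    dsimp only
    have h1 := sq_softThreshold_le hl hu (z + a)
    have h2 := sq_softThreshold_le hl hu (-z + a)
    by_cases hz : z ∈ s
    · rw [Set.indicator_of_mem hz, Pi.one_apply]
      -- With p, q the estimates at levels l, u, one has (q - a)² - (p - a)² ≤ 2a(p - q), as q² ≤
      -- p². The values of p - q at z and -z sum to at most 2a, giving 4a² per pair.
      have h3 : (softThreshold l (z + a) - softThreshold u (z + a))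
          + (softThreshold l (-z + a) - softThreshold u (-z + a)) ≤ 2 * a := by
        rw [show -z + a = -(z - a) by ring, softThreshold_neg hl, softThreshold_neg hu0]
        linarith [softThreshold_diff_lipschitz hl hu (show z - a ≤ z + a by linarith)]
      nlinarith
    · rw [Set.indicator_of_notMem hz]
      have hz' : |z| < l - a := not_le.1 hz
      have hz2 := abs_lt.1 hz'
      have b1 : |z + a| ≤ l := abs_le.2 ⟨by linarith [hz2.1], by linarith [hz2.2]⟩
      have b2 : |-z + a| ≤ l := abs_le.2 ⟨by linarith [hz2.2], by linarith [hz2.1]⟩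
      rw [softThreshold_of_abs_le b1, softThreshold_of_abs_le b2,
        softThreshold_of_abs_le (b1.trans hu), softThreshold_of_abs_le (b2.trans hu)]
      linarith
  rw [integral_add (integrable_symm_sq_softThreshold hl a) hsi, integral_const_mul] at key
  rw [integral_const_mul]
  linarith

/-- Changing the level by `u - l` changes the root risk by at most `u - l`. -/
lemma thresholdRisk_le_mul_add {l u η : ℝ} (hl : 0 ≤ l) (hu : l ≤ u) (hη : 0 < η) (a : ℝ) :
    thresholdRisk u a ≤ (1 + η) * thresholdRisk l a + (1 + 1 / η) * (u - l) ^ 2 := by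
  have hi := (integrable_sq_softThreshold hl a).const_mul (1 + η)
  have : thresholdRisk u a ≤ ∫ z, ((1 + η) * (softThreshold l (z + a) - a) ^ 2
      + (1 + 1 / η) * (u - l) ^ 2) ∂stdGauss := by
    refine integral_mono (integrable_sq_softThreshold (hl.trans hu) a)
      (hi.add (integrable_const _)) fun z => ?_
    dsimp only
    have h := abs_le.1 (abs_softThreshold_sub_softThreshold_le hl hu (z + a))
    set p := softThreshold l (z + a) - a
    set q := softThreshold u (z + a) - softThreshold l (z + a) with hq
    have h1 : q ^ 2 ≤ (u - l) ^ 2 := sq_le_sq' h.1 h.2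
    have h2 : softThreshold u (z + a) - a = p + q := by ring
    rw [h2]
    have h3 : 2 * p * q ≤ η * p ^ 2 + 1 / η * q ^ 2 := by
      have h4 : 0 ≤ (η * p - q) ^ 2 / η := by positivity
      have h5 : (η * p - q) ^ 2 / η = η * p ^ 2 - 2 * p * q + 1 / η * q ^ 2 := by
        field_simp; ring
      linarith
    have h6 : (1 + 1 / η) * q ^ 2 ≤ (1 + 1 / η) * (u - l) ^ 2 := by gcongr
    nlinarith
  rw [integral_add hi (integrable_const _), integral_const_mul, integral_const, probReal_univ,
    one_smul] at this
  exact this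

lemma thresholdRisk_le_const {u : ℝ} (hu : 0 ≤ u) (a : ℝ) :
    thresholdRisk u a ≤ 2 * u ^ 2 + 2 := by
  have hi := integrable_sq_stdGauss.const_mul 2
  have : thresholdRisk u a ≤ ∫ z, (2 * u ^ 2 + 2 * z ^ 2) ∂stdGauss :=
    integral_mono (integrable_sq_softThreshold hu a) ((integrable_const _).add hi)
      fun z => sq_softThreshold_sub_le hu z a
  rw [integral_add (integrable_const _) hi, integral_const, probReal_univ, one_smul,
    integral_const_mul, integral_sq_stdGauss] at this
  linarith

lemma gaussTail_le_one (l : ℝ) : gaussTail l ≤ 1 := measureReal_le_one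

/-- Crude polynomial growth in the level, to be beaten by the exponentially small probability that
step-down stops so high. Means below l pay an extra bias of at most 2a²; for larger means the risk
at l is already at least l²/2. -/
lemma thresholdRisk_le_ratio {l u a : ℝ} (hl : 0 < l) (hu : l ≤ u) (ha : 0 ≤ a) :
    thresholdRisk u a ≤ 6 * (u / l) ^ 2 * thresholdRisk l a := by
  have h0 := min_sq_le_thresholdRisk hl.le ha
  have hr : 1 ≤ u / l := (one_le_div hl).2 hu
  have hr2 : 1 ≤ (u / l) ^ 2 := one_le_pow₀ hr
  have hn := thresholdRisk_nonneg l a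
  rcases le_total a l with h | h
  · have h1 := thresholdRisk_le_add hl.le hu ha
    have h2 : min (a ^ 2) (l ^ 2) = a ^ 2 := min_eq_left (by gcongr)
    have h3 : 2 * a ^ 2 * gaussTail (l - a) ≤ 2 * a ^ 2 * 1 := by
      gcongr; exact gaussTail_le_one _
    rw [h2] at h0
    nlinarith
  · have h1 := thresholdRisk_le_mul_add hl.le hu one_pos a
    have h2 : min (a ^ 2) (l ^ 2) = l ^ 2 := min_eq_right (by gcongr)
    rw [h2] at h0
    have h3 : (u - l) ^ 2 ≤ (u / l) ^ 2 * l ^ 2 := by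
      rw [div_pow, div_mul_cancel₀ _ (by positivity)]
      gcongr
      linarith
    have h4 : (u / l) ^ 2 * l ^ 2 ≤ (u / l) ^ 2 * (2 * thresholdRisk l a) := by gcongr
    nlinarith

/-! ### The excess loss of a lower level -/

/-- Pointwise bound for the additional squared error incurred by thresholding at a level at least
`l` instead of at a higher one, in terms of the noise `z = x - θ` and `a = |θ|`. -/
def excessLoss (l a z : ℝ) : ℝ := min (z ^ 2) (4 * (max (|z| - l + a / 2) 0) ^ 2)

lemma excessLoss_nonneg (l a z : ℝ) : 0 ≤ excessLoss l a z := by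
  unfold excessLoss; positivity

lemma excessLoss_neg (l a z : ℝ) : excessLoss l a (-z) = excessLoss l a z := by
  simp [excessLoss]

lemma excessLoss_le_sq (l a z : ℝ) : excessLoss l a z ≤ z ^ 2 := min_le_left _ _

lemma measurable_excessLoss (l a : ℝ) : Measurable (excessLoss l a) := by
  unfold excessLoss; fun_prop

lemma integrable_excessLoss (l a : ℝ) : Integrable (excessLoss l a) stdGauss := by
  refine integrable_of_le_sq (measurable_excessLoss l a) 0 1 fun z => ?_
  rw [abs_of_nonneg (excessLoss_nonneg _ _ _)]
  linarith [excessLoss_le_sq l a z]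

lemma integral_excessLoss_le_one (l a : ℝ) : ∫ z, excessLoss l a z ∂stdGauss ≤ 1 := by
  rw [← integral_sq_stdGauss]
  exact integral_mono (integrable_excessLoss l a) integrable_sq_stdGauss (excessLoss_le_sq l a)

/-- From |z| - l + a/2 ≤ (|z| - l)₊ + a/2 and (p + q)² ≤ 2p² + 2q²; nothing is lost when |z| < l -
a/2. -/
lemma integral_excessLoss_le {l a : ℝ} (ha : 0 ≤ a) :
    ∫ z, excessLoss l a z ∂stdGauss ≤ 8 * excessMoment l + 2 * a ^ 2 * gaussTail (l - a / 2) := by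
  rw [excessMoment, gaussTail_eq_integral, ← integral_const_mul, ← integral_const_mul,
    ← integral_add ((integrable_excess l).const_mul 8)
      (by simpa only [add_zero] using (integrable_indicator_ge (l - a / 2) 0).const_mul (2 * a ^ 2))]
  refine integral_mono (integrable_excessLoss l a) (((integrable_excess l).const_mul 8).add
      (by simpa only [add_zero] using (integrable_indicator_ge (l - a / 2) 0).const_mul (2 * a ^ 2)))
      fun z => ?_
  refine (min_le_right _ _).trans ?_
  dsimp only
  by_cases hz : l - a / 2 ≤ |z|
  · rw [Set.indicator_of_mem (by exact hz), Pi.one_apply, max_eq_left (by linarith)]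
    rcases max_cases (|z| - l) 0 with ⟨h, _⟩ | ⟨h, _⟩ <;> rw [h]
    · nlinarith [sq_nonneg (|z| - l - a / 2)]
    · nlinarith
  · rw [max_eq_right (by linarith)]
    have : 0 ≤ 2 * a ^ 2 * ({z : ℝ | l - a / 2 ≤ |z|}.indicator (1 : ℝ → ℝ) z) :=
      mul_nonneg (by positivity) (Set.indicator_nonneg (fun _ _ => zero_le_one) _)
    nlinarith [sq_nonneg (max (|z| - l) 0)]

/-- For x ≥ 0, an estimate τ ≤ θ is closer to θ than the soft estimate at u, which shrinks more. An
overshoot τ > θ is at most x - θ and at most 2(x - v) - θ, that is 2((x - θ) - v + θ/2); this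
explains the shape of `excessLoss`. For x ≤ 0 either τ = 0, as does the soft estimate at u, or the
noise exceeds v and the same excess covers the error. -/
lemma sq_sub_le_of_nonneg {l v u x τ θ : ℝ} (hl : 0 ≤ l) (hlv : l ≤ v) (hvu : v ≤ u) (hθ : 0 ≤ θ)
    (hp : 0 ≤ x → max (x - v) 0 ≤ τ ∧ τ ≤ x ∧ τ ≤ 2 * max (x - v) 0)
    (hm : x ≤ 0 → max (-x - v) 0 ≤ -τ ∧ -τ ≤ -x ∧ -τ ≤ 2 * max (-x - v) 0) :
    (τ - θ) ^ 2 ≤ (softThreshold u x - θ) ^ 2 + excessLoss l θ (x - θ) := by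
  have hlu := hlv.trans hvu
  have hν := excessLoss_nonneg l θ (x - θ)
  rw [softThreshold_eq (hl.trans hlu)]
  rcases le_total 0 x with hx | hx
  · obtain ⟨h1, h2, h3⟩ := hp hx
    rw [max_eq_right (show -x - u ≤ 0 by linarith), sub_zero]
    have h4 : max (x - u) 0 ≤ max (x - v) 0 := by gcongr
    rcases le_total τ θ with h | h
    · have : (τ - θ) ^ 2 ≤ (max (x - u) 0 - θ) ^ 2 :=
        sq_le_sq.2 (by rw [abs_of_nonpos (by linarith), abs_of_nonpos (by linarith)]; linarith)
      linarith
    · have : (τ - θ) ^ 2 ≤ excessLoss l θ (x - θ) := by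
        rw [excessLoss, abs_of_nonneg (show 0 ≤ x - θ by linarith)]
        refine le_min (by gcongr) ?_
        have h5 : τ - θ ≤ 2 * max (x - θ - l + θ / 2) 0 := by
          rcases max_cases (x - v) 0 with ⟨e, _⟩ | ⟨e, _⟩ <;> rw [e] at h3
          · have := le_max_left (x - θ - l + θ / 2) 0
            linarith
          · have := le_max_right (x - θ - l + θ / 2) 0
            linarith
        nlinarith
      nlinarith [sq_nonneg (max (x - u) 0 - θ)]
  · obtain ⟨h1, h2, h3⟩ := hm hx
    rw [max_eq_right (show x - u ≤ 0 by linarith), zero_sub]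
    rcases max_cases (-x - v) 0 with ⟨e, he⟩ | ⟨e, he⟩ <;> rw [e] at h3 h1
    · have : (τ - θ) ^ 2 ≤ excessLoss l θ (x - θ) := by
        rw [excessLoss, abs_of_nonpos (show x - θ ≤ 0 by linarith)]
        have h5 : θ - τ ≤ 2 * max (-(x - θ) - l + θ / 2) 0 := by
          have := le_max_left (-(x - θ) - l + θ / 2) 0
          linarith
        refine le_min ?_ ?_
        · nlinarith
        · nlinarith
      nlinarith [sq_nonneg (-max (-x - u) 0 - θ)]
    · have hτ : τ = 0 := by linarith
      rw [hτ, max_eq_right (by linarith)]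
      linarith

lemma sq_sub_le {l v u x τ θ : ℝ} (hl : 0 ≤ l) (hlv : l ≤ v) (hvu : v ≤ u)
    (hp : 0 ≤ x → max (x - v) 0 ≤ τ ∧ τ ≤ x ∧ τ ≤ 2 * max (x - v) 0)
    (hm : x ≤ 0 → max (-x - v) 0 ≤ -τ ∧ -τ ≤ -x ∧ -τ ≤ 2 * max (-x - v) 0) :
    (τ - θ) ^ 2 ≤ (softThreshold u x - θ) ^ 2 + excessLoss l |θ| (x - θ) := by
  rcases le_total 0 θ with hθ | hθ
  · rw [abs_of_nonneg hθ]
    exact sq_sub_le_of_nonneg hl hlv hvu hθ hp hm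
  · have h := sq_sub_le_of_nonneg (x := -x) (τ := -τ) (θ := -θ) hl hlv hvu (by linarith)
      (fun h => hm (by linarith)) (fun h => by
        rw [neg_neg, neg_neg]; exact hp (by linarith))
    rw [softThreshold_neg (hl.trans (hlv.trans hvu))] at h
    rw [← excessLoss_neg, abs_of_nonpos hθ]
    rw [show -(x - θ) = -x - -θ by ring]
    linarith

/-- The soft and hard rules both vanish at x = v, so the Lipschitz bound starts from t_v(v) = 0 and
gives the slope 2 bound. -/
lemma IsSmoothThreshold.sandwich_nonneg {κ₀ κ₁ : ℝ} {t : ℝ → ℝ → ℝ}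
    (ht : IsSmoothThreshold κ₀ κ₁ t) (hκ : κ₀ ≤ 2) {v x : ℝ} (hv : 0 ≤ v) (hx : 0 ≤ x) :
    max (x - v) 0 ≤ t v x ∧ t v x ≤ x ∧ t v x ≤ 2 * max (x - v) 0 := by
  obtain ⟨h1, h2⟩ := ht.between_nonneg v x hv hx
  have h0 : t v v = 0 := by
    obtain ⟨h3, h4⟩ := ht.between_nonneg v v hv hv
    rw [softThreshold_of_abs_le (abs_of_nonneg hv).le] at h3
    rw [hardThreshold, if_neg (by rw [abs_of_nonneg hv]; exact lt_irrefl v)] at h4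
    linarith
  rw [softThreshold_eq hv, max_eq_right (show -x - v ≤ 0 by linarith), sub_zero] at h1
  rw [hardThreshold, abs_of_nonneg hx] at h2
  refine ⟨h1, ?_, ?_⟩
  · split_ifs at h2 <;> linarith
  · split_ifs at h2 with h
    · have := (ht.lipschitz_obs v v x hv h).2
      rw [max_eq_left (by linarith)]
      nlinarith
    · have := le_max_right (x - v) 0
      linarith

lemma IsSmoothThreshold.sandwich_nonpos {κ₀ κ₁ : ℝ} {t : ℝ → ℝ → ℝ}
    (ht : IsSmoothThreshold κ₀ κ₁ t) (hκ : κ₀ ≤ 2) {v x : ℝ} (hv : 0 ≤ v) (hx : x ≤ 0) :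
    max (-x - v) 0 ≤ -t v x ∧ -t v x ≤ -x ∧ -t v x ≤ 2 * max (-x - v) 0 := by
  rcases hx.eq_or_lt with rfl | hx
  · have h := ht.sandwich_nonneg hκ hv le_rfl
    simp only [zero_sub, max_eq_right (show -v ≤ 0 by linarith), neg_zero, mul_zero] at h ⊢
    refine ⟨?_, ?_, ?_⟩ <;> linarith
  obtain ⟨h1, h2⟩ := ht.between_neg v x hv hx
  rw [softThreshold_eq hv, max_eq_right (show x - v ≤ 0 by linarith), zero_sub] at h2
  rw [hardThreshold, abs_of_neg hx] at h1
  refine ⟨by linarith, ?_, ?_⟩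
  · split_ifs at h1 <;> linarith
  · split_ifs at h1 with h
    · have h0 : t v (-v) = 0 := by
        -- At v = 0 the point -v is not negative, so the value there comes from the nonnegative
        -- half.
        rcases hv.eq_or_lt with rfl | hv'
        · have h := ht.sandwich_nonneg hκ (le_refl (0 : ℝ)) le_rfl
          simp at h ⊢
          linarith
        · obtain ⟨h3, h4⟩ := ht.between_neg v (-v) hv (by linarith)
          rw [softThreshold_of_abs_le (by rw [abs_neg, abs_of_nonneg hv])] at h4
          rw [hardThreshold, if_neg (by rw [abs_neg, abs_of_nonneg hv]; exact lt_irrefl v)] at h3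
          linarith
      have := (ht.lipschitz_obs v x (-v) hv (by linarith)).2
      rw [max_eq_left (by linarith)]
      nlinarith
    · have := le_max_right (-x - v) 0
      linarith

lemma IsSmoothThreshold.sq_sub_le {κ₀ κ₁ : ℝ} {t : ℝ → ℝ → ℝ}
    (ht : IsSmoothThreshold κ₀ κ₁ t) (hκ : κ₀ ≤ 2) {l v u : ℝ} (hl : 0 ≤ l) (hlv : l ≤ v)
    (hvu : v ≤ u) (x θ : ℝ) :
    (t v x - θ) ^ 2 ≤ (softThreshold u x - θ) ^ 2 + excessLoss l |θ| (x - θ) :=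
  FDRThreshold.sq_sub_le hl hlv hvu (fun hx => ht.sandwich_nonneg hκ (hl.trans hlv) hx)
    (fun hx => ht.sandwich_nonpos hκ (hl.trans hlv) hx)

/-- The soft rule itself at a lower level: its loss exceeds that at a higher level by at most the
excess loss. -/
lemma thresholdRisk_le_add_excessLoss {l u : ℝ} (hl : 0 ≤ l) (hlu : l ≤ u) {a : ℝ} (ha : 0 ≤ a) :
    thresholdRisk l a ≤ thresholdRisk u a + ∫ z, excessLoss l a z ∂stdGauss := by
  rw [thresholdRisk, thresholdRisk, ← integral_add
    (integrable_sq_softThreshold (hl.trans hlu) a) (integrable_excessLoss l a)]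
  refine integral_mono (integrable_sq_softThreshold hl a)
    ((integrable_sq_softThreshold (hl.trans hlu) a).add (integrable_excessLoss l a)) fun z => ?_
  have h := sq_sub_le_of_nonneg (x := z + a) (τ := softThreshold l (z + a)) hl le_rfl hlu ha
    (fun hx => by
      rw [softThreshold_eq hl, max_eq_right (show -(z + a) - l ≤ 0 by linarith), sub_zero]
      refine ⟨le_rfl, max_le (by linarith) hx, ?_⟩
      linarith [le_max_right (z + a - l) 0])
    (fun hx => by
      rw [softThreshold_eq hl, max_eq_right (show (z + a) - l ≤ 0 by linarith), zero_sub, neg_neg]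
      refine ⟨le_rfl, max_le (by linarith) (by linarith), ?_⟩
      linarith [le_max_right (-(z + a) - l) 0])
  rwa [add_sub_cancel_right] at h

/-! ### Exponential tilting by an exceedance count -/

lemma exp_mul_card_eq_prod {n : ℕ} (x : Fin n → ℝ) (c s : ℝ) :
    Real.exp (s * exceedCount x c) =
      ∏ i, Real.exp (s * {y : ℝ | c ≤ |y|}.indicator 1 (x i)) := by
  rw [← Real.exp_sum, ← Finset.mul_sum, exceedCount, Finset.card_filter]
  push_cast
  congr 2

section Tilt

variable {n : ℕ} (μ : Fin n → Measure ℝ) [∀ i, IsProbabilityMeasure (μ i)]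

lemma measurable_exp_indicator (c s : ℝ) :
    Measurable fun y : ℝ => Real.exp (s * {y : ℝ | c ≤ |y|}.indicator 1 y) := by
  have : Measurable ({y : ℝ | c ≤ |y|}.indicator (1 : ℝ → ℝ)) :=
    measurable_one.indicator (measurableSet_le measurable_const (by fun_prop))
  fun_prop

lemma exp_indicator_le (c s y : ℝ) :
    Real.exp (s * {y : ℝ | c ≤ |y|}.indicator 1 y) ≤ Real.exp (max s 0) := by
  apply Real.exp_le_exp.2
  by_cases h : y ∈ {y : ℝ | c ≤ |y|} <;> simp [h]

lemma le_exp_indicator (c s y : ℝ) :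
    Real.exp (min s 0) ≤ Real.exp (s * {y : ℝ | c ≤ |y|}.indicator 1 y) := by
  apply Real.exp_le_exp.2
  by_cases h : y ∈ {y : ℝ | c ≤ |y|} <;> simp [h]

lemma integrable_exp_indicator (ν : Measure ℝ) [IsProbabilityMeasure ν] (c s : ℝ) :
    Integrable (fun y : ℝ => Real.exp (s * {y : ℝ | c ≤ |y|}.indicator 1 y)) ν := by
  refine Integrable.mono' (integrable_const (Real.exp (max s 0)))
    (measurable_exp_indicator c s).aestronglyMeasurable (Eventually.of_forall fun y => ?_)
  rw [Real.norm_eq_abs, abs_of_pos (Real.exp_pos _)]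
  exact exp_indicator_le c s y

lemma integral_exp_indicator_le (ν : Measure ℝ) [IsProbabilityMeasure ν] (c s : ℝ) :
    ∫ y, Real.exp (s * {y : ℝ | c ≤ |y|}.indicator 1 y) ∂ν
      ≤ Real.exp (ν.real {y | c ≤ |y|} * (Real.exp s - 1)) := by
  have hm : MeasurableSet {y : ℝ | c ≤ |y|} := measurableSet_le measurable_const (by fun_prop)
  have h : ∀ y : ℝ, Real.exp (s * {y : ℝ | c ≤ |y|}.indicator 1 y)
      = 1 + {y : ℝ | c ≤ |y|}.indicator 1 y * (Real.exp s - 1) := by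
    intro y
    by_cases h : y ∈ {y : ℝ | c ≤ |y|} <;> simp [h]
  have hi : Integrable ({y : ℝ | c ≤ |y|}.indicator (1 : ℝ → ℝ)) ν :=
    (integrable_const (1 : ℝ)).indicator hm
  simp_rw [h]
  rw [integral_add (integrable_const _) (hi.mul_const _), integral_mul_const,
    integral_indicator_one hm, integral_const, probReal_univ, one_smul]
  linarith [Real.add_one_le_exp (ν.real {y | c ≤ |y|} * (Real.exp s - 1))]

lemma integral_exp_indicator_ge (ν : Measure ℝ) [IsProbabilityMeasure ν] (c s : ℝ) :
    Real.exp (min s 0) ≤ ∫ y, Real.exp (s * {y : ℝ | c ≤ |y|}.indicator 1 y) ∂ν := by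
  have := integral_mono (μ := ν) (integrable_const (Real.exp (min s 0)))
    (integrable_exp_indicator ν c s) (le_exp_indicator c s)
  simpa using this

lemma mul_exp_card_eq_prod (g : ℝ → ℝ) (i : Fin n) (x : Fin n → ℝ) (c s : ℝ) :
    g (x i) * Real.exp (s * exceedCount x c) =
      ∏ j, ((if j = i then g (x j) else 1) *
        Real.exp (s * {y : ℝ | c ≤ |y|}.indicator 1 (x j))) := by
  rw [exp_mul_card_eq_prod, Finset.prod_mul_distrib]
  simp

lemma integrable_mul_exp_indicator {ν : Measure ℝ} [IsProbabilityMeasure ν] {g : ℝ → ℝ}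
    (hg : Integrable g ν) (c s : ℝ) :
    Integrable (fun y => g y * Real.exp (s * {y : ℝ | c ≤ |y|}.indicator 1 y)) ν := by
  refine hg.mul_bdd (c := Real.exp (max s 0)) (measurable_exp_indicator c s).aestronglyMeasurable
    (Eventually.of_forall fun y => ?_)
  rw [Real.norm_eq_abs, abs_of_pos (Real.exp_pos _)]
  exact exp_indicator_le c s y

lemma integrable_factor {g : ℝ → ℝ} {i : Fin n} (hg : Integrable g (μ i)) (c s : ℝ) (j : Fin n) :
    Integrable (fun y => (if j = i then g y else 1) *
        Real.exp (s * {y : ℝ | c ≤ |y|}.indicator 1 y)) (μ j) := by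
  by_cases h : j = i
  · subst h
    simpa using integrable_mul_exp_indicator hg c s
  · simpa [h] using integrable_exp_indicator (μ j) c s

lemma integrable_mul_exp_card {g : ℝ → ℝ} {i : Fin n} (hg : Integrable g (μ i)) (c s : ℝ) :
    Integrable (fun x : Fin n → ℝ => g (x i) * Real.exp (s * exceedCount x c))
      (Measure.pi μ) := by
  simp_rw [mul_exp_card_eq_prod]
  exact Integrable.fintype_prod (integrable_factor μ hg c s)

/-- Independence factors the expectation. In coordinate i the tilt is at most e^{max(s,0)}, and
putting the missing tilt factor, at least e^{min(s,0)}, back into the product costs e^{-min(s,0)}: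
together e^{|s|}. Each tilt factor is 1 + p(e^s - 1) ≤ exp(p(e^s - 1)). -/
lemma integral_mul_exp_card_le {g : ℝ → ℝ} (hg0 : ∀ y, 0 ≤ g y) {i : Fin n}
    (hg : Integrable g (μ i)) (c s : ℝ) :
    ∫ x, g (x i) * Real.exp (s * exceedCount x c) ∂(Measure.pi μ)
      ≤ Real.exp |s| * (∫ y, g y ∂(μ i)) *
        Real.exp ((∑ j, (μ j).real {y | c ≤ |y|}) * (Real.exp s - 1)) := by
  simp_rw [mul_exp_card_eq_prod]
  rw [integral_fintype_prod_eq_prod (μ := μ) (f := fun j y => (if j = i then g y else 1) *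
    Real.exp (s * {y : ℝ | c ≤ |y|}.indicator 1 y)),
    ← Finset.mul_prod_erase Finset.univ _ (Finset.mem_univ i)]
  set w : Fin n → ℝ := fun j => ∫ y, Real.exp (s * {y : ℝ | c ≤ |y|}.indicator 1 y) ∂(μ j) with hw
  have hwpos : ∀ j, 0 ≤ w j := fun j => integral_nonneg fun y => (Real.exp_pos _).le
  have hG : 0 ≤ ∫ y, g y ∂(μ i) := integral_nonneg hg0
  have h1 : ∏ j ∈ Finset.univ.erase i, ∫ y, (if j = i then g y else 1) *
      Real.exp (s * {y : ℝ | c ≤ |y|}.indicator 1 y) ∂(μ j) = ∏ j ∈ Finset.univ.erase i, w j := by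
    refine Finset.prod_congr rfl fun j hj => ?_
    simp [hw, (Finset.mem_erase.1 hj).1]
  have h2 : ∫ y, (if i = i then g y else 1) *
      Real.exp (s * {y : ℝ | c ≤ |y|}.indicator 1 y) ∂(μ i)
      ≤ Real.exp |s| * (∫ y, g y ∂(μ i)) * w i := by
    have h3 : ∫ y, g y * Real.exp (s * {y : ℝ | c ≤ |y|}.indicator 1 y) ∂(μ i)
        ≤ ∫ y, Real.exp (max s 0) * g y ∂(μ i) := by
      refine integral_mono (integrable_mul_exp_indicator hg c s) (hg.const_mul _) fun y => ?_
      dsimp only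
      rw [mul_comm (Real.exp _)]
      exact mul_le_mul_of_nonneg_left (exp_indicator_le c s y) (hg0 y)
    rw [integral_const_mul] at h3
    have h4 : Real.exp (max s 0) = Real.exp |s| * Real.exp (min s 0) := by
      rw [← Real.exp_add]
      congr 1
      rcases le_total 0 s with h | h
      · rw [max_eq_left h, min_eq_right h, abs_of_nonneg h, add_zero]
      · rw [max_eq_right h, min_eq_left h, abs_of_nonpos h]; ring
    simp only [if_true]
    refine h3.trans ?_
    rw [h4, mul_assoc, mul_comm (Real.exp (min s 0)), ← mul_assoc]
    exact mul_le_mul_of_nonneg_left (integral_exp_indicator_ge (μ i) c s) (by positivity)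
  have h5 : ∏ j, w j ≤ Real.exp ((∑ j, (μ j).real {y | c ≤ |y|}) * (Real.exp s - 1)) := by
    rw [Finset.sum_mul, Real.exp_sum]
    exact Finset.prod_le_prod (fun j _ => hwpos j) fun j _ => integral_exp_indicator_le (μ j) c s
  rw [h1]
  calc _ ≤ (Real.exp |s| * (∫ y, g y ∂(μ i)) * w i) * ∏ j ∈ Finset.univ.erase i, w j :=
        mul_le_mul_of_nonneg_right h2 (Finset.prod_nonneg fun j _ => hwpos j)
    _ = Real.exp |s| * (∫ y, g y ∂(μ i)) * ∏ j, w j := by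
        rw [mul_assoc, Finset.mul_prod_erase Finset.univ w (Finset.mem_univ i)]
    _ ≤ _ := mul_le_mul_of_nonneg_left h5 (by positivity)

lemma integrable_sum_mul_exp_card {g : Fin n → ℝ → ℝ} (hg : ∀ i, Integrable (g i) (μ i))
    (c s : ℝ) :
    Integrable (fun x : Fin n → ℝ => (∑ i, g i (x i)) * Real.exp (s * exceedCount x c))
      (Measure.pi μ) := by
  simp_rw [Finset.sum_mul]
  exact integrable_finsetSum _ fun i _ => integrable_mul_exp_card μ (hg i) c s

/-- Chernoff-type bound for the loss restricted to an event about an exceedance count. -/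
lemma integral_sum_mul_exp_card_le {g : Fin n → ℝ → ℝ} (hg0 : ∀ i y, 0 ≤ g i y)
    (hg : ∀ i, Integrable (g i) (μ i)) (c s : ℝ) :
    ∫ x, (∑ i, g i (x i)) * Real.exp (s * exceedCount x c) ∂(Measure.pi μ)
      ≤ Real.exp |s| * (∑ i, ∫ y, g i y ∂(μ i)) *
        Real.exp ((∑ j, (μ j).real {y | c ≤ |y|}) * (Real.exp s - 1)) := by
  have h : ∀ x : Fin n → ℝ, (∑ i, g i (x i)) * Real.exp (s * exceedCount x c)
      = ∑ i, g i (x i) * Real.exp (s * exceedCount x c) := fun x => Finset.sum_mul _ _ _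
  simp_rw [h]
  rw [integral_finsetSum _ fun i _ => integrable_mul_exp_card μ (hg i) c s, Finset.mul_sum,
    Finset.sum_mul]
  exact Finset.sum_le_sum fun i _ => integral_mul_exp_card_le μ (hg0 i) (hg i) c s

lemma integral_sum_eval {g : Fin n → ℝ → ℝ} (hg : ∀ i, Integrable (g i) (μ i)) :
    ∫ x, ∑ i, g i (x i) ∂(Measure.pi μ) = ∑ i, ∫ y, g i y ∂(μ i) := by
  rw [integral_finsetSum _ fun i _ => by simpa using integrable_mul_exp_card μ (hg i) 0 0]
  refine Finset.sum_congr rfl fun i _ => ?_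
  exact integral_comp_eval (μ := μ) (hg i).aestronglyMeasurable

end Tilt

/-! ### Vector quantities -/

/-- Expected number of exceedances of the level `l`. -/
def expectedExceed {n : ℕ} (θ : Fin n → ℝ) (l : ℝ) : ℝ := ∑ i, exceedProb l |θ i|

/-- Total expected excess loss at the level `l`. -/
def totalExcess {n : ℕ} (θ : Fin n → ℝ) (l : ℝ) : ℝ :=
  ∑ i, ∫ z, excessLoss l |θ i| z ∂stdGauss

section Vector

variable {n : ℕ} (θ : Fin n → ℝ)

lemma integrable_softLoss_coord {l : ℝ} (hl : 0 ≤ l) (i : Fin n) :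
    Integrable (fun y => (softThreshold l y - θ i) ^ 2) (gaussianReal (θ i) 1) :=
  (integrable_shift_iff _ _).2 (integrable_sq_softThreshold hl (θ i))

lemma integrable_excess_coord (l : ℝ) (i : Fin n) :
    Integrable (fun y => excessLoss l |θ i| (y - θ i)) (gaussianReal (θ i) 1) := by
  rw [integrable_shift_iff]
  simpa using integrable_excessLoss l |θ i|

lemma integral_excess_coord (l : ℝ) (i : Fin n) :
    ∫ y, excessLoss l |θ i| (y - θ i) ∂(gaussianReal (θ i) 1)
      = ∫ z, excessLoss l |θ i| z ∂stdGauss := by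
  rw [integral_gaussianReal_shift]
  simp

lemma gaussianReal_real_exceed (l a : ℝ) :
    (gaussianReal a 1).real {y | l ≤ |y|} = exceedProb l |a| := by
  have hm : MeasurableSet {y : ℝ | l ≤ |y|} := measurableSet_le measurable_const (by fun_prop)
  rw [exceedProb_abs, exceedProb_eq_integral, ← integral_indicator_one hm,
    integral_gaussianReal_shift]
  rfl

lemma softRisk_eq {l : ℝ} (hl : 0 ≤ l) : softRisk θ l = ∑ i, thresholdRisk l |θ i| := by
  rw [softRisk, gaussianVec]
  simp only [sqError]
  rw [integral_sum_eval _ (g := fun i y => (softThreshold l y - θ i) ^ 2)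
    (integrable_softLoss_coord θ hl)]
  refine Finset.sum_congr rfl fun i _ => ?_
  rw [integral_gaussianReal_shift, thresholdRisk_abs hl]
  rfl

lemma softRisk_nonneg (l : ℝ) : 0 ≤ softRisk θ l :=
  integral_nonneg fun _ => Finset.sum_nonneg fun _ _ => sq_nonneg _

lemma optSoftRisk_nonneg : 0 ≤ optSoftRisk θ := Real.iInf_nonneg fun l => softRisk_nonneg θ l

lemma exists_softRisk_lt {c : ℝ} (hc : optSoftRisk θ < c) : ∃ l, 0 ≤ l ∧ softRisk θ l < c := by
  obtain ⟨l, hl⟩ := exists_lt_of_ciInf_lt hc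
  exact ⟨l, l.2, hl⟩

lemma expectedExceed_antitone : Antitone (expectedExceed θ) := fun _ _ h =>
  Finset.sum_le_sum fun i _ => exceedProb_antitone |θ i| h

lemma totalExcess_nonneg (l : ℝ) : 0 ≤ totalExcess θ l :=
  Finset.sum_nonneg fun _ _ => integral_nonneg fun _ => excessLoss_nonneg _ _ _

/-- The squared error of the soft threshold estimator, tilted by the number of exceedances. -/
lemma integral_softLoss_mul_exp_le {u : ℝ} (hu : 0 ≤ u) (c s : ℝ) :
    Integrable (fun x => sqError (fun i => softThreshold u (x i)) θ
      * Real.exp (s * exceedCount x c)) (gaussianVec θ) ∧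
    ∫ x, sqError (fun i => softThreshold u (x i)) θ * Real.exp (s * exceedCount x c)
      ∂(gaussianVec θ) ≤
      Real.exp |s| * softRisk θ u * Real.exp (expectedExceed θ c * (Real.exp s - 1)) := by
  refine ⟨integrable_sum_mul_exp_card _ (integrable_softLoss_coord θ hu) c s, ?_⟩
  refine (integral_sum_mul_exp_card_le (fun i => gaussianReal (θ i) 1)
    (g := fun i y => (softThreshold u y - θ i) ^ 2) (fun _ _ => sq_nonneg _)
    (integrable_softLoss_coord θ hu) c s).trans (le_of_eq ?_)
  rw [softRisk_eq θ hu]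
  have h : ∀ i, ∫ y, (softThreshold u y - θ i) ^ 2 ∂(gaussianReal (θ i) 1)
      = thresholdRisk u |θ i| := by
    intro i
    rw [integral_gaussianReal_shift, thresholdRisk_abs hu]; rfl
  simp only [gaussianReal_real_exceed, expectedExceed, h]

lemma integral_excess_mul_exp_le (l c s : ℝ) :
    Integrable (fun x => (∑ i, excessLoss l |θ i| (x i - θ i))
      * Real.exp (s * exceedCount x c)) (gaussianVec θ) ∧
    ∫ x, (∑ i, excessLoss l |θ i| (x i - θ i)) * Real.exp (s * exceedCount x c)
      ∂(gaussianVec θ) ≤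
      Real.exp |s| * totalExcess θ l * Real.exp (expectedExceed θ c * (Real.exp s - 1)) := by
  refine ⟨integrable_sum_mul_exp_card _ (integrable_excess_coord θ l) c s, ?_⟩
  refine (integral_sum_mul_exp_card_le (fun i => gaussianReal (θ i) 1)
    (g := fun i y => excessLoss l |θ i| (y - θ i)) (fun _ _ => excessLoss_nonneg _ _ _)
    (integrable_excess_coord θ l) c s).trans (le_of_eq ?_)
  simp only [gaussianReal_real_exceed, expectedExceed, integral_excess_coord, totalExcess]

/-! ### The adaptive levels -/

lemma exceedCount_le (x : Fin n → ℝ) (s : ℝ) : exceedCount x s ≤ n := by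
  classical
  rw [exceedCount]
  exact (Finset.card_le_univ _).trans_eq (Fintype.card_fin n)

lemma xiHatDown_spec (hn : 1 ≤ n) (α : ℝ) (x : Fin n → ℝ) :
    ∃ k ∈ Finset.Icc 1 n, xiHatDown α x = xi α n k ∧ exceedCount x (xi α n (k + 1)) < k + 1 := by
  classical
  have h := Finset.max'_mem (insert (xi α n n)
    (((Finset.Icc 1 n).filter fun k => exceedCount x (xi α n (k + 1)) < k + 1).image
      (xi α n))) (Finset.insert_nonempty _ _)
  rcases Finset.mem_insert.1 h with h | h
  · refine ⟨n, Finset.mem_Icc.2 ⟨hn, le_rfl⟩, ?_, Nat.lt_succ_of_le (exceedCount_le x _)⟩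
    rw [← h, xiHatDown]
  · obtain ⟨k, hk, hk'⟩ := Finset.mem_image.1 h
    obtain ⟨hk1, hk2⟩ := Finset.mem_filter.1 hk
    refine ⟨k, hk1, ?_, hk2⟩
    rw [hk', xiHatDown]

lemma xiHatUp_spec (α : ℝ) (x : Fin n → ℝ) :
    xiHatUp α x = xi α n 1 ∨
    ∃ k ∈ Finset.Icc 1 n, xiHatUp α x = xi α n k ∧ k ≤ exceedCount x (xi α n k) := by
  classical
  have h := Finset.min'_mem (insert (xi α n 1)
    (((Finset.Icc 1 n).filter fun k => k ≤ exceedCount x (xi α n k)).image (xi α n)))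
    (Finset.insert_nonempty _ _)
  rcases Finset.mem_insert.1 h with h | h
  · left
    rw [← h, xiHatUp]
  · right
    obtain ⟨k, hk, hk'⟩ := Finset.mem_image.1 h
    obtain ⟨hk1, hk2⟩ := Finset.mem_filter.1 hk
    refine ⟨k, hk1, ?_, hk2⟩
    rw [hk', xiHatUp]

end Vector

/-! ### Nominal tail probabilities and ordering of the candidate levels -/

section Levels

variable {α : ℝ} {n k : ℕ}

lemma level_pos (h0 : 0 < α) (hn : 1 ≤ n) (hk : 1 ≤ k) : 0 < α * k / (2 * n) := by
  have : (0 : ℝ) < n := by exact_mod_cast hn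
  have : (0 : ℝ) < k := by exact_mod_cast hk
  positivity

lemma level_lt_half (h1 : α < 1) (hn : 1 ≤ n) (hk : k ≤ n) : α * k / (2 * n) < 1 / 2 := by
  have hn' : (0 : ℝ) < n := by exact_mod_cast hn
  have hk' : (k : ℝ) ≤ n := by exact_mod_cast hk
  rw [div_lt_div_iff₀ (by positivity) (by norm_num)]
  have : (0 : ℝ) ≤ k := Nat.cast_nonneg k
  rcases this.eq_or_lt with h | h
  · rw [← h]; simp; positivity
  · nlinarith

lemma xi_pos_of_mem (h0 : 0 < α) (h1 : α < 1) (hk1 : 1 ≤ k) (hk : k ≤ n) : 0 < xi α n k :=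
  xi_pos (level_pos h0 (hk1.trans hk) hk1) (level_lt_half h1 (hk1.trans hk) hk)

lemma gaussTail_xi_of_mem (h0 : 0 < α) (h1 : α < 1) (hk1 : 1 ≤ k) (hk : k ≤ n) :
    gaussTail (xi α n k) = α * k / n :=
  gaussTail_xi (level_pos h0 (hk1.trans hk) hk1) (level_lt_half h1 (hk1.trans hk) hk)

/-- Levels with a larger nominal tail probability are lower. -/
lemma xi_le_xi {β : ℝ} {m n' : ℕ} (hp : 0 < α * k / (2 * n)) (hq : β * m / (2 * n') < 1)
    (h : α * k / (2 * n) ≤ β * m / (2 * n')) : xi β n' m ≤ xi α n k := by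
  rw [xi, xi, neg_le_neg_iff]
  by_contra hlt
  push Not at hlt
  have h2 := stdNormalCDF_mono hlt.le
  rw [stdNormalCDF_quantile hp (h.trans_lt hq), stdNormalCDF_quantile (hp.trans_le h) hq] at h2
  have h3 := le_antisymm h h2
  rw [h3] at hlt
  exact lt_irrefl _ hlt

end Levels

/-! ### Risk bound for an adaptive level between the two FDR levels -/

/-- Joint continuity makes the loss at a random level measurable. The level is clipped at 0 because
the rules are constrained only at nonnegative levels. -/
lemma IsSmoothThreshold.continuous {κ₀ κ₁ : ℝ} {t : ℝ → ℝ → ℝ}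
    (ht : IsSmoothThreshold κ₀ κ₁ t) (hκ : 0 ≤ κ₀) :
    Continuous fun p : ℝ × ℝ => t (max p.1 0) p.2 := by
  have hκ₁ : 0 ≤ κ₁ := by
    have := ht.lipschitz_level 0 1 0 le_rfl zero_le_one
    have h2 := abs_nonneg (t 0 0 - t 1 0)
    norm_num at this
    linarith
  have hobs : ∀ l x y, 0 ≤ l → |t l x - t l y| ≤ κ₀ * |x - y| := by
    intro l x y hl
    rcases lt_trichotomy x y with h | rfl | h
    · obtain ⟨h1, h2⟩ := ht.lipschitz_obs l x y hl h
      rw [abs_sub_comm, abs_sub_comm x, abs_of_nonneg h1, abs_of_pos (sub_pos.2 h)]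
      exact h2
    · simp
    · obtain ⟨h1, h2⟩ := ht.lipschitz_obs l y x hl h
      rw [abs_of_nonneg h1, abs_of_pos (sub_pos.2 h)]
      exact h2
  refine (LipschitzWith.of_dist_le' (K := κ₁ + κ₀) fun p q => ?_).continuous
  have h1 := ht.lipschitz_level (max p.1 0) (max q.1 0) p.2 (le_max_right _ _) (le_max_right _ _)
  have h2 := hobs (max q.1 0) p.2 q.2 (le_max_right _ _)
  have h3 : |max p.1 0 - max q.1 0| ≤ dist p q :=
    (abs_max_sub_max_le_abs _ _ _).trans (le_max_left _ _)
  have h4 : |p.2 - q.2| ≤ dist p q := le_max_right _ _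
  rw [Real.dist_eq]
  calc _ ≤ |t (max p.1 0) p.2 - t (max q.1 0) p.2| + |t (max q.1 0) p.2 - t (max q.1 0) q.2| :=
        abs_sub_le _ _ _
    _ ≤ κ₁ * dist p q + κ₀ * dist p q := by
        refine add_le_add (h1.trans ?_) (h2.trans ?_) <;> gcongr
    _ = _ := by ring

lemma xiHatUp_pos {n : ℕ} (hn : 1 ≤ n) {α : ℝ} (h0 : 0 < α) (h1 : α < 1) (x : Fin n → ℝ) :
    0 < xiHatUp α x := by
  rcases xiHatUp_spec α x with h | ⟨k, hk, h, -⟩ <;> rw [h]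
  · exact xi_pos_of_mem h0 h1 le_rfl hn
  · exact xi_pos_of_mem h0 h1 (Finset.mem_Icc.1 hk).1 (Finset.mem_Icc.1 hk).2

lemma softLoss_nonneg {n : ℕ} (v θ : Fin n → ℝ) : 0 ≤ sqError v θ :=
  Finset.sum_nonneg fun _ _ => sq_nonneg _

lemma IsSmoothThreshold.sqError_le {κ₀ κ₁ : ℝ} {t : ℝ → ℝ → ℝ}
    (ht : IsSmoothThreshold κ₀ κ₁ t) (hκ : κ₀ ≤ 2) {n : ℕ} (x θ : Fin n → ℝ) {l v u : ℝ}
    (hl : 0 ≤ l) (hlv : l ≤ v) (hvu : v ≤ u) :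
    sqError (fun i => t v (x i)) θ ≤ sqError (fun i => softThreshold u (x i)) θ
      + ∑ i, excessLoss l |θ i| (x i - θ i) := by
  rw [sqError, sqError, ← Finset.sum_add_distrib]
  exact Finset.sum_le_sum fun i _ => ht.sq_sub_le hκ hl hlv hvu (x i) (θ i)

-- The two single terms belong to the expected behaviour, step-up stopping by k₀ and step-down
-- stopping at or below ζ; each sum collects the exceptional stopping indices, with the event
-- replaced by its exponential majorant. For k > k₀ the inflation factor of the lower level is
-- simply dropped.
open Classical in
theorem integral_loss_le {κ₀ κ₁ : ℝ} {t : ℝ → ℝ → ℝ} (ht : IsSmoothThreshold κ₀ κ₁ t)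
    (hκ0 : 0 ≤ κ₀) (hκ : κ₀ ≤ 2) {n : ℕ} (hn : 1 ≤ n) {α₁ α₂ : ℝ} (hα₁ : 0 < α₁) (hα₁' : α₁ < 1)
    {d₁ d₂ : ℝ} (hd₁ : 0 ≤ d₁) (θ : Fin n → ℝ)
    {Ω : Type*} [MeasurableSpace Ω] {P : Measure Ω} [IsProbabilityMeasure P] {X : Ω → Fin n → ℝ}
    (hX : HasLaw X (gaussianVec θ) P) {lam : Ω → ℝ} (hlam_meas : AEMeasurable lam P)
    (hlam : ∀ᵐ ω ∂P, √(1 + d₁) * xiHatUp α₁ (X ω) ≤ lam ω ∧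
      lam ω ≤ √(1 + d₂) * xiHatDown α₂ (X ω))
    {k₀ : ℕ} (hk₀ : 1 ≤ k₀) (hk₀n : k₀ ≤ n) {ζ : ℝ} (hζ : xi α₁ n k₀ ≤ ζ) {s : ℝ} (hs : 0 ≤ s) :
    Integrable (fun ω => sqError (fun i => t (lam ω) (X ω i)) θ) P ∧
    ∫ ω, sqError (fun i => t (lam ω) (X ω i)) θ ∂P ≤
      softRisk θ (√(1 + d₂) * ζ)
      + ∑ k ∈ (Finset.Icc 1 n).filter (fun k => ζ < xi α₂ n k),
          softRisk θ (√(1 + d₂) * xi α₂ n k) *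
            Real.exp (k + 2 - expectedExceed θ (xi α₂ n (k + 1)) / 2)
      + totalExcess θ (√(1 + d₁) * xi α₁ n k₀)
      + ∑ k ∈ (Finset.Icc 1 n).filter (fun k => k₀ < k),
          totalExcess θ (xi α₁ n k) *
            Real.exp (s - s * k + expectedExceed θ (xi α₁ n k) * (Real.exp s - 1)) := by
  set r₁ := √(1 + d₁) with hr₁
  set r₂ := √(1 + d₂) with hr₂
  have hr₁1 : 1 ≤ r₁ := Real.one_le_sqrt.2 (by linarith)
  have hr₂0 : 0 ≤ r₂ := Real.sqrt_nonneg _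
  set K₂ := (Finset.Icc 1 n).filter (fun k => ζ < xi α₂ n k)
  set K₁ := (Finset.Icc 1 n).filter (fun k => k₀ < k)
  have hξ₀ : 0 < xi α₁ n k₀ := xi_pos_of_mem hα₁ hα₁' hk₀ hk₀n
  have hζ0 : 0 < ζ := hξ₀.trans_le hζ
  let S : ℝ → (Fin n → ℝ) → ℝ := fun u x => sqError (fun i => softThreshold u (x i)) θ
  let V : ℝ → (Fin n → ℝ) → ℝ := fun l x => ∑ i, excessLoss l |θ i| (x i - θ i)
  have hS0 : ∀ u x, 0 ≤ S u x := fun u x => softLoss_nonneg _ _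
  have hV0 : ∀ l x, 0 ≤ V l x := fun l x => Finset.sum_nonneg fun i _ => excessLoss_nonneg _ _ _
  let F : (Fin n → ℝ) → ℝ := fun x => S (r₂ * ζ) x
    + ∑ k ∈ K₂, S (r₂ * xi α₂ n k) x * Real.exp ((-1) * exceedCount x (xi α₂ n (k + 1)))
        * Real.exp (k + 1)
    + V (r₁ * xi α₁ n k₀) x
    + ∑ k ∈ K₁, V (xi α₁ n k) x * Real.exp (s * exceedCount x (xi α₁ n k)) * Real.exp (-(s * k))
  have hK₂pos : ∀ k ∈ K₂, 0 ≤ r₂ * xi α₂ n k := fun k hk =>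
    mul_nonneg hr₂0 (hζ0.trans (Finset.mem_filter.1 hk).2).le
  have hpath : ∀ᵐ ω ∂P, sqError (fun i => t (lam ω) (X ω i)) θ ≤ F (X ω) := by
    filter_upwards [hlam] with ω hω
    obtain ⟨hω1, hω2⟩ := hω
    set x := X ω
    have hlow : ∃ l, 0 ≤ l ∧ l ≤ lam ω ∧ V l x ≤ V (r₁ * xi α₁ n k₀) x
        + ∑ k ∈ K₁, V (xi α₁ n k) x * Real.exp (s * exceedCount x (xi α₁ n k))
          * Real.exp (-(s * k)) := by
      have hsum : 0 ≤ ∑ k ∈ K₁, V (xi α₁ n k) x * Real.exp (s * exceedCount x (xi α₁ n k))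
          * Real.exp (-(s * k)) := Finset.sum_nonneg fun k _ => by
        have := hV0 (xi α₁ n k) x
        positivity
      by_cases hc : xi α₁ n k₀ ≤ xiHatUp α₁ x
      · exact ⟨r₁ * xi α₁ n k₀, by positivity, le_trans (by gcongr) hω1, by linarith⟩
      · rcases xiHatUp_spec α₁ x with h | ⟨k, hk, h, hcount⟩
        -- The default level, used when nothing is rejected, is the highest candidate, so it cannot
        -- lie below the k₀-th.
        · exfalso
          apply hc
          rw [h]
          refine xi_le_xi (level_pos hα₁ hn le_rfl)
            ((level_lt_half hα₁' hn hk₀n).trans (by norm_num)) ?_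
          gcongr
        · have hkI := Finset.mem_Icc.1 hk
          have hkk : k₀ < k := by
            by_contra hle
            apply hc
            rw [h]
            refine xi_le_xi (level_pos hα₁ hn hkI.1)
              ((level_lt_half hα₁' hn hk₀n).trans (by norm_num)) ?_
            have : k ≤ k₀ := not_lt.1 hle
            gcongr
          have hkpos := xi_pos_of_mem hα₁ hα₁' hkI.1 hkI.2
          refine ⟨xi α₁ n k, hkpos.le, le_trans ?_ hω1, ?_⟩
          · rw [h]; nlinarith
          · have h1 : V (xi α₁ n k) x ≤ V (xi α₁ n k) x *
                Real.exp (s * exceedCount x (xi α₁ n k)) * Real.exp (-(s * k)) := by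
              rw [mul_assoc, ← Real.exp_add]
              refine le_mul_of_one_le_right (hV0 _ _) (Real.one_le_exp ?_)
              have : (k : ℝ) ≤ exceedCount x (xi α₁ n k) := by exact_mod_cast hcount
              nlinarith
            have h2 := Finset.single_le_sum (f := fun k => V (xi α₁ n k) x *
                Real.exp (s * exceedCount x (xi α₁ n k)) * Real.exp (-(s * k)))
              (fun k _ => by have := hV0 (xi α₁ n k) x; positivity)
              (Finset.mem_filter.2 ⟨hk, hkk⟩ : k ∈ K₁)
            have h3 := hV0 (r₁ * xi α₁ n k₀) x
            linarith
    have hup : ∃ u, lam ω ≤ u ∧ S u x ≤ S (r₂ * ζ) x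
        + ∑ k ∈ K₂, S (r₂ * xi α₂ n k) x * Real.exp ((-1) * exceedCount x (xi α₂ n (k + 1)))
          * Real.exp (k + 1) := by
      have hnn : ∀ k, 0 ≤ S (r₂ * xi α₂ n k) x *
          Real.exp ((-1) * exceedCount x (xi α₂ n (k + 1))) * Real.exp ((k : ℝ) + 1) := fun k => by
        have := hS0 (r₂ * xi α₂ n k) x
        positivity
      obtain ⟨k, hk, h, hcount⟩ := xiHatDown_spec hn α₂ x
      rw [h] at hω2
      by_cases hc : ζ < xi α₂ n k
      · refine ⟨_, hω2, ?_⟩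
        have h1 : S (r₂ * xi α₂ n k) x ≤ S (r₂ * xi α₂ n k) x *
          Real.exp ((-1) * exceedCount x (xi α₂ n (k + 1))) * Real.exp (k + 1) := by
          rw [mul_assoc, ← Real.exp_add]
          refine le_mul_of_one_le_right (hS0 _ _) (Real.one_le_exp ?_)
          have : (exceedCount x (xi α₂ n (k + 1)) : ℝ) ≤ k + 1 := by exact_mod_cast hcount.le
          linarith
        have h2 := Finset.single_le_sum (f := fun k : ℕ => S (r₂ * xi α₂ n k) x *
          Real.exp ((-1) * exceedCount x (xi α₂ n (k + 1))) * Real.exp ((k : ℝ) + 1))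
          (fun k _ => hnn k) (Finset.mem_filter.2 ⟨hk, hc⟩ : k ∈ K₂)
        have h3 := hS0 (r₂ * ζ) x
        linarith
      · refine ⟨r₂ * ζ, hω2.trans (by gcongr; exact not_lt.1 hc), ?_⟩
        have := Finset.sum_nonneg (s := K₂) fun k _ => hnn k
        linarith
    obtain ⟨l, hl0, hl1, hl2⟩ := hlow
    obtain ⟨u, hu1, hu2⟩ := hup
    have := ht.sqError_le hκ x θ hl0 hl1 hu1
    simp only [F]
    change _ ≤ S u x + V l x at this
    linarith
  have iS : ∀ u, 0 ≤ u → ∀ c σ, Integrable (fun x => S u x * Real.exp (σ * exceedCount x c))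
      (gaussianVec θ) := fun u hu c σ => (integral_softLoss_mul_exp_le θ hu c σ).1
  have iV : ∀ l c σ, Integrable (fun x => V l x * Real.exp (σ * exceedCount x c))
      (gaussianVec θ) := fun l c σ => (integral_excess_mul_exp_le θ l c σ).1
  have iS0 : ∀ u, 0 ≤ u → Integrable (S u) (gaussianVec θ) := fun u hu => by
    simpa using iS u hu 0 0
  have iV0 : ∀ l, Integrable (V l) (gaussianVec θ) := fun l => by simpa using iV l 0 0
  have i1 : Integrable (S (r₂ * ζ)) (gaussianVec θ) := iS0 _ (by positivity)
  have i2 : ∀ k ∈ K₂, Integrable (fun x => S (r₂ * xi α₂ n k) x *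
      Real.exp ((-1) * exceedCount x (xi α₂ n (k + 1))) * Real.exp (k + 1)) (gaussianVec θ) :=
    fun k hk => (iS _ (hK₂pos k hk) _ _).mul_const _
  have i4 : ∀ k ∈ K₁, Integrable (fun x => V (xi α₁ n k) x *
      Real.exp (s * exceedCount x (xi α₁ n k)) * Real.exp (-(s * k))) (gaussianVec θ) :=
    fun k _ => (iV _ _ _).mul_const _
  have iF : Integrable F (gaussianVec θ) :=
    ((i1.add (integrable_finsetSum _ i2)).add (iV0 _)).add (integrable_finsetSum _ i4)
  have hloss0 : ∀ ω, 0 ≤ sqError (fun i => t (lam ω) (X ω i)) θ := fun ω => softLoss_nonneg _ _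
  have iFX : Integrable (fun ω => F (X ω)) P := by
    have : Integrable F (P.map X) := by rw [hX.map_eq]; exact iF
    exact this.comp_aemeasurable hX.aemeasurable
  have hmeas : AEStronglyMeasurable (fun ω => sqError (fun i => t (lam ω) (X ω i)) θ) P := by
    have hcont := ht.continuous hκ0
    have h1 : AEMeasurable (fun ω => sqError (fun i => t (max (lam ω) 0) (X ω i)) θ) P := by
      simp only [sqError]
      refine Finset.aemeasurable_fun_sum _ fun i _ => ?_
      have h2 : AEMeasurable (fun ω => (lam ω, X ω i)) P :=
        hlam_meas.prodMk ((measurable_pi_apply i).comp_aemeasurable hX.aemeasurable)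
      exact ((hcont.measurable.comp_aemeasurable h2).sub_const _).pow_const 2
    refine h1.aestronglyMeasurable.congr ?_
    filter_upwards [hlam] with ω hω
    have : 0 ≤ lam ω := le_trans
      (mul_nonneg (by linarith) (xiHatUp_pos hn hα₁ hα₁' (X ω)).le) hω.1
    rw [max_eq_left this]
  have iL : Integrable (fun ω => sqError (fun i => t (lam ω) (X ω i)) θ) P := by
    refine iFX.mono' hmeas ?_
    filter_upwards [hpath] with ω hω
    rw [Real.norm_eq_abs, abs_of_nonneg (hloss0 ω)]
    exact hω
  refine ⟨iL, ?_⟩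
  calc _ ≤ ∫ ω, F (X ω) ∂P := integral_mono_ae iL iFX hpath
    _ = ∫ x, F x ∂(gaussianVec θ) := hX.integral_comp iF.aestronglyMeasurable
    _ = softRisk θ (r₂ * ζ) + ∑ k ∈ K₂, (∫ x, S (r₂ * xi α₂ n k) x *
          Real.exp ((-1) * exceedCount x (xi α₂ n (k + 1))) ∂(gaussianVec θ)) * Real.exp (k + 1)
        + totalExcess θ (r₁ * xi α₁ n k₀)
        + ∑ k ∈ K₁, (∫ x, V (xi α₁ n k) x *
          Real.exp (s * exceedCount x (xi α₁ n k)) ∂(gaussianVec θ)) * Real.exp (-(s * k)) := by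
        simp only [F]
        have j12 : Integrable (fun x => S (r₂ * ζ) x + ∑ k ∈ K₂, S (r₂ * xi α₂ n k) x *
            Real.exp ((-1) * exceedCount x (xi α₂ n (k + 1))) * Real.exp (k + 1))
            (gaussianVec θ) := i1.add (integrable_finsetSum _ i2)
        have j123 : Integrable (fun x => S (r₂ * ζ) x + ∑ k ∈ K₂, S (r₂ * xi α₂ n k) x *
            Real.exp ((-1) * exceedCount x (xi α₂ n (k + 1))) * Real.exp (k + 1)
            + V (r₁ * xi α₁ n k₀) x) (gaussianVec θ) := j12.add (iV0 _)
        rw [integral_add j123 (integrable_finsetSum _ i4), integral_add j12 (iV0 _),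
          integral_add i1 (integrable_finsetSum _ i2),
          integral_finsetSum _ i2, integral_finsetSum _ i4]
        simp only [integral_mul_const]
        congr 2
        simp only [V, totalExcess, gaussianVec]
        rw [integral_sum_eval _ (g := fun i y => excessLoss (r₁ * xi α₁ n k₀) |θ i| (y - θ i))
          (integrable_excess_coord θ _)]
        simp only [integral_excess_coord]
    _ ≤ _ := by
        refine add_le_add (add_le_add (add_le_add le_rfl (Finset.sum_le_sum fun k hk => ?_)) le_rfl)
          (Finset.sum_le_sum fun k hk => ?_)
        · refine (mul_le_mul_of_nonneg_right (integral_softLoss_mul_exp_le θ (hK₂pos k hk)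
            (xi α₂ n (k + 1)) (-1)).2 (Real.exp_pos _).le).trans ?_
          rw [mul_comm (Real.exp |(-1 : ℝ)|), mul_assoc, mul_assoc, ← Real.exp_add, ← Real.exp_add]
          refine mul_le_mul_of_nonneg_left (Real.exp_le_exp.2 ?_) (softRisk_nonneg θ _)
          -- Tilting with s = -1 turns M(e^{-1} - 1) into at most -M/2; the cost e^{|s|} = e raises
          -- k + 1 to k + 2.
          have h1 : Real.exp (-1) ≤ 1 / 2 := by
            rw [Real.exp_neg, inv_le_comm₀ (Real.exp_pos _) (by norm_num)]
            have := Real.add_one_le_exp (1 : ℝ)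
            norm_num; linarith
          have h2 : 0 ≤ expectedExceed θ (xi α₂ n (k + 1)) :=
            Finset.sum_nonneg fun _ _ => exceedProb_nonneg _ _
          rw [abs_neg, abs_one]
          nlinarith
        · refine (mul_le_mul_of_nonneg_right (integral_excess_mul_exp_le θ (xi α₁ n k)
            (xi α₁ n k) s).2 (Real.exp_pos _).le).trans (le_of_eq ?_)
          rw [mul_comm (Real.exp |s|), mul_assoc, mul_assoc, ← Real.exp_add, ← Real.exp_add,
            abs_of_nonneg hs]
          congr 2
          ring

section Deterministic

variable {n : ℕ} (θ : Fin n → ℝ)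

/-! ### Aggregated risk bounds -/

lemma sum_min_le_softRisk {l : ℝ} (hl : 0 ≤ l) :
    ∑ i, min (|θ i| ^ 2) (l ^ 2) ≤ 2 * softRisk θ l := by
  rw [softRisk_eq θ hl, Finset.mul_sum]
  exact Finset.sum_le_sum fun i _ => min_sq_le_thresholdRisk hl (abs_nonneg _)

lemma excessMoment_le_softRisk {l : ℝ} (hl : 0 ≤ l) : n * excessMoment l ≤ 2 * softRisk θ l := by
  rw [softRisk_eq θ hl, Finset.mul_sum]
  have := Finset.sum_le_sum (s := Finset.univ) fun i (_ : i ∈ Finset.univ) =>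
    excessMoment_le_thresholdRisk hl (abs_nonneg (θ i))
  simpa using this

lemma expectedExceed_le {l : ℝ} (hl : 0 ≤ l) :
    expectedExceed θ l ≤ n * gaussTail l + ∑ i, min (|θ i| ^ 2) 1 := by
  have := Finset.sum_le_sum (s := Finset.univ) fun i (_ : i ∈ Finset.univ) =>
    exceedProb_le_gaussTail_add_min hl (abs_nonneg (θ i))
  simpa [Finset.sum_add_distrib, expectedExceed] using this

lemma totalExcess_le (l : ℝ) :
    totalExcess θ l ≤ 8 * (n * excessMoment l) + 2 * ∑ i, min (|θ i| ^ 2) 1 := by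
  have h : ∀ i ∈ Finset.univ, ∫ z, excessLoss l |θ i| z ∂stdGauss
      ≤ 8 * excessMoment l + 2 * min (|θ i| ^ 2) 1 := by
    intro i _
    have h1 := integral_excessLoss_le (l := l) (abs_nonneg (θ i))
    have h2 := integral_excessLoss_le_one l |θ i|
    have h3 := excessMoment_nonneg l
    rcases le_total (|θ i| ^ 2) 1 with h | h
    · rw [min_eq_left h]
      have h4 := gaussTail_le_one (l - |θ i| / 2)
      nlinarith [sq_nonneg |θ i|]
    · rw [min_eq_right h]; linarith
  have := Finset.sum_le_sum h
  simp only [Finset.sum_add_distrib, Finset.sum_const, Finset.card_univ, Fintype.card_fin,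
    nsmul_eq_mul, ← Finset.mul_sum] at this
  rw [totalExcess]
  linarith

/-- Sharp form at high levels: beyond the null part, the excess is a small multiple of
`∑ min (θ i ^ 2) (L ^ 2)`. -/
lemma totalExcess_le_of_large {l L ε : ℝ} (hL : 1 ≤ ε * L ^ 2) (hL0 : 0 ≤ L)
    (hl : gaussTail (l - L / 2) ≤ ε / 2) :
    totalExcess θ l ≤ 8 * (n * excessMoment l) + ε * ∑ i, min (|θ i| ^ 2) (L ^ 2) := by
  have h : ∀ i ∈ Finset.univ, ∫ z, excessLoss l |θ i| z ∂stdGauss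
      ≤ 8 * excessMoment l + ε * min (|θ i| ^ 2) (L ^ 2) := by
    intro i _
    have h1 := integral_excessLoss_le (l := l) (abs_nonneg (θ i))
    have h2 := integral_excessLoss_le_one l |θ i|
    have h3 := excessMoment_nonneg l
    -- Means up to L meet the tail at l - L/2, at most ε/2; for larger means the excess is at most E
    -- Z² = 1 ≤ ε L².
    rcases le_total |θ i| L with h | h
    · rw [min_eq_left (by gcongr)]
      have h4 : gaussTail (l - |θ i| / 2) ≤ ε / 2 :=
        (gaussTail_antitone (by linarith)).trans hl
      nlinarith [sq_nonneg |θ i|]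
    · rw [min_eq_right (by gcongr)]; linarith
  have := Finset.sum_le_sum h
  simp only [Finset.sum_add_distrib, Finset.sum_const, Finset.card_univ, Fintype.card_fin,
    nsmul_eq_mul, ← Finset.mul_sum] at this
  rw [totalExcess]
  linarith

lemma softRisk_le_add_totalExcess {l u : ℝ} (hl : 0 ≤ l) (hlu : l ≤ u) :
    softRisk θ l ≤ softRisk θ u + totalExcess θ l := by
  rw [softRisk_eq θ hl, softRisk_eq θ (hl.trans hlu), totalExcess, ← Finset.sum_add_distrib]
  exact Finset.sum_le_sum fun i _ => thresholdRisk_le_add_excessLoss hl hlu (abs_nonneg _)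

lemma softRisk_le_ratio {l u : ℝ} (hl : 0 < l) (hlu : l ≤ u) :
    softRisk θ u ≤ 6 * (u / l) ^ 2 * softRisk θ l := by
  rw [softRisk_eq θ hl.le, softRisk_eq θ (hl.le.trans hlu), Finset.mul_sum]
  exact Finset.sum_le_sum fun i _ => thresholdRisk_le_ratio hl hlu (abs_nonneg _)

/-- A small relative increase of a high level changes the risk by a small factor. -/
lemma softRisk_le_of_near {l u ε : ℝ} (hε : 0 < ε) (hε1 : ε ≤ 1) (hl : 0 < l) (hlu : l ≤ u)
    (hul : u - l ≤ 4 * ε * l) (hQ : gaussTail (l / 2) ≤ ε / 4) :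
    softRisk θ u ≤ (1 + 257 * ε) * softRisk θ l := by
  rw [softRisk_eq θ hl.le, softRisk_eq θ (hl.le.trans hlu), Finset.mul_sum]
  refine Finset.sum_le_sum fun i _ => ?_
  set a := |θ i|
  have ha : 0 ≤ a := abs_nonneg _
  have h0 := min_sq_le_thresholdRisk hl.le ha
  have hn := thresholdRisk_nonneg l a
  -- Below l/2 the extra bias is at most (ε/2)a². Above it the risk at l is at least l²/8, so the
  -- squared change of level is of relative order ε², and Young's inequality with weight ε leaves
  -- order ε.
  rcases le_total a (l / 2) with h | h
  · have h1 := thresholdRisk_le_add hl.le hlu ha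
    have h2 : gaussTail (l - a) ≤ ε / 4 := (gaussTail_antitone (by linarith)).trans hQ
    rw [min_eq_left (by gcongr; linarith)] at h0
    nlinarith [sq_nonneg a, mul_le_mul_of_nonneg_left h2 (sq_nonneg a)]
  · have h1 := thresholdRisk_le_mul_add hl.le hlu hε a
    have h2 : l ^ 2 ≤ 8 * thresholdRisk l a := by
      have : l ^ 2 / 4 ≤ min (a ^ 2) (l ^ 2) := le_min (by nlinarith) (by nlinarith)
      linarith
    have h3 : (u - l) ^ 2 ≤ (4 * ε * l) ^ 2 := by
      have := sub_nonneg.2 hlu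
      gcongr
    have h4 : (1 + 1 / ε) * (u - l) ^ 2 ≤ (1 + 1 / ε) * (4 * ε * l) ^ 2 := by gcongr
    have h5 : (1 + 1 / ε) * (4 * ε * l) ^ 2 = 16 * (ε ^ 2 + ε) * l ^ 2 := by field_simp; ring
    have h6 : 16 * (ε ^ 2 + ε) * l ^ 2 ≤ 32 * ε * (8 * thresholdRisk l a) := by
      have : 16 * (ε ^ 2 + ε) ≤ 32 * ε := by nlinarith
      gcongr
    nlinarith

/-- The sum of the likelihood ratios of the sparsified signals `min |θ i| b` at `x`. -/
def likelihoodSum (b x : ℝ) : ℝ :=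
  ∑ i, Real.exp (-(min |θ i| b ^ 2 / 2)) * Real.cosh (min |θ i| b * x)

lemma likelihoodSum_mul_le {b x : ℝ} (hb : 0 ≤ b) (hx : 0 ≤ x) :
    likelihoodSum θ b x * gaussTail x ≤ expectedExceed θ x := by
  rw [likelihoodSum, Finset.sum_mul, expectedExceed]
  exact Finset.sum_le_sum fun i _ =>
    cosh_mul_gaussTail_le hx (le_min (abs_nonneg _) hb) (min_le_left _ _)

/-- Convexity on the segment from 0 to ry, with cosh 0 = 1. -/
lemma cosh_mul_ge {r y : ℝ} (hr : 1 ≤ r) : r * Real.cosh y - (r - 1) ≤ Real.cosh (r * y) := by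
  have hr0 : 0 < r := by linarith
  have hconv : ConvexOn ℝ Set.univ Real.cosh := by
    have h : Real.cosh = fun x => 1 / 2 * Real.exp x + 1 / 2 * Real.exp (-x) := by
      funext x; rw [Real.cosh_eq]; ring
    rw [h]
    have h2 : ConvexOn ℝ Set.univ fun x : ℝ => Real.exp (-x) := by
      have := convexOn_exp.comp_linearMap (-LinearMap.id)
      simpa [Function.comp_def] using this
    exact (convexOn_exp.smul (by norm_num : (0 : ℝ) ≤ 1 / 2)).add
      (h2.smul (by norm_num : (0 : ℝ) ≤ 1 / 2))
  have h := hconv.2 (Set.mem_univ (r * y)) (Set.mem_univ 0)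
    (by positivity : 0 ≤ 1 / r) (by rw [sub_nonneg, div_le_one hr0]; exact hr : 0 ≤ 1 - 1 / r)
    (by ring)
  simp only [smul_eq_mul, mul_zero, add_zero, Real.cosh_zero, mul_one] at h
  rw [show 1 / r * (r * y) = y by field_simp] at h
  have h2 := mul_le_mul_of_nonneg_left h hr0.le
  rw [show r * (1 / r * Real.cosh (r * y) + (1 - 1 / r)) = Real.cosh (r * y) + (r - 1) by
    field_simp] at h2
  linarith

/-- At least linear growth in the evaluation point while the truncation b stays fixed: this lets the
mean count at a level ρz gain a factor ρ, which beats the growth ρ² of the risk after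
exponentiation. -/
lemma likelihoodSum_mul_ge {b x r : ℝ} (hr : 1 ≤ r) :
    r * (likelihoodSum θ b x - n) ≤ likelihoodSum θ b (r * x) := by
  have h : ∀ i ∈ Finset.univ, r * (Real.exp (-(min |θ i| b ^ 2 / 2)) *
      Real.cosh (min |θ i| b * x) - 1) ≤
      Real.exp (-(min |θ i| b ^ 2 / 2)) * Real.cosh (min |θ i| b * (r * x)) := by
    intro i _
    set c := min |θ i| b
    have h1 := cosh_mul_ge (y := c * x) hr
    have h2 : Real.exp (-(c ^ 2 / 2)) ≤ 1 := Real.exp_le_one_iff.2 (by nlinarith [sq_nonneg c])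
    have h3 := Real.exp_pos (-(c ^ 2 / 2))
    rw [show c * (r * x) = r * (c * x) by ring]
    have h4 := mul_le_mul_of_nonneg_left h1 h3.le
    nlinarith
  have := Finset.sum_le_sum h
  simpa [← Finset.mul_sum, Finset.sum_sub_distrib, likelihoodSum] using this

/-- Means below (1 - ε)l cost little extra bias. For the others the risk is at most 10z², while with
b = min(a, z) the likelihood ratio is at least exp(bz - b²/2)/2. That exponent increases for b ≤ z,
so it is at least its value at b = (1 - ε)l, exactly the compensating exponent. -/
lemma thresholdRisk_le_of_far {l u z ε a : ℝ} (hε : 0 < ε) (hε1 : ε ≤ 1 / 2) (hl : 1 ≤ l)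
    (hlz : l ≤ (1 - ε) * z) (hzu : z ≤ u) (huz : u ≤ 2 * z) (ha : 0 ≤ a)
    (hQ : gaussTail (ε * l) ≤ ε / 4) :
    thresholdRisk u a ≤ (1 + ε) * thresholdRisk l a
      + 20 * z ^ 2 * Real.exp (-((1 - ε) * l * z - ((1 - ε) * l) ^ 2 / 2)) *
        (Real.exp (-(min a z ^ 2 / 2)) * Real.cosh (min a z * z)) := by
  have hl0 : 0 < l := by linarith
  have hz0 : 0 < z := by
    by_contra h
    nlinarith
  have hlz' : l ≤ z := by nlinarith
  have hz1 : 1 ≤ z := hl.trans hlz'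
  have hlu : l ≤ u := hlz'.trans hzu
  set e₀ := (1 - ε) * l * z - ((1 - ε) * l) ^ 2 / 2 with he₀
  have h0 := min_sq_le_thresholdRisk hl0.le ha
  have hn := thresholdRisk_nonneg l a
  have hnn : 0 ≤ Real.exp (-(min a z ^ 2 / 2)) * Real.cosh (min a z * z) :=
    mul_nonneg (Real.exp_pos _).le (Real.cosh_pos _).le
  rcases le_total a ((1 - ε) * l) with h | h
  · have h1 := thresholdRisk_le_add hl0.le hlu ha
    have h2 : gaussTail (l - a) ≤ ε / 4 := (gaussTail_antitone (by nlinarith)).trans hQ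
    have h3 : a ≤ l := by nlinarith
    rw [min_eq_left (by gcongr)] at h0
    have h4 : 0 ≤ 20 * z ^ 2 * Real.exp (-e₀) * (Real.exp (-(min a z ^ 2 / 2)) *
      Real.cosh (min a z * z)) := by positivity
    nlinarith [sq_nonneg a, mul_le_mul_of_nonneg_left h2 (sq_nonneg a)]
  · have h1 := thresholdRisk_le_const (hl0.le.trans hlu) a
    have h2 : 2 * u ^ 2 + 2 ≤ 10 * z ^ 2 := by nlinarith
    set b := min a z
    have hb0 : (1 - ε) * l ≤ b := le_min h (by nlinarith)
    have hbz : b ≤ z := min_le_right _ _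
    have h3 : e₀ ≤ b * z - b ^ 2 / 2 := by
      nlinarith [mul_nonneg (sub_nonneg.2 hb0) (sub_nonneg.2 hbz)]
    have h4 : 1 ≤ Real.exp (-e₀) * (2 * (Real.exp (-(b ^ 2 / 2)) * Real.cosh (b * z))) := by
      have h5 : Real.exp (b * z) ≤ 2 * Real.cosh (b * z) := by
        rw [Real.cosh_eq]; linarith [Real.exp_pos (-(b * z))]
      calc (1 : ℝ) ≤ Real.exp (-e₀ + (-(b ^ 2 / 2) + b * z)) := Real.one_le_exp (by linarith)
        _ = Real.exp (-e₀) * (Real.exp (-(b ^ 2 / 2)) * Real.exp (b * z)) := by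
          rw [Real.exp_add, Real.exp_add]
        _ ≤ Real.exp (-e₀) * (Real.exp (-(b ^ 2 / 2)) * (2 * Real.cosh (b * z))) := by gcongr
        _ = _ := by ring
    have h6 := mul_le_mul_of_nonneg_left h4 (show 0 ≤ 10 * z ^ 2 by positivity)
    have h7 : 0 ≤ (1 + ε) * thresholdRisk l a := by positivity
    nlinarith

/-- The compensating exponent exceeds l²/2 by at least εlz/4, which absorbs the linear term of (l +
2)²/2 and leaves εz/4 to spare. The shift by 2 matches the bound `excessMoment l` ≥ exp(-(l +
2)²/2)/3. -/
lemma exp_neg_le_of_far {l z ε : ℝ} (hε : 0 < ε) (hε1 : ε ≤ 1 / 2) (hl : 1 ≤ l)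
    (hlz : l ≤ (1 - ε) * z) (hz : 8 ≤ ε * z) :
    Real.exp (-((1 - ε) * l * z - ((1 - ε) * l) ^ 2 / 2))
      ≤ Real.exp (4 - ε * z / 4) * Real.exp (-((l + 2) ^ 2 / 2)) := by
  have hl0 : 0 < l := by linarith
  have hz0 : 0 < z := by
    by_contra h
    nlinarith
  set e₀ := (1 - ε) * l * z - ((1 - ε) * l) ^ 2 / 2 with he₀
  rw [← Real.exp_add]
  apply Real.exp_le_exp.2
  have h1 : l * z * (ε / 4) ≤ e₀ - l ^ 2 / 2 := by
    have h2 : l ^ 2 * (1 + (1 - ε) ^ 2) ≤ l * ((1 - ε) * z) * (1 + (1 - ε) ^ 2) := by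
      rw [sq l]; gcongr
    have h3 : e₀ - l ^ 2 / 2 = (1 - ε) * (l * z) - l ^ 2 * (1 + (1 - ε) ^ 2) / 2 := by
      rw [he₀]; ring
    have h4 : ε / 4 ≤ (1 - ε) - (1 - ε) * (1 + (1 - ε) ^ 2) / 2 := by
      have h : 1 / 2 * ε ≤ (1 - ε) * (2 * ε - ε ^ 2) :=
        mul_le_mul (by linarith) (by nlinarith) hε.le (by linarith)
      linarith
    have h5 := mul_le_mul_of_nonneg_left h4 (show 0 ≤ l * z by positivity)
    rw [h3]
    linarith
  have h6 : 0 ≤ (l - 1) * (ε * z / 4 - 2) := mul_nonneg (by linarith) (by linarith)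
  linarith

/-- Comparison with a much lower level: the null part of the risk at the lower level dominates. -/
lemma softRisk_le_of_far {l u z ε A : ℝ} (hε : 0 < ε) (hε1 : ε ≤ 1 / 2) (hl : 1 ≤ l)
    (hlz : l ≤ (1 - ε) * z) (hzu : z ≤ u) (huz : u ≤ 2 * z)
    (hA : likelihoodSum θ z z ≤ A * n) (hQ : gaussTail (ε * l) ≤ ε / 4) (hz : 8 ≤ ε * z)
    (hz' : 120 * A * z ^ 2 * Real.exp (4 - ε * z / 4) ≤ ε) :
    softRisk θ u ≤ (1 + 2 * ε) * softRisk θ l := by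
  have hl0 : 0 < l := by linarith
  have hz1 : 1 ≤ z := by nlinarith
  have hlz' : l ≤ z := by nlinarith
  have hlu : l ≤ u := hlz'.trans hzu
  set e₀ := (1 - ε) * l * z - ((1 - ε) * l) ^ 2 / 2 with he₀
  have hterm : ∀ i ∈ Finset.univ, thresholdRisk u |θ i| ≤ (1 + ε) * thresholdRisk l |θ i|
      + 20 * z ^ 2 * Real.exp (-e₀) * (Real.exp (-(min |θ i| z ^ 2 / 2)) *
        Real.cosh (min |θ i| z * z)) := by
    intro i _
    exact thresholdRisk_le_of_far hε hε1 hl hlz hzu huz (abs_nonneg _) hQ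
  have hsum := Finset.sum_le_sum hterm
  rw [Finset.sum_add_distrib, ← Finset.mul_sum, ← Finset.mul_sum, ← softRisk_eq θ hl0.le,
    ← softRisk_eq θ (hl0.le.trans hlu)] at hsum
  change _ ≤ (1 + ε) * softRisk θ l + 20 * z ^ 2 * Real.exp (-e₀) * likelihoodSum θ z z at hsum
  have hH : 1 / 3 * Real.exp (-((l + 2) ^ 2 / 2)) ≤ excessMoment l := by
    have h1 := le_gaussTail (l := l + 1) (h := 1) (by linarith) zero_le_one
    rw [show l + 1 + 1 = l + 2 by ring] at h1
    exact h1.trans (gaussTail_le_excessMoment l)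
  have hexp := exp_neg_le_of_far hε hε1 hl hlz hz
  rw [← he₀] at hexp
  have hAn : 20 * z ^ 2 * Real.exp (-e₀) * likelihoodSum θ z z ≤ ε * softRisk θ l := by
    have hls : 0 ≤ likelihoodSum θ z z := Finset.sum_nonneg fun i _ =>
      mul_nonneg (Real.exp_pos _).le (Real.cosh_pos _).le
    have hAn0 : 0 ≤ A * n := hls.trans hA
    calc 20 * z ^ 2 * Real.exp (-e₀) * likelihoodSum θ z z
        ≤ 20 * z ^ 2 * (Real.exp (4 - ε * z / 4) * Real.exp (-((l + 2) ^ 2 / 2))) * (A * n) := by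
          gcongr
      _ = (120 * A * z ^ 2 * Real.exp (4 - ε * z / 4)) *
          (n * (1 / 3 * Real.exp (-((l + 2) ^ 2 / 2))) / 2) := by ring
      _ ≤ ε * (n * excessMoment l / 2) := by gcongr
      _ ≤ ε * softRisk θ l := by
          gcongr
          linarith [excessMoment_le_softRisk θ hl0.le]
  linarith

/-- The soft threshold risk at a level where the likelihood sum is moderate is nearly optimal. -/
lemma softRisk_le_of_likelihoodSum_le {l z r ε A : ℝ} (hε : 0 < ε) (hε1 : ε ≤ 1 / 2) (hl : 1 ≤ l)
    (hr : 1 ≤ r) (hr' : r ≤ 1 + ε) (hA : likelihoodSum θ z z ≤ A * n)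
    (hQ : gaussTail (ε * l) ≤ ε / 4) (hz : 8 ≤ ε * z)
    (hz' : 120 * A * z ^ 2 * Real.exp (4 - ε * z / 4) ≤ ε) :
    softRisk θ (r * z) ≤ (1 + 257 * ε) * softRisk θ l + totalExcess θ (r * z) := by
  have hz0 : 0 < z := by by_contra h; nlinarith
  have hT := totalExcess_nonneg θ (r * z)
  have hS := softRisk_nonneg θ l
  -- A competitor l above rz loses only the excess; within a factor of about 1 ± ε the levels are
  -- comparable; well below z its null risk dominates.
  rcases le_total (r * z) l with h | h
  · have := softRisk_le_add_totalExcess θ (by positivity) h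
    nlinarith
  · rcases le_total ((1 - ε) * z) l with h2 | h2
    · have := softRisk_le_of_near θ hε (by linarith) (by linarith) h (by nlinarith)
        ((gaussTail_antitone (by nlinarith)).trans hQ)
      linarith
    · have := softRisk_le_of_far θ (u := r * z) hε hε1 hl h2 (by nlinarith) (by nlinarith) hA hQ hz hz'
      nlinarith

lemma sum_pow_le {q : ℝ} (hq : 0 ≤ q) (hq1 : q < 1) (n : ℕ) :
    ∑ k ∈ Finset.Icc 1 n, q ^ k ≤ q / (1 - q) := by
  have h : (∑ k ∈ Finset.Icc 1 n, q ^ k) * (1 - q) = q - q ^ (n + 1) := by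
    induction n with
    | zero => simp
    | succ m ih =>
      rw [Finset.sum_Icc_succ_top (by omega), add_mul, ih]
      ring
  rw [le_div_iff₀ (by linarith), h]
  linarith [pow_nonneg hq (n + 1)]

open Classical in
/-- The contribution of the events that the step-down level exceeds `z`. -/
lemma sum_softRisk_mul_exp_le {α : ℝ} (hα : 0 < α) (hα1 : α < 1) {z r A : ℝ} (hz : 0 < z)
    (hr : 1 ≤ r) (hA : xi α n 1 ≤ z ∨ likelihoodSum θ z z = A * n) (hB : 5 ≤ α * (A - 1) / 2) :
    ∑ k ∈ (Finset.Icc 1 n).filter (fun k => z < xi α n k),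
          softRisk θ (r * xi α n k) * Real.exp (k + 2 - expectedExceed θ (xi α n (k + 1)) / 2)
      ≤ 12 * Real.exp (-(α * (A - 1) / 2 - 4)) * softRisk θ (r * z) := by
  set B := α * (A - 1) / 2 with hBdef
  set q := Real.exp (-(B - 4)) with hq
  have hq1 : q ≤ 1 / 2 := by
    have h1 : q ≤ Real.exp (-1) := Real.exp_le_exp.2 (by linarith)
    have h2 : Real.exp (-1) ≤ 1 / 2 := by
      rw [Real.exp_neg, inv_le_comm₀ (Real.exp_pos _) (by norm_num)]
      have := Real.add_one_le_exp (1 : ℝ)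
      norm_num; linarith
    linarith
  have hS := softRisk_nonneg θ (r * z)
  have hterm : ∀ k ∈ (Finset.Icc 1 n).filter (fun k => z < xi α n k),
      softRisk θ (r * xi α n k) * Real.exp (k + 2 - expectedExceed θ (xi α n (k + 1)) / 2)
      ≤ 6 * softRisk θ (r * z) * q ^ k := by
    intro k hk
    obtain ⟨hkI, hkz⟩ := Finset.mem_filter.1 hk
    obtain ⟨hk1, hkn⟩ := Finset.mem_Icc.1 hkI
    have hn : 1 ≤ n := hk1.trans hkn
    have hnpos : (0 : ℝ) < n := by exact_mod_cast hn
    have hkpos : (1 : ℝ) ≤ k := by exact_mod_cast hk1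
    have hkn' : (k : ℝ) ≤ n := by exact_mod_cast hkn
    -- In the other alternative z is at or above every candidate, so no index k is left to sum over.
    have hlike : likelihoodSum θ z z = A * n := by
      rcases hA with h | h
      · exfalso
        have : xi α n k ≤ xi α n 1 := by
          refine xi_le_xi (level_pos hα hn le_rfl)
            ((level_lt_half hα1 hn hkn).trans (by norm_num)) ?_
          gcongr
        linarith
      · exact h
    set ρ := xi α n k / z with hρ
    have hρ1 : 1 ≤ ρ := (one_le_div hz).2 hkz.le
    have hρz : xi α n k = ρ * z := by rw [hρ]; field_simp
    -- The null tail at ξ_k is αk/n, and at ξ_k = ρz the likelihood sum is at least ρ(A - 1)n.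
    have hM : α * (A - 1) * (k * ρ) ≤ expectedExceed θ (xi α n (k + 1)) := by
      have h1 : expectedExceed θ (xi α n k) ≤ expectedExceed θ (xi α n (k + 1)) := by
        refine expectedExceed_antitone θ (xi_le_xi (level_pos hα hn hk1) ?_ ?_)
        · rw [div_lt_one (by positivity)]
          push_cast
          nlinarith
        · push_cast
          gcongr
          linarith
      have h2 := likelihoodSum_mul_le θ hz.le (hz.trans hkz).le (b := z) (x := xi α n k)
      rw [gaussTail_xi_of_mem hα hα1 hk1 hkn] at h2
      have h3 := likelihoodSum_mul_ge θ (b := z) (x := z) hρ1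
      rw [hlike, ← hρz] at h3
      have h4 : 0 ≤ α * k / n := by positivity
      have h5 := mul_le_mul_of_nonneg_right h3 h4
      have h6 : ρ * (A * n - n) * (α * k / n) = α * (A - 1) * (k * ρ) := by
        field_simp
      linarith
    have h1 : softRisk θ (r * xi α n k) ≤ 6 * ρ ^ 2 * softRisk θ (r * z) := by
      have h2 := softRisk_le_ratio θ (l := r * z) (u := r * xi α n k) (by positivity)
        (by gcongr)
      have h3 : r * xi α n k / (r * z) = ρ := by
        rw [hρ]; field_simp
      rwa [h3] at h2
    have h2 : ρ ^ 2 ≤ Real.exp ρ := by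
      have h4 : Real.exp ρ = Real.exp (ρ / 2) ^ 2 := by
        rw [← Real.exp_nat_mul]; congr 1; push_cast; ring
      have h5 := Real.quadratic_le_exp_of_nonneg (show 0 ≤ ρ / 2 by linarith)
      rw [h4]
      have h6 : ρ ≤ Real.exp (ρ / 2) := by nlinarith [sq_nonneg (ρ - 2)]
      gcongr
    calc _ ≤ 6 * Real.exp ρ * softRisk θ (r * z) * Real.exp (k + 2 - B * (k * ρ)) := by
          have h7 : 6 * ρ ^ 2 * softRisk θ (r * z) ≤ 6 * Real.exp ρ * softRisk θ (r * z) := by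
            gcongr
          have h8 : Real.exp (k + 2 - expectedExceed θ (xi α n (k + 1)) / 2)
              ≤ Real.exp (k + 2 - B * (k * ρ)) := by
            apply Real.exp_le_exp.2
            rw [hBdef]
            linarith
          exact mul_le_mul (h1.trans h7) h8 (Real.exp_pos _).le (by positivity)
      _ = 6 * softRisk θ (r * z) * Real.exp (ρ + (k + 2 - B * (k * ρ))) := by
          rw [Real.exp_add]; ring
      _ ≤ 6 * softRisk θ (r * z) * q ^ k := by
          rw [hq, ← Real.exp_nat_mul]
          gcongr
          -- Each of ρ, k and 1 is at most kρ, so ρ + k + 2 ≤ 4kρ; hence the 4 in q, and B ≥ 5 gives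
          -- q ≤ 1/2.
          have h9 : 0 ≤ (k - 1) * ρ := mul_nonneg (by linarith) (by linarith)
          have h10 : 0 ≤ k * (ρ - 1) := mul_nonneg (by linarith) (by linarith)
          nlinarith
  calc _ ≤ ∑ k ∈ (Finset.Icc 1 n).filter (fun k => z < xi α n k), 6 * softRisk θ (r * z) * q ^ k :=
        Finset.sum_le_sum hterm
    _ ≤ ∑ k ∈ Finset.Icc 1 n, 6 * softRisk θ (r * z) * q ^ k :=
        Finset.sum_le_sum_of_subset_of_nonneg (Finset.filter_subset _ _)
          fun k _ _ => by positivity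
    _ = 6 * softRisk θ (r * z) * ∑ k ∈ Finset.Icc 1 n, q ^ k := by rw [Finset.mul_sum]
    _ ≤ 6 * softRisk θ (r * z) * (2 * q) := by
        gcongr
        refine (sum_pow_le (Real.exp_pos _).le (by linarith) n).trans ?_
        rw [div_le_iff₀ (by linarith)]
        nlinarith [Real.exp_pos (-(B - 4))]
    _ = _ := by ring

/-- Existence of a level between two given ones with controlled likelihood sum. -/
lemma exists_level {x y c : ℝ} (hxy : x ≤ y) (hx : likelihoodSum θ x x ≤ c) :
    ∃ z, x ≤ z ∧ z ≤ y ∧ likelihoodSum θ z z ≤ c ∧ (y ≤ z ∨ likelihoodSum θ z z = c) := by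
  by_cases h : likelihoodSum θ y y ≤ c
  · exact ⟨y, hxy, le_rfl, h, Or.inl le_rfl⟩
  · have hcont : ContinuousOn (fun z => likelihoodSum θ z z) (Set.Icc x y) := by
      unfold likelihoodSum
      fun_prop
    obtain ⟨z, hz, hz'⟩ := intermediate_value_Icc hxy hcont ⟨hx, (not_le.1 h).le⟩
    exact ⟨z, hz.1, hz.2, hz'.le, Or.inr hz'⟩

end Deterministic

/-! ### The step-up level from below -/

/-- The nominal level is at most α/2 for every n and k ≤ n, so all candidates share a positive lower
bound and the Mills-type constants are uniform. -/
lemma xi_one_one_le {α : ℝ} (hα : 0 < α) (hα1 : α < 1) {n k : ℕ} (hk1 : 1 ≤ k) (hkn : k ≤ n) :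
    xi α 1 1 ≤ xi α n k := by
  have hn : (0 : ℝ) < n := by exact_mod_cast hk1.trans hkn
  have hkn' : (k : ℝ) ≤ n := by exact_mod_cast hkn
  refine xi_le_xi (level_pos hα (hk1.trans hkn) hk1)
    ((level_lt_half hα1 le_rfl le_rfl).trans (by norm_num)) ?_
  rw [div_le_div_iff₀ (by positivity) (by norm_num)]
  push_cast
  nlinarith

/-- Excess moment and Gaussian density at the candidate levels. -/
lemma exists_excessMoment_xi_le {α : ℝ} (hα : 0 < α) (hα1 : α < 1) :
    ∃ C : ℝ, 1 ≤ C ∧ ∀ n k : ℕ, 1 ≤ k → k ≤ n →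
      n * excessMoment (xi α n k) ≤ C * k / xi α n k ^ 2 ∧
      Real.exp (-(xi α n k ^ 2 / 2)) ≤ C * xi α n k * k / n := by
  set c := xi α 1 1 with hc
  have hc0 : 0 < c := xi_pos_of_mem hα hα1 le_rfl le_rfl
  have hE : 1 ≤ Real.exp (1 + 1 / (2 * c ^ 2)) := Real.one_le_exp (by positivity)
  refine ⟨6 * Real.exp (1 + 1 / (2 * c ^ 2)), by linarith, fun n k hk1 hkn => ?_⟩
  have hcx : c ≤ xi α n k := xi_one_one_le hα hα1 hk1 hkn
  have hn : (0 : ℝ) < n := by exact_mod_cast hk1.trans hkn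
  have hx0 : 0 < xi α n k := hc0.trans_le hcx
  have h1 := excessMoment_le_gaussTail hc0 hcx
  have h2 := exp_le_mul_gaussTail hc0 hcx
  rw [gaussTail_xi_of_mem hα hα1 hk1 hkn] at h1 h2
  constructor
  · calc n * excessMoment (xi α n k)
        ≤ n * (6 * Real.exp (1 + 1 / (2 * c ^ 2)) * (α * k / n) / xi α n k ^ 2) := by gcongr
      _ = α * (6 * Real.exp (1 + 1 / (2 * c ^ 2)) * k / xi α n k ^ 2) := by field_simp
      _ ≤ 1 * (6 * Real.exp (1 + 1 / (2 * c ^ 2)) * k / xi α n k ^ 2) := by gcongr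
      _ = _ := one_mul _
  · calc _ ≤ 3 * Real.exp (1 + 1 / (2 * c ^ 2)) * xi α n k * (α * k / n) := h2
      _ = α / 2 * (6 * Real.exp (1 + 1 / (2 * c ^ 2)) * xi α n k * k / n) := by field_simp; ring
      _ ≤ 1 * (6 * Real.exp (1 + 1 / (2 * c ^ 2)) * xi α n k * k / n) := by
        gcongr; linarith
      _ = _ := one_mul _

open Classical in
/-- The contribution of the events that the step-up level falls below the `k₀`-th candidate. -/
lemma exists_sum_totalExcess_le {α : ℝ} (hα : 0 < α) (hα1 : α < 1) :
    ∃ s C c : ℝ, 0 ≤ s ∧ 0 < C ∧ 0 < c ∧ ∀ (n : ℕ) (θ : Fin n → ℝ) (k₀ : ℕ),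
      ∑ i, min (|θ i| ^ 2) 1 ≤ (1 - α) / 2 * k₀ →
      ∑ k ∈ (Finset.Icc 1 n).filter (fun k => k₀ < k),
          totalExcess θ (xi α n k) *
            Real.exp (s - s * k + expectedExceed θ (xi α n k) * (Real.exp s - 1))
        ≤ C * Real.exp (-(c * k₀)) := by
  obtain ⟨C₁, hC₁, hlevel⟩ := exists_excessMoment_xi_le hα hα1
  set x₀ := xi α 1 1 with hx₀
  have hx₀0 : 0 < x₀ := xi_pos_of_mem hα hα1 le_rfl le_rfl
  -- For k > k₀ the nulls contribute αk to the mean count and the signals at most (1 - α)k/2, in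
  -- total βk < k.
  set β := (1 + α) / 2 with hβ
  have hβ0 : 0 < β := by rw [hβ]; linarith
  have hβ1 : β < 1 := by rw [hβ]; linarith
  -- The optimal Chernoff tilt for a Poisson mean βk exceeding k; the rate is -log β - (1 - β) > 0.
  set s := -Real.log β with hs
  have hlog : Real.log β < β - 1 := Real.log_lt_sub_one_of_pos hβ0 hβ1.ne
  set c := s - (1 - β) with hc
  have hc0 : 0 < c := by rw [hc, hs]; linarith
  have hs0 : 0 ≤ s := by rw [hs]; linarith
  have hes : Real.exp s = 1 / β := by rw [hs, Real.exp_neg, Real.exp_log hβ0, one_div]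
  set q := Real.exp (-(c / 4)) with hq
  have hq1 : q < 1 := by
    rw [hq, ← Real.exp_zero]; exact Real.exp_lt_exp.2 (by linarith)
  have hq0 : 0 < q := Real.exp_pos _
  set C₂ := 8 * C₁ / x₀ ^ 2 + 1 with hC₂
  have hC₂0 : 0 < C₂ := by positivity
  refine ⟨s, C₂ * (2 / c) * Real.exp s * (q / (1 - q)), c / 4, hs0, ?_, by positivity, ?_⟩
  · have : 0 < 1 - q := by linarith
    positivity
  intro n θ k₀ hθ
  have hterm : ∀ k ∈ (Finset.Icc 1 n).filter (fun k => k₀ < k),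
      totalExcess θ (xi α n k) *
        Real.exp (s - s * k + expectedExceed θ (xi α n k) * (Real.exp s - 1))
      ≤ C₂ * (2 / c) * Real.exp s * Real.exp (-(c / 4 * k₀)) * q ^ k := by
    intro k hk
    obtain ⟨hkI, hkk⟩ := Finset.mem_filter.1 hk
    obtain ⟨hk1, hkn⟩ := Finset.mem_Icc.1 hkI
    have hn : (0 : ℝ) < n := by exact_mod_cast hk1.trans hkn
    have hk0 : (0 : ℝ) < k := by exact_mod_cast hk1
    have hkk' : (k₀ : ℝ) ≤ k := by exact_mod_cast hkk.le
    have hx0 : x₀ ≤ xi α n k := xi_one_one_le hα hα1 hk1 hkn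
    have hmin : ∑ i, min (|θ i| ^ 2) 1 ≤ (1 - α) / 2 * k := hθ.trans (by
      have : 0 ≤ (1 - α) / 2 := by linarith
      gcongr)
    have hM : expectedExceed θ (xi α n k) ≤ β * k := by
      have h := expectedExceed_le θ (hx₀0.le.trans hx0)
      rw [gaussTail_xi_of_mem hα hα1 hk1 hkn, mul_div_cancel₀ _ hn.ne'] at h
      rw [hβ]; linarith
    have hT : totalExcess θ (xi α n k) ≤ C₂ * k := by
      have h := totalExcess_le θ (xi α n k)
      have h2 : C₁ * k / xi α n k ^ 2 ≤ C₁ * k / x₀ ^ 2 := by gcongr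
      have h3 := (hlevel n k hk1 hkn).1
      have h4 : C₂ * k = 8 * (C₁ * k / x₀ ^ 2) + k := by rw [hC₂]; ring
      nlinarith
    have hexp : Real.exp (s - s * k + expectedExceed θ (xi α n k) * (Real.exp s - 1))
        ≤ Real.exp s * Real.exp (-(c * k)) := by
      rw [← Real.exp_add]
      apply Real.exp_le_exp.2
      have h1 : 0 ≤ 1 / β - 1 := by
        rw [sub_nonneg, le_div_iff₀ hβ0]; linarith
      have h2 : expectedExceed θ (xi α n k) * (1 / β - 1) ≤ β * k * (1 / β - 1) := by gcongr
      have h3 : β * k * (1 / β - 1) = (1 - β) * k := by field_simp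
      rw [hes, hc]
      nlinarith
    have hkexp : k * Real.exp (-(c / 2 * k)) ≤ 2 / c := by
      rw [Real.exp_neg, ← div_eq_mul_inv, div_le_div_iff₀ (Real.exp_pos _) hc0]
      have := Real.add_one_le_exp (c / 2 * k)
      nlinarith
    -- Half of the rate absorbs the factor k of the total excess, a quarter gives decay in k₀ and a
    -- quarter makes the sum geometric.
    have hsplit : Real.exp (-(c * k)) ≤ Real.exp (-(c / 2 * k)) *
        (Real.exp (-(c / 4 * k₀)) * q ^ k) := by
      rw [hq, ← Real.exp_nat_mul, ← Real.exp_add, ← Real.exp_add]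
      apply Real.exp_le_exp.2
      nlinarith
    calc _ ≤ (C₂ * k) * (Real.exp s * Real.exp (-(c * k))) :=
          mul_le_mul hT hexp (Real.exp_pos _).le (by positivity)
      _ ≤ (C₂ * k) * (Real.exp s * (Real.exp (-(c / 2 * k)) *
          (Real.exp (-(c / 4 * k₀)) * q ^ k))) := by gcongr
      _ = C₂ * (k * Real.exp (-(c / 2 * k))) * Real.exp s * Real.exp (-(c / 4 * k₀)) * q ^ k := by
          ring
      _ ≤ _ := by gcongr
  calc _ ≤ ∑ k ∈ (Finset.Icc 1 n).filter (fun k => k₀ < k),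
        C₂ * (2 / c) * Real.exp s * Real.exp (-(c / 4 * k₀)) * q ^ k := Finset.sum_le_sum hterm
    _ ≤ ∑ k ∈ Finset.Icc 1 n, C₂ * (2 / c) * Real.exp s * Real.exp (-(c / 4 * k₀)) * q ^ k :=
        Finset.sum_le_sum_of_subset_of_nonneg (Finset.filter_subset _ _)
          fun k _ _ => by positivity
    _ = C₂ * (2 / c) * Real.exp s * Real.exp (-(c / 4 * k₀)) * ∑ k ∈ Finset.Icc 1 n, q ^ k := by
        rw [Finset.mul_sum]
    _ ≤ C₂ * (2 / c) * Real.exp s * Real.exp (-(c / 4 * k₀)) * (q / (1 - q)) := by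
        gcongr
        exact sum_pow_le hq0.le hq1 n
    _ = _ := by ring

/-! ### The risk bound at a fixed sample size -/

-- Assembles both brackets under explicit conditions. A near-optimal l must be at least L, which
-- bounds ∑ min(θ_i², L²) by 4ρ. That bound controls the signal part of the excess, the counts
-- beyond k₀, and H at ξ_{1,k₀}, so that the search for z can start there.
open Classical in
theorem integral_loss_le_of_levels {κ₀ κ₁ : ℝ} {t : ℝ → ℝ → ℝ} (ht : IsSmoothThreshold κ₀ κ₁ t)
    (hκ0 : 0 ≤ κ₀) (hκ : κ₀ ≤ 2) {n : ℕ} (hn : 1 ≤ n) {α₁ α₂ : ℝ} (hα₁ : 0 < α₁) (hα₁' : α₁ < 1)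
    (hα₂ : 0 < α₂) (hα : α₂ ≤ α₁) {d₁ d₂ : ℝ} (hd₁ : 0 ≤ d₁) (hd : d₁ ≤ d₂) (θ : Fin n → ℝ)
    {Ω : Type*} [MeasurableSpace Ω] {P : Measure Ω} [IsProbabilityMeasure P] {X : Ω → Fin n → ℝ}
    (hX : HasLaw X (gaussianVec θ) P) {lam : Ω → ℝ} (hlam_meas : AEMeasurable lam P)
    (hlam : ∀ᵐ ω ∂P, √(1 + d₁) * xiHatUp α₁ (X ω) ≤ lam ω ∧
      lam ω ≤ √(1 + d₂) * xiHatDown α₂ (X ω))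
    {ε L A : ℝ} (hε : 0 < ε) (hε1 : ε ≤ 1 / 2) (hL : 1 ≤ L) (hL2 : 1 ≤ ε * L ^ 2)
    (hLQ : gaussTail (ε * L) ≤ ε / 4) (hA1 : 1 / α₁ ≤ A) (hA2 : 5 ≤ α₂ * (A - 1) / 2)
    (hA3 : 12 * Real.exp (-(α₂ * (A - 1) / 2 - 4)) ≤ ε)
    {k₀ : ℕ} (hk₀ : 1 ≤ k₀) (hk₀n : k₀ ≤ n) (hρ : 0 < optSoftRisk θ)
    (hρk : 4 * optSoftRisk θ ≤ (1 - α₁) / 2 * k₀)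
    (hρL : 2 * optSoftRisk θ < n * excessMoment L)
    (hξ1 : gaussTail (xi α₁ n k₀ - L / 2) ≤ ε / 2) (hξ2 : 8 ≤ ε * xi α₁ n k₀)
    (hξ3 : ∀ z, xi α₁ n k₀ ≤ z → 120 * A * z ^ 2 * Real.exp (4 - ε * z / 4) ≤ ε)
    (hd₂ : √(1 + d₂) ≤ 1 + ε)
    (hnoise : 8 * (n * excessMoment (√(1 + d₁) * xi α₁ n k₀)) ≤ ε * optSoftRisk θ)
    {s : ℝ} (hs : 0 ≤ s)
    (hlow : ∑ i, min (|θ i| ^ 2) 1 ≤ (1 - α₁) / 2 * k₀ →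
      ∑ k ∈ (Finset.Icc 1 n).filter (fun k => k₀ < k),
          totalExcess θ (xi α₁ n k) *
            Real.exp (s - s * k + expectedExceed θ (xi α₁ n k) * (Real.exp s - 1))
        ≤ ε * optSoftRisk θ) :
    ∫ ω, sqError (fun i => t (lam ω) (X ω i)) θ ∂P ≤ (1 + 800 * ε) * optSoftRisk θ := by
  set ρ := optSoftRisk θ with hρdef
  have hα₂' : α₂ < 1 := hα.trans_lt hα₁'
  have hnpos : (0 : ℝ) < n := by exact_mod_cast hn
  have hk₀pos : (1 : ℝ) ≤ k₀ := by exact_mod_cast hk₀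
  obtain ⟨l, hl0, hl⟩ := exists_softRisk_lt θ (c := min ((1 + ε) * ρ) (n * excessMoment L / 2))
    (lt_min (by rw [← hρdef]; nlinarith) (by rw [← hρdef]; linarith))
  have hl1 : softRisk θ l ≤ (1 + ε) * ρ := (hl.trans_le (min_le_left _ _)).le
  have hl2 : softRisk θ l < n * excessMoment L / 2 := hl.trans_le (min_le_right _ _)
  -- Below L the null risk alone would exceed the risk of l.
  have hLl : L ≤ l := by
    by_contra h
    have h1 := excessMoment_antitone (not_le.1 h).le
    have h2 := excessMoment_le_softRisk θ hl0
    have h3 : n * excessMoment L ≤ n * excessMoment l := by gcongr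
    linarith
  have hminL : ∑ i, min (|θ i| ^ 2) (L ^ 2) ≤ 4 * ρ := by
    have h1 : ∑ i, min (|θ i| ^ 2) (L ^ 2) ≤ ∑ i, min (|θ i| ^ 2) (l ^ 2) :=
      Finset.sum_le_sum fun i _ => by gcongr
    have h2 := sum_min_le_softRisk θ hl0
    have h3 : ε * ρ ≤ 1 / 2 * ρ := by gcongr
    linarith
  have hmin1 : ∑ i, min (|θ i| ^ 2) 1 ≤ (1 - α₁) / 2 * k₀ := by
    have h1 : ∑ i, min (|θ i| ^ 2) 1 ≤ ∑ i, min (|θ i| ^ 2) (L ^ 2) :=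
      Finset.sum_le_sum fun i _ => by
        gcongr
        exact one_le_pow₀ hL
    linarith
  have hξ0 : 0 < xi α₁ n k₀ := xi_pos_of_mem hα₁ hα₁' hk₀ hk₀n
  have hr₁ : 1 ≤ √(1 + d₁) := Real.one_le_sqrt.2 (by linarith)
  have hr₂ : 1 ≤ √(1 + d₂) := Real.one_le_sqrt.2 (by linarith)
  have hr₁₂ : √(1 + d₁) ≤ √(1 + d₂) := Real.sqrt_le_sqrt (by linarith)
  have hT : ∀ y, √(1 + d₁) * xi α₁ n k₀ ≤ y → totalExcess θ y ≤ 5 * ε * ρ := by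
    intro y hy
    have h1 := totalExcess_le_of_large θ (l := y) hL2 (by linarith)
      ((gaussTail_antitone (sub_le_sub_right
        ((le_mul_of_one_le_left hξ0.le hr₁).trans hy) _)).trans hξ1)
    have h2 := excessMoment_antitone hy
    have h3 : n * excessMoment y ≤ n * excessMoment (√(1 + d₁) * xi α₁ n k₀) := by gcongr
    have h4 := mul_le_mul_of_nonneg_left hminL hε.le
    linarith
  have hlike : likelihoodSum θ (xi α₁ n k₀) (xi α₁ n k₀) ≤ A * n := by
    have h1 := likelihoodSum_mul_le θ hξ0.le hξ0.le (b := xi α₁ n k₀)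
    have h2 := expectedExceed_le θ hξ0.le
    rw [gaussTail_xi_of_mem hα₁ hα₁' hk₀ hk₀n] at h1 h2
    rw [mul_div_cancel₀ _ hnpos.ne'] at h2
    -- The mean count at ξ_{1,k₀} is at most α₁k₀ + (1 - α₁)k₀/2 ≤ k₀; dividing by the tail α₁k₀/n
    -- gives n/α₁, whence the requirement A ≥ 1/α₁.
    have h3 : likelihoodSum θ (xi α₁ n k₀) (xi α₁ n k₀) * (α₁ * k₀ / n) ≤ k₀ := by
      have : 0 ≤ (1 - α₁) / 2 * k₀ := mul_nonneg (by linarith) (by linarith)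
      linarith
    have h4 : likelihoodSum θ (xi α₁ n k₀) (xi α₁ n k₀) ≤ 1 / α₁ * n := by
      have h5 : (k₀ : ℝ) = 1 / α₁ * n * (α₁ * k₀ / n) := by field_simp
      exact le_of_mul_le_mul_right (h3.trans_eq h5) (by positivity)
    refine h4.trans ?_
    gcongr
  have hle : xi α₁ n k₀ ≤ xi α₂ n 1 := by
    refine xi_le_xi (level_pos hα₂ hn le_rfl)
      ((level_lt_half hα₁' hn hk₀n).trans (by norm_num)) ?_
    gcongr
  obtain ⟨z, hz1, hz2, hz3, hz4⟩ := exists_level θ hle hlike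
  have hz0 : 0 < z := hξ0.trans_le hz1
  have hup : softRisk θ (√(1 + d₂) * z) ≤ (1 + 520 * ε) * ρ := by
    have h1 := softRisk_le_of_likelihoodSum_le θ hε hε1 (hL.trans hLl) hr₂ hd₂ hz3
      ((gaussTail_antitone (by gcongr)).trans hLQ) (hξ2.trans (by gcongr)) (hξ3 z hz1)
    have h2 := hT (√(1 + d₂) * z) (by gcongr)
    have h3 : (1 + 257 * ε) * softRisk θ l ≤ (1 + 257 * ε) * ((1 + ε) * ρ) := by gcongr
    have h4 : (1 + 257 * ε) * ((1 + ε) * ρ) + 5 * ε * ρ ≤ (1 + 520 * ε) * ρ := by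
      have : 0 ≤ ρ * ε * (1 - 2 * ε) := by
        have : 0 ≤ 1 - 2 * ε := by linarith
        positivity
      have := mul_pos hρ hε
      have h5 : (1 + 257 * ε) * ((1 + ε) * ρ) + 5 * ε * ρ
        = (1 + 520 * ε) * ρ - 257 / 2 * (ρ * ε * (1 - 2 * ε)) - 257 / 2 * (ρ * ε) := by ring
      linarith
    linarith
  have hK₂ := sum_softRisk_mul_exp_le θ hα₂ hα₂' hz0 hr₂ hz4 hA2
  have hmain := (integral_loss_le ht hκ0 hκ hn hα₁ hα₁' hd₁ θ hX hlam_meas hlam hk₀ hk₀n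
    hz1 hs).2
  have hK₂' : 12 * Real.exp (-(α₂ * (A - 1) / 2 - 4)) * softRisk θ (√(1 + d₂) * z)
      ≤ ε * ((1 + 520 * ε) * ρ) :=
    mul_le_mul hA3 hup (softRisk_nonneg θ _) hε.le
  have h5 : ε * ((1 + 520 * ε) * ρ) ≤ 261 * ε * ρ := by
    have : 0 ≤ ρ * ε * (1 - 2 * ε) := by
      have : 0 ≤ 1 - 2 * ε := by linarith
      positivity
    have h9 : ε * ((1 + 520 * ε) * ρ) = 261 * ε * ρ - 260 * (ρ * ε * (1 - 2 * ε)) := by ring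
    linarith
  have h6 := hT _ le_rfl
  have h7 := hlow hmin1
  have h8 := mul_pos hε hρ
  linarith

/-- Excess moment at an inflated level, in terms of the rate `L0`. -/
lemma excessMoment_le_L0 {n : ℕ} {d ξ C : ℝ} (hd : 0 ≤ d) (hd1 : d ≤ 1) (hξ : 0 < ξ)
    (hℓ : 1 ≤ Real.log (Real.log n)) (hC : 1 ≤ C) (hξ1 : ξ ≤ 2 * √(Real.log n))
    (hexp : Real.exp (-(ξ ^ 2 / 2)) ≤ C * ξ * (d * Real.log n + Real.log (Real.log n)) / n)
    (hB : 2 * C * (d * Real.log n ^ (3 / 2 : ℝ) + Real.log (Real.log n) * √(Real.log n)) ≤ √n) :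
    n * excessMoment (√(1 + d) * ξ) ≤ 8 * C ^ 2 * (L0 d n / (n : ℝ) ^ d) := by
  set ℓ := Real.log n with hℓdef
  have hℓ1 : 1 < ℓ := by
    by_contra h
    -- `Real.log` is even, so log ℓ ≥ 1 does not exclude negative ℓ; the logarithm of a natural
    -- number is nonnegative.
    rcases lt_or_ge ℓ 0 with h0 | h0
    · have hn0 : (0 : ℝ) ≤ n := Nat.cast_nonneg n
      have := Real.log_natCast_nonneg n
      linarith
    · have := Real.log_nonpos h0 (not_lt.1 h)
      linarith
  have hn1 : (1 : ℝ) < n := by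
    by_contra h
    have := Real.log_nonpos (Nat.cast_nonneg n) (not_lt.1 h)
    linarith
  have hn0 : (0 : ℝ) < n := by linarith
  set B := d * ℓ ^ (3 / 2 : ℝ) + Real.log ℓ * √ℓ with hBdef
  have hsq : √ℓ * √ℓ = ℓ := Real.mul_self_sqrt (by linarith)
  have h32 : ℓ ^ (3 / 2 : ℝ) = ℓ * √ℓ := by
    rw [show (3 / 2 : ℝ) = 1 + 1 / 2 by norm_num, Real.rpow_add (by linarith), Real.rpow_one,
      Real.sqrt_eq_rpow]
  have hs0 : 0 < √ℓ := Real.sqrt_pos.2 (by linarith)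
  have hB0 : 0 < B := by
    rw [hBdef]
    have : 0 < Real.log ℓ * √ℓ := by positivity
    positivity
  set y := Real.exp (-(ξ ^ 2 / 2)) with hy
  have hy1 : y ≤ 2 * C * B / n := by
    refine hexp.trans ?_
    have h1 : ξ * (d * ℓ + Real.log ℓ) ≤ 2 * B := by
      have : B = √ℓ * (d * ℓ + Real.log ℓ) := by rw [hBdef, h32]; ring
      rw [this, ← mul_assoc]
      gcongr
    have h2 : C * (ξ * (d * ℓ + Real.log ℓ)) ≤ C * (2 * B) := by gcongr
    refine div_le_div_of_nonneg_right ?_ hn0.le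
    linarith
  -- As y ≤ n^{-1/2}, the level is at least √(log n), so dividing by its cube yields (log n)^{-3/2}.
  have hξ2 : ℓ ≤ ξ ^ 2 := by
    have h1 : y ≤ 1 / √n := by
      refine hy1.trans ?_
      rw [div_le_div_iff₀ hn0 (Real.sqrt_pos.2 hn0)]
      have := Real.mul_self_sqrt hn0.le
      nlinarith [Real.sqrt_nonneg (n : ℝ)]
    have h2 := Real.log_le_log (Real.exp_pos _) h1
    rw [Real.log_exp, one_div, Real.log_inv, Real.log_sqrt hn0.le] at h2
    linarith
  have hξ3 : ℓ ^ (3 / 2 : ℝ) ≤ ξ ^ 3 := by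
    have h1 : √ℓ ≤ ξ := Real.sqrt_le_iff.2 ⟨hξ.le, hξ2⟩
    rw [h32]
    calc ℓ * √ℓ ≤ ξ ^ 2 * ξ := by gcongr
      _ = ξ ^ 3 := by ring
  have hr : 1 ≤ √(1 + d) := Real.one_le_sqrt.2 (by linarith)
  have hlam0 : 0 < √(1 + d) * ξ := by positivity
  have h1 := excessMoment_le hlam0
  -- Inflating the level by √(1+d) raises the density factor to the power 1 + d, which produces both
  -- n^{-d} and the exponent in `L0`.
  have h2 : Real.exp (-((√(1 + d) * ξ) ^ 2 / 2)) = y ^ (1 + d) := by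
    rw [hy, ← Real.exp_mul, mul_pow, Real.sq_sqrt (by linarith)]
    congr 1; ring
  have h3 : y ^ (1 + d) ≤ (2 * C) ^ 2 * (B ^ (1 + d) / (n * (n : ℝ) ^ d)) := by
    calc y ^ (1 + d) ≤ (2 * C * B / n) ^ (1 + d) :=
          Real.rpow_le_rpow (Real.exp_pos _).le hy1 (by linarith)
      _ = (2 * C) ^ (1 + d) * (B ^ (1 + d) / (n * (n : ℝ) ^ d)) := by
          rw [Real.div_rpow (by positivity) hn0.le, Real.mul_rpow (by positivity) hB0.le,
            Real.rpow_add hn0, Real.rpow_one]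
          ring
      _ ≤ (2 * C) ^ (2 : ℝ) * (B ^ (1 + d) / (n * (n : ℝ) ^ d)) := by
          gcongr
          · linarith
          · linarith
      _ = _ := by norm_num
  have hℓ32 : 0 < ℓ ^ (3 / 2 : ℝ) := Real.rpow_pos_of_pos (by linarith) _
  have h4 : ℓ ^ (3 / 2 : ℝ) ≤ (√(1 + d) * ξ) ^ 3 := by
    refine hξ3.trans ?_
    gcongr
    exact le_mul_of_one_le_left hξ.le hr
  have hL0 : L0 d n = B ^ (1 + d) / ℓ ^ (3 / 2 : ℝ) := by
    rw [L0, Real.rpow_neg (by linarith)]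
    ring
  calc n * excessMoment (√(1 + d) * ξ)
      ≤ n * (2 * ((2 * C) ^ 2 * (B ^ (1 + d) / (n * (n : ℝ) ^ d))) / ℓ ^ (3 / 2 : ℝ)) := by
        gcongr
        refine h1.trans ?_
        rw [h2]
        gcongr
    _ = _ := by
        rw [hL0]
        have : 0 < (n : ℝ) ^ d := Real.rpow_pos_of_pos hn0 _
        field_simp
        ring

/-! ### Asymptotics -/

lemma tendsto_gaussTail : Tendsto gaussTail atTop (𝓝 0) := by
  have h : Tendsto (fun l : ℝ => 2 * Real.exp (-(l ^ 2 / 2))) atTop (𝓝 0) := by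
    have h1 : Tendsto (fun l : ℝ => l ^ 2 / 2) atTop atTop :=
      (tendsto_pow_atTop two_ne_zero).atTop_div_const two_pos
    simpa using (Real.tendsto_exp_neg_atTop_nhds_zero.comp h1).const_mul 2
  refine tendsto_of_tendsto_of_tendsto_of_le_of_le' tendsto_const_nhds h
    (Eventually.of_forall fun l => (gaussTail_pos l).le) ?_
  filter_upwards [eventually_ge_atTop 0] with l hl using gaussTail_le_exp hl

lemma exists_cutoff {ε : ℝ} (hε : 0 < ε) :
    ∃ L : ℝ, 1 ≤ L ∧ 1 ≤ ε * L ^ 2 ∧ gaussTail (ε * L) ≤ ε / 4 := by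
  have h1 : Tendsto (fun L : ℝ => ε * L ^ 2) atTop atTop :=
    (tendsto_pow_atTop two_ne_zero).const_mul_atTop hε
  have h2 : Tendsto (fun L : ℝ => ε * L) atTop atTop := tendsto_id.const_mul_atTop hε
  exact ((eventually_ge_atTop 1).and ((h1.eventually_ge_atTop 1).and
    ((tendsto_gaussTail.comp h2).eventually_le_const (by positivity)))).exists

lemma exists_likelihood_level {α₁ α₂ ε : ℝ} (hα₂ : 0 < α₂) (hε : 0 < ε) :
    ∃ A : ℝ, 1 / α₁ ≤ A ∧ 5 ≤ α₂ * (A - 1) / 2 ∧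
      12 * Real.exp (-(α₂ * (A - 1) / 2 - 4)) ≤ ε := by
  have h1 : Tendsto (fun A : ℝ => α₂ * (A - 1) / 2) atTop atTop :=
    ((tendsto_atTop_add_const_right _ (-1) tendsto_id).const_mul_atTop hα₂).atTop_div_const two_pos
  have h2 : Tendsto (fun A : ℝ => 12 * Real.exp (-(α₂ * (A - 1) / 2 - 4))) atTop (𝓝 0) := by
    have h := (Real.tendsto_exp_neg_atTop_nhds_zero.comp
      (tendsto_atTop_add_const_right _ (-4) h1)).const_mul 12
    rw [mul_zero] at h
    exact h
  exact ((eventually_ge_atTop (1 / α₁)).and ((h1.eventually_ge_atTop 5).and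
    (h2.eventually_le_const hε))).exists

/-- One cutoff for every condition on the base level. The third must hold for all z above it, since
z is chosen later by the intermediate value theorem. -/
lemma exists_level_bound {ε : ℝ} (hε : 0 < ε) (L A K : ℝ) :
    ∃ Z : ℝ, ∀ ξ, Z ≤ ξ → gaussTail (ξ - L / 2) ≤ ε / 2 ∧ 8 ≤ ε * ξ ∧
      (∀ z, ξ ≤ z → 120 * A * z ^ 2 * Real.exp (4 - ε * z / 4) ≤ ε) ∧ K ≤ ε * ξ ^ 2 := by
  have h1 : Tendsto (fun ξ : ℝ => gaussTail (ξ - L / 2)) atTop (𝓝 0) :=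
    tendsto_gaussTail.comp (tendsto_atTop_add_const_right _ (-(L / 2)) tendsto_id)
  have h2 : Tendsto (fun ξ : ℝ => ε * ξ) atTop atTop := tendsto_id.const_mul_atTop hε
  have h3 : Tendsto (fun z : ℝ => 120 * A * z ^ 2 * Real.exp (4 - ε * z / 4)) atTop (𝓝 0) := by
    have h := ((Real.tendsto_pow_mul_exp_neg_atTop_nhds_zero 2).comp
      (h2.atTop_div_const (by norm_num : (0 : ℝ) < 4))).const_mul
        (120 * A * (4 / ε) ^ 2 * Real.exp 4)
    rw [mul_zero] at h
    refine h.congr fun z => ?_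
    simp only [Function.comp]
    rw [sub_eq_add_neg, Real.exp_add]
    field_simp
  have h4 : Tendsto (fun ξ : ℝ => ε * ξ ^ 2) atTop atTop :=
    (tendsto_pow_atTop two_ne_zero).const_mul_atTop hε
  exact eventually_atTop.1 ((h1.eventually_le_const (by positivity)).and
    ((h2.eventually_ge_atTop 8).and
    ((eventually_forall_ge_atTop.2 (h3.eventually_le_const hε)).and (h4.eventually_ge_atTop K))))

lemma eventually_const_mul_log_pow_le (C : ℝ) {η : ℝ} (hη : 0 < η) (m : ℕ) :
    ∀ᶠ n : ℕ in atTop, C * Real.log n ^ m ≤ η * n := by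
  have h := (Real.isLittleO_pow_log_id_atTop (n := m)).const_mul_left C
  filter_upwards [tendsto_natCast_atTop_atTop.eventually (h.bound hη)] with n hn
  simp only [id, Real.norm_eq_abs, Nat.abs_cast] at hn
  exact (le_abs_self _).trans hn

/-- The noise contribution is negligible above the rate `L0`. -/
lemma noise_le {n k : ℕ} {d ξ C₁ C₂ ρ ε : ℝ} (hd : 0 ≤ d) (hd1 : d ≤ 1) (hξ : 0 < ξ)
    (hℓ : 1 ≤ Real.log (Real.log n)) (hC₁ : 1 ≤ C₁) (hC₂ : 1 ≤ C₂)
    (hk : k ≤ C₂ * (ρ + (d * Real.log n + Real.log (Real.log n))))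
    (hH : n * excessMoment ξ ≤ C₁ * k / ξ ^ 2)
    (hexp : Real.exp (-(ξ ^ 2 / 2)) ≤ C₁ * ξ * k / n)
    (hρ : 0 < ρ) (hξK : 16 * C₁ * C₂ ≤ ε * ξ ^ 2) (hξ1 : ξ ≤ 2 * √(Real.log n))
    (hB : 2 * (2 * C₁ * C₂) *
      (d * Real.log n ^ (3 / 2 : ℝ) + Real.log (Real.log n) * √(Real.log n)) ≤ √n)
    (hL0 : 64 * (2 * C₁ * C₂) ^ 2 * (L0 d n / (n : ℝ) ^ d) ≤ ε * ρ) :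
    8 * (n * excessMoment (√(1 + d) * ξ)) ≤ ε * ρ := by
  set D := d * Real.log n + Real.log (Real.log n) with hD
  -- If D ≤ ρ then k = O(ρ) and dividing by ξ² suffices, without the inflation. Otherwise k = O(D),
  -- the case for which the rate `L0` is tailored.
  rcases le_total D ρ with h | h
  · have h1 : n * excessMoment (√(1 + d) * ξ) ≤ n * excessMoment ξ := by
      gcongr
      exact excessMoment_antitone
        (le_mul_of_one_le_left hξ.le (Real.one_le_sqrt.2 (by linarith)))
    have h2 : (k : ℝ) ≤ C₂ * (2 * ρ) := hk.trans (by gcongr; linarith)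
    have h3 : C₁ * k / ξ ^ 2 ≤ C₁ * (C₂ * (2 * ρ)) / ξ ^ 2 := by gcongr
    have h4 : C₁ * (C₂ * (2 * ρ)) / ξ ^ 2 ≤ ε * ρ / 8 := by
      rw [div_le_iff₀ (by positivity)]
      nlinarith
    linarith
  · have h2 : (k : ℝ) ≤ C₂ * (2 * D) := hk.trans (by gcongr; linarith)
    have h3 : 1 ≤ 2 * C₁ * C₂ := by nlinarith
    have h4 : Real.exp (-(ξ ^ 2 / 2)) ≤ 2 * C₁ * C₂ * ξ * D / n := by
      refine hexp.trans ?_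
      calc C₁ * ξ * k / n ≤ C₁ * ξ * (C₂ * (2 * D)) / n := by gcongr
        _ = _ := by ring
    have := excessMoment_le_L0 hd hd1 hξ hℓ h3 hξ1 h4 hB
    linarith

/-- The tail αk/n is at least 2/n² once n ≥ 2/α, which forces exp(-ξ²/2) ≥ n^{-2}. -/
lemma xi_le_two_mul_sqrt_log {α : ℝ} (hα : 0 < α) (hα1 : α < 1) {n k : ℕ} (hk : 1 ≤ k)
    (hkn : k ≤ n) (hn : 2 / α ≤ n) : xi α n k ≤ 2 * √(Real.log n) := by
  have hn0 : (0 : ℝ) < n := by exact_mod_cast hk.trans hkn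
  have hξ := xi_pos_of_mem hα hα1 hk hkn
  have h1 := gaussTail_le_exp hξ.le
  rw [gaussTail_xi_of_mem hα hα1 hk hkn] at h1
  have hk1 : (1 : ℝ) ≤ k := by exact_mod_cast hk
  have h2 : ((n : ℝ) ^ 2)⁻¹ ≤ Real.exp (-(xi α n k ^ 2 / 2)) := by
    rw [div_le_iff₀ hα] at hn
    have h3 : 2 * ((n : ℝ) ^ 2)⁻¹ ≤ α * k / n := by
      rw [← div_eq_mul_inv, div_le_div_iff₀ (by positivity) hn0]
      have : n * α * 1 ≤ n * α * k := by gcongr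
      nlinarith
    linarith
  have h3 := Real.log_le_log (by positivity) h2
  rw [Real.log_exp, Real.log_inv, Real.log_pow] at h3
  have h4 : 0 ≤ Real.log n := Real.log_natCast_nonneg n
  push_cast at h3
  have h5 : xi α n k ^ 2 ≤ (2 * √(Real.log n)) ^ 2 := by
    rw [mul_pow, Real.sq_sqrt h4]; linarith
  exact le_of_sq_le_sq h5 (by positivity)

lemma base_bounds {ℓ d : ℝ} (hd : 0 ≤ d) (hd1 : d ≤ 1) (hℓ : 1 ≤ Real.log ℓ) (hℓ0 : 1 ≤ ℓ) :
    1 ≤ d * ℓ ^ (3 / 2 : ℝ) + Real.log ℓ * √ℓ ∧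
      d * ℓ ^ (3 / 2 : ℝ) + Real.log ℓ * √ℓ ≤ 2 * ℓ ^ 2 := by
  have h1 : 1 ≤ √ℓ := Real.one_le_sqrt.2 hℓ0
  have h2 : √ℓ ≤ ℓ := Real.sqrt_le_iff.2 ⟨by linarith, by nlinarith⟩
  have h3 : Real.log ℓ ≤ ℓ := (Real.log_le_sub_one_of_pos (by linarith)).trans (by linarith)
  have h4 : 0 ≤ ℓ ^ (3 / 2 : ℝ) := by positivity
  have h5 : ℓ ^ (3 / 2 : ℝ) ≤ ℓ ^ 2 := by
    rw [← Real.rpow_natCast]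
    exact Real.rpow_le_rpow_of_exponent_le hℓ0 (by norm_num)
  constructor
  · nlinarith [mul_nonneg hd h4]
  · have h6 : d * ℓ ^ (3 / 2 : ℝ) ≤ 1 * ℓ ^ 2 := by gcongr
    have h7 : Real.log ℓ * √ℓ ≤ ℓ * ℓ := by gcongr
    linarith

/-- The base of the power in `L0` is at least 1, so the right side is at least (log n)^{-3/2}
n^{-d}. This is why k₀ has to exceed a multiple of D. -/
lemma exp_neg_le_L0 {n : ℕ} {d : ℝ} (hd : 0 ≤ d) (hd1 : d ≤ 1)
    (hℓ : 1 ≤ Real.log (Real.log n)) (hℓ0 : 1 ≤ Real.log n) :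
    Real.exp (-(2 * (d * Real.log n + Real.log (Real.log n)))) ≤ L0 d n / (n : ℝ) ^ d := by
  have hn0 : (0 : ℝ) < n := by
    rcases Nat.eq_zero_or_pos n with h | h
    · rw [h, Nat.cast_zero, Real.log_zero] at hℓ0; linarith
    · exact_mod_cast h
  have hB := (base_bounds hd hd1 hℓ hℓ0).1
  have h1 : Real.log n ^ (-(3 / 2) : ℝ) ≤ L0 d n :=
    le_mul_of_one_le_right (by positivity) (Real.one_le_rpow hB (by linarith))
  have h2 : Real.log n ^ (-(3 / 2) : ℝ) = Real.exp (-(3 / 2) * Real.log (Real.log n)) := by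
    rw [Real.rpow_def_of_pos (by linarith), mul_comm]
  have h3 : (n : ℝ) ^ d = Real.exp (d * Real.log n) := by
    rw [Real.rpow_def_of_pos hn0, mul_comm]
  calc _ ≤ Real.exp (-(3 / 2) * Real.log (Real.log n)) / (n : ℝ) ^ d := by
        rw [h3, ← Real.exp_sub]
        apply Real.exp_le_exp.2
        have : 0 ≤ d * Real.log n := by positivity
        linarith
    _ ≤ _ := by
        rw [← h2]
        gcongr

lemma L0_div_pos {n : ℕ} {d : ℝ} (hd : 0 ≤ d) (hd1 : d ≤ 1)
    (hℓ : 1 ≤ Real.log (Real.log n)) (hℓ0 : 1 ≤ Real.log n) :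
    0 < L0 d n / (n : ℝ) ^ d :=
  (Real.exp_pos _).trans_le (exp_neg_le_L0 hd hd1 hℓ hℓ0)

/-- For every tolerance the risk is eventually within that factor of the optimal soft threshold
risk. -/
theorem eventually_integral_loss_le
    {α₁ α₂ κ₀ κ₁ : ℝ} (hα₂ : 0 < α₂) (hα : α₂ ≤ α₁) (hα₁ : α₁ < 1)
    (hκ₁ : 1 ≤ κ₀) (hκ₂ : κ₀ < 2)
    {t : ℝ → ℝ → ℝ} (ht : IsSmoothThreshold κ₀ κ₁ t)
    {δ₁ δ₂ : ℕ → ℝ} (hδ₁ : ∀ n, 0 ≤ δ₁ n) (hδ : ∀ n, δ₁ n ≤ δ₂ n)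
    (hδ₂ : Tendsto δ₂ atTop (𝓝 0)) (θ : (n : ℕ) → Fin n → ℝ)
    {Ω : ℕ → Type*} [∀ n, MeasurableSpace (Ω n)] {P : (n : ℕ) → Measure (Ω n)}
    [∀ n, IsProbabilityMeasure (P n)] {X : (n : ℕ) → Ω n → Fin n → ℝ}
    (hX : ∀ n, 1 ≤ n → HasLaw (X n) (gaussianVec (θ n)) (P n))
    {lam : (n : ℕ) → Ω n → ℝ} (hlam_meas : ∀ n, 1 ≤ n → AEMeasurable (lam n) (P n))
    (hlam : ∀ n, 1 ≤ n → ∀ᵐ ω ∂(P n),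
      √(1 + δ₁ n) * xiHatUp α₁ (X n ω) ≤ lam n ω ∧
        lam n ω ≤ √(1 + δ₂ n) * xiHatDown α₂ (X n ω))
    (hlower : (fun n : ℕ => L0 (δ₁ n) n / (n : ℝ) ^ (δ₁ n))
      =o[atTop] fun n : ℕ => optSoftRisk (θ n))
    (hupper : (fun n : ℕ => optSoftRisk (θ n)) =o[atTop] fun n : ℕ => (n : ℝ))
    {ε : ℝ} (hε : 0 < ε) (hε1 : ε ≤ 1 / 2) :
    ∀ᶠ n in atTop, 0 < optSoftRisk (θ n) ∧
      ∫ ω, sqError (fun i => t (lam n ω) (X n ω i)) (θ n) ∂(P n)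
        ≤ (1 + 800 * ε) * optSoftRisk (θ n) := by
  have hα₁0 : 0 < α₁ := hα₂.trans_le hα
  obtain ⟨L, hL, hL2, hLQ⟩ := exists_cutoff hε
  obtain ⟨A, hA1, hA2, hA3⟩ := exists_likelihood_level (α₁ := α₁) hα₂ hε
  obtain ⟨s, C₃, c, hs, hC₃, hc, hsum⟩ := exists_sum_totalExcess_le hα₁0 hα₁
  obtain ⟨C₁, hC₁, hlevel⟩ := exists_excessMoment_xi_le hα₁0 hα₁
  -- The factor in k₀: 8/(1 - α₁) makes room for signal mass 4ρ within (1 - α₁)k₀/2, and 2/c makes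
  -- e^{-ck₀} ≤ e^{-2D}.
  obtain ⟨C₀, hC₀⟩ : ∃ C₀ : ℝ, 1 ≤ C₀ ∧ 8 / (1 - α₁) ≤ C₀ ∧ 2 / c ≤ C₀ :=
    ⟨max 1 (max (8 / (1 - α₁)) (2 / c)), le_max_left _ _,
      (le_max_left _ _).trans (le_max_right _ _), (le_max_right _ _).trans (le_max_right _ _)⟩
  obtain ⟨hC₀1, hC₀α, hC₀c⟩ := hC₀
  obtain ⟨Z, hZ⟩ := exists_level_bound hε L A (16 * C₁ * (C₀ + 1))
  have hH0 : 0 < excessMoment L := (gaussTail_pos _).trans_le (gaussTail_le_excessMoment L)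
  -- The ρ part of k₀, its D part and the rounding will each cost at most ηn, so k₀ < n and the tail
  -- at ξ_{1,k₀} is below the tail at Z, forcing ξ_{1,k₀} > Z.
  set η := min (gaussTail Z) 1 / 4 with hη
  have hη0 : 0 < η := by
    have := gaussTail_pos Z
    positivity
  have hη1 : 4 * η ≤ 1 := by rw [hη]; linarith [min_le_right (gaussTail Z) 1]
  have hηZ : 4 * η ≤ gaussTail Z := by rw [hη]; linarith [min_le_left (gaussTail Z) 1]
  have hlogn : Tendsto (fun n : ℕ => Real.log n) atTop atTop :=
    Real.tendsto_log_atTop.comp tendsto_natCast_atTop_atTop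
  have hδ₂s : Tendsto (fun n => √(1 + δ₂ n)) atTop (𝓝 1) := by
    have h := (hδ₂.const_add 1).sqrt
    rwa [add_zero, Real.sqrt_one] at h
  have hC₀0 : 0 < C₀ := by linarith
  filter_upwards [eventually_ge_atTop 1,
    (Real.tendsto_log_atTop.comp hlogn).eventually_ge_atTop 1,
    hlogn.eventually_ge_atTop 1,
    hδ₂.eventually_le_const one_pos,
    hδ₂s.eventually_le_const (by linarith : 1 < 1 + ε),
    hupper.bound (c := η / C₀) (by positivity),
    hupper.bound (c := excessMoment L / 4) (by positivity),
    -- One constant covers both uses of the lower risk bound: the step-up remainder through C₃ and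
    -- the noise through the other summand.
    hlower.bound (c := ε / (C₃ + 64 * (2 * C₁ * (C₀ + 1)) ^ 2)) (by positivity),
    eventually_const_mul_log_pow_le (2 * C₀) hη0 1,
    eventually_const_mul_log_pow_le ((2 * (2 * C₁ * (C₀ + 1)) * 2) ^ 2) one_pos 4,
    tendsto_natCast_atTop_atTop.eventually_ge_atTop (2 / α₁),
    tendsto_natCast_atTop_atTop.eventually_ge_atTop (1 / η)]
    with n hn hℓℓ hℓ hd1 hd₂ hup1 hup2 hlo hlog1 hlog4 hnα hnη
  have hn0 : (0 : ℝ) < n := by exact_mod_cast hn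
  have hρ0 := optSoftRisk_nonneg (θ n)
  simp only [Function.comp] at hℓℓ
  have hd := hδ₁ n
  have hd1' : δ₁ n ≤ 1 := (hδ n).trans hd1
  have hLpos := L0_div_pos hd hd1' hℓℓ hℓ
  rw [Real.norm_of_nonneg hLpos.le, Real.norm_of_nonneg hρ0] at hlo
  rw [Real.norm_of_nonneg hρ0, Real.norm_of_nonneg hn0.le] at hup1 hup2
  set ρ := optSoftRisk (θ n) with hρdef
  set D := δ₁ n * Real.log n + Real.log (Real.log n) with hD
  set R := L0 (δ₁ n) n / (n : ℝ) ^ (δ₁ n) with hR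
  have hlo' : (C₃ + 64 * (2 * C₁ * (C₀ + 1)) ^ 2) * R ≤ ε * ρ := by
    rw [div_mul_eq_mul_div, le_div_iff₀ (by positivity)] at hlo
    linarith
  have hρ : 0 < ρ := by
    have : 0 < (C₃ + 64 * (2 * C₁ * (C₀ + 1)) ^ 2) * R := by positivity
    exact pos_of_mul_pos_right (this.trans_le hlo') hε.le
  refine ⟨hρ, ?_⟩
  have hD1 : 1 ≤ D := by
    have : 0 ≤ δ₁ n * Real.log n := by positivity
    linarith
  have hD2 : D ≤ 2 * Real.log n := by
    have h1 : δ₁ n * Real.log n ≤ 1 * Real.log n := by gcongr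
    have h2 := Real.log_le_sub_one_of_pos (by linarith : 0 < Real.log n)
    linarith
  set k₀ := ⌈C₀ * (ρ + D)⌉₊ with hk₀def
  have hk₀lo : C₀ * (ρ + D) ≤ k₀ := Nat.le_ceil _
  have hk₀hi : (k₀ : ℝ) < C₀ * (ρ + D) + 1 := Nat.ceil_lt_add_one (by positivity)
  have hk₀1 : 1 ≤ k₀ := Nat.one_le_ceil_iff.2 (by positivity)
  have hC₀ρ : C₀ * ρ ≤ k₀ := le_trans (by gcongr; linarith) hk₀lo
  have hC₀D : C₀ * D ≤ k₀ := le_trans (by gcongr; linarith) hk₀lo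
  have hk₀η : (k₀ : ℝ) < 3 * η * n := by
    have h1 : C₀ * ρ ≤ η * n := by
      calc C₀ * ρ ≤ C₀ * (η / C₀ * n) := by gcongr
        _ = η * n := by field_simp
    have h2 : C₀ * D ≤ C₀ * (2 * Real.log n) := by gcongr
    rw [div_le_iff₀ hη0] at hnη
    rw [pow_one] at hlog1
    linarith
  have hk₀n : k₀ ≤ n := by
    have h1 : 4 * η * n ≤ 1 * n := by gcongr
    have : (k₀ : ℝ) ≤ n := by linarith [mul_pos hη0 hn0]
    exact_mod_cast this
  set ξ := xi α₁ n k₀ with hξdef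
  have hξ0 : 0 < ξ := xi_pos_of_mem hα₁0 hα₁ hk₀1 hk₀n
  have hZξ : Z ≤ ξ := by
    refine (gaussTail_lt_imp ?_).le
    rw [hξdef, gaussTail_xi_of_mem hα₁0 hα₁ hk₀1 hk₀n, div_lt_iff₀ hn0]
    have h1 : α₁ * k₀ ≤ 1 * k₀ := by gcongr
    have h2 : 4 * η * n ≤ gaussTail Z * n := by gcongr
    linarith [mul_pos hη0 hn0]
  obtain ⟨hξ1, hξ2, hξ3, hξ4⟩ := hZ ξ hZξ
  have hρk : 4 * ρ ≤ (1 - α₁) / 2 * k₀ := by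
    rw [div_le_iff₀ (by linarith)] at hC₀α
    have h1 : (1 - α₁) / 2 * (C₀ * ρ) ≤ (1 - α₁) / 2 * k₀ := by
      have : 0 ≤ (1 - α₁) / 2 := by linarith
      gcongr
    have h2 : 8 * ρ ≤ C₀ * (1 - α₁) * ρ := by gcongr
    linarith
  have hρL : 2 * ρ < n * excessMoment L := by linarith [mul_pos hn0 hH0]
  have hB : 2 * (2 * C₁ * (C₀ + 1)) *
      (δ₁ n * Real.log n ^ (3 / 2 : ℝ) + Real.log (Real.log n) * √(Real.log n)) ≤ √n := by
    refine Real.le_sqrt_of_sq_le (le_trans ?_ (hlog4.trans_eq (one_mul _)))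
    have h1 := base_bounds hd hd1' hℓℓ hℓ
    have h2 : 2 * (2 * C₁ * (C₀ + 1)) *
      (δ₁ n * Real.log n ^ (3 / 2 : ℝ) + Real.log (Real.log n) * √(Real.log n))
        ≤ 2 * (2 * C₁ * (C₀ + 1)) * (2 * Real.log n ^ 2) := by
      gcongr
      exact h1.2
    calc _ ≤ (2 * (2 * C₁ * (C₀ + 1)) * (2 * Real.log n ^ 2)) ^ 2 := by
          gcongr
      _ = _ := by ring
  have hCR : 64 * (2 * C₁ * (C₀ + 1)) ^ 2 * R ≤ ε * ρ := by
    have : 0 ≤ C₃ * R := by positivity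
    linarith
  have hC₃R : C₃ * R ≤ ε * ρ := by
    have : 0 ≤ 64 * (2 * C₁ * (C₀ + 1)) ^ 2 * R := by positivity
    linarith
  obtain ⟨hlev1, hlev2⟩ := hlevel n k₀ hk₀1 hk₀n
  have hnoise : 8 * (n * excessMoment (√(1 + δ₁ n) * ξ)) ≤ ε * ρ := by
    refine noise_le hd hd1' hξ0 hℓℓ hC₁ (C₂ := C₀ + 1) (by linarith) ?_ hlev1 hlev2 hρ hξ4
      (xi_le_two_mul_sqrt_log hα₁0 hα₁ hk₀1 hk₀n hnα) hB hCR
    rw [← hD]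
    linarith
  refine integral_loss_le_of_levels ht (by linarith) hκ₂.le hn hα₁0 hα₁ hα₂ hα hd (hδ n) (θ n)
    (hX n hn) (hlam_meas n hn) (hlam n hn) hε hε1 hL hL2 hLQ hA1 hA2 hA3 hk₀1 hk₀n hρ hρk hρL
    hξ1 hξ2 hξ3 hd₂ hnoise hs fun hmin => (hsum n (θ n) k₀ hmin).trans ?_
  refine le_trans ?_ hC₃R
  gcongr
  refine le_trans (Real.exp_le_exp.2 (neg_le_neg ?_)) (exp_neg_le_L0 hd hd1' hℓℓ hℓ)
  rw [← hD]
  rw [div_le_iff₀ hc] at hC₀c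
  have h1 : 2 * D ≤ C₀ * c * D := by gcongr
  have h2 : c * (C₀ * D) ≤ c * k₀ := by gcongr
  linarith

end FDRThreshold

end

/-! ### The theorem: finite risk and asymptotic optimality -/

open FDRThreshold in
theorem theorem3
    -- nominal FDR levels and Lipschitz constants
    (α₁ α₂ κ₀ κ₁ : ℝ) (hα₂ : 0 < α₂) (hα : α₂ ≤ α₁) (hα₁ : α₁ < 1)
    (hκ₁ : 1 ≤ κ₀) (hκ₂ : κ₀ < 2)
    -- the smooth threshold rules
    (t : ℝ → ℝ → ℝ) (ht : IsSmoothThreshold κ₀ κ₁ t)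
    (δ₁ δ₂ : ℕ → ℝ) (hδ₁ : ∀ n, 0 ≤ δ₁ n) (hδ : ∀ n, δ₁ n ≤ δ₂ n)
    (hδ₂ : Tendsto δ₂ atTop (𝓝 0))
    -- for each `n`, an observation `X ~ N(θ, I_n)` on some probability space
    (θ : (n : ℕ) → Fin n → ℝ)
    {Ω : ℕ → Type*} [∀ n, MeasurableSpace (Ω n)] (P : (n : ℕ) → Measure (Ω n))
    [∀ n, IsProbabilityMeasure (P n)]
    (X : (n : ℕ) → Ω n → Fin n → ℝ)
    (hX : ∀ n, 1 ≤ n → HasLaw (X n) (gaussianVec (θ n)) (P n))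
    -- the random threshold level
    (lam : (n : ℕ) → Ω n → ℝ) (hlam_meas : ∀ n, 1 ≤ n → AEMeasurable (lam n) (P n))
    (hlam : ∀ n, 1 ≤ n → ∀ᵐ ω ∂(P n),
      √(1 + δ₁ n) * xiHatUp α₁ (X n ω) ≤ lam n ω ∧
        lam n ω ≤ √(1 + δ₂ n) * xiHatDown α₂ (X n ω))
    -- the risk range
    (hlower : (fun n : ℕ => L0 (δ₁ n) n / (n : ℝ) ^ (δ₁ n))
      =o[atTop] fun n : ℕ => optSoftRisk (θ n))
    (hupper : (fun n : ℕ => optSoftRisk (θ n)) =o[atTop] fun n : ℕ => (n : ℝ)) :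
    (∀ n, 1 ≤ n →
      Integrable (fun ω => sqError (fun i => t (lam n ω) (X n ω i)) (θ n)) (P n)) ∧
    limsup (fun n : ℕ =>
      (((∫ ω, sqError (fun i => t (lam n ω) (X n ω i)) (θ n) ∂(P n)) /
        optSoftRisk (θ n) : ℝ) : EReal)) atTop ≤ 1 := by
  have hα₁0 : 0 < α₁ := hα₂.trans_le hα
  -- Integrability needs no asymptotics: any admissible choice works, here k₀ = 1, ζ = ξ_{1,1} and s
  -- = 0.
  refine ⟨fun n hn => (integral_loss_le ht (by linarith) hκ₂.le hn hα₁0 hα₁ (hδ₁ n) (θ n)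
    (hX n hn) (hlam_meas n hn) (hlam n hn) le_rfl hn le_rfl le_rfl).1, ?_⟩
  refine EReal.le_of_forall_lt_iff_le.1 fun r hr => ?_
  have hr1 : 1 < r := by exact_mod_cast hr
  -- Chosen so that 1 + 800ε ≤ r, with ε ≤ 1/2 as the finite-sample bound requires.
  have hε : 0 < min ((r - 1) / 800) (1 / 2) := lt_min (by linarith) (by norm_num)
  refine limsup_le_of_le (by isBoundedDefault) ?_
  filter_upwards [eventually_integral_loss_le hα₂ hα hα₁ hκ₁ hκ₂ ht hδ₁ hδ hδ₂ θ hX hlam_meas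
    hlam hlower hupper hε (min_le_right _ _)] with n ⟨hρ, hn⟩
  rw [EReal.coe_le_coe_iff, div_le_iff₀ hρ]
  refine hn.trans ?_
  gcongr
  linarith [min_le_left ((r - 1) / 800) (1 / 2 : ℝ)]
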